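/- Let $\hbar,k,T>0$. Consider the Hilbert space $u\otimes b\otimes w\otimes c$ of a finite-dimensional subsystem $u$, a finite-dimensional non-zero bath $b$, a weight $w$ and a clock $c$ (both $L^2(\mathbb R)$), with Hamiltonian $H=H_e+H_c+H^{\rm int}$, $H_e=H_u+H_b+H_w$, where $H_u,H_b$ are arbitrary Hermitian matrices, $H_w=X_w$ is the position operator of the weight, $H_c=P_c$ is the momentum operator of the clock, and $H^{\rm int}$ is a (possibly unbounded) self-adjoint operator that commutes strongly with $H_e$, with the clock position $X_c$ and with the weight momentum $P_w$. Assume that the sum $H$, on the intersection of the domains of its terms, is essentially self-adjoint, and let $U(t)=e^{-iHt/\hbar}$, $t\in\mathbb R$, be the unitary group generated by its closure. Let $S(\sigma)=-k\,\mathrm{tr}(\sigma\ln\sigma)$ and $F(\sigma)=\mathrm{tr}(H\sigma)-T\,S(\sigma)$ (with $H$ the Hamiltonian of the respective part, $H_u$ or $H_b$). Then there are unitaries $V(x,p,t)$ on $u\otimes b$, measurable in $(x,p)$ and depending only on the Hamiltonian, with $(U(t)\psi)(p-t,x+t)=V(x,p,t)\,\psi(p,x)$ for a.e. $(p,x)$,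 for every $\psi$ (written in the momentum representation of $w$ and the position representation of $c$), such that the following holds for every initial state $\rho(0)=\rho_u\otimes\rho_b\otimes\rho_w\otimes\rho_c$, where $\rho_u,\rho_w,\rho_c$ are arbitrary density operators and $\rho_b=e^{-H_b/kT}/\mathrm{tr}\,e^{-H_b/kT}$. Write $\rho(t)=U(t)\rho(0)U(t)^\dagger$, let $\rho_{ub}(t),\rho_u(t),\rho_b(t)$ be its reduced states, and let $\Delta$ denote the difference between times $t$ and $0$. For every $t$: 1. With $\mu(x,p)=\langle x,p|\rho_{cw}(0)|x,p\rangle$, the joint density of weight momentum and clock position in the initial state, $$\rho_{ub}(t)=\iint_{\mathbb R^2}\mu(x,p)\,V(x,p,t)\,\rho_{ub}(0)\,V^\dagger(x,p,t)\,dp\,dx .$$ 2. $\Delta S(\rho_{ub})\ge 0$ and $-\Delta S(\rho_b)\le\Delta S(\rho_u)$. 3. $\Delta F(\rho_b)\ge0$, i.e. $T\,\Delta S(\rho_b)\le\Delta\,\mathrm{tr}(H_b\rho_b)$. 4. If the mean energy of the weight is finite initially, then it is finite at time $t$, the mean of $H_e$ is finite and the same at times $0$ and $t$, and the quantities $\Delta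 U=\Delta\langle H_u\rangle$, $W=\Delta\langle H_w\rangle$, $Q=\Delta\langle H_b\rangle$ satisfy $$\Delta U+W+Q=0,\qquad W\le -T\,\Delta S(\rho_b)-\Delta U,\qquad W\le-\Delta F(\rho_u).$$ In particular $W\le 0$ if $\Delta F(\rho_u)=0$ (Kelvin–Planck: no positive work in a cyclic process). -/

import Mathlib

open MeasureTheory
open scoped ENNReal Kronecker InnerProductSpace ComplexOrder

namespace ClockEngine

noncomputable section

/-! ### Operators on a Hilbert space: trace, density operators, unitary groups, generators -/

section Abstract

variable {H : Type*} [NormedAddCommGroup H] [InnerProductSpace ℂ H] [CompleteSpace H]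

/-- The index set of a fixed Hilbert basis of `H`. -/
def basisIndex (H : Type*) [NormedAddCommGroup H] [InnerProductSpace ℂ H] [CompleteSpace H] :
    Set H :=
  (exists_hilbertBasis ℂ H).choose

/-- A fixed Hilbert basis (complete orthonormal system) of `H`. -/
def stdBasis (H : Type*) [NormedAddCommGroup H] [InnerProductSpace ℂ H] [CompleteSpace H] :
    HilbertBasis (basisIndex H) ℂ H :=
  (exists_hilbertBasis ℂ H).choose_spec.choose

/-- The trace `∑ₖ ⟨eₖ, T eₖ⟩` over a Hilbert basis. For trace-class `T` the series converges
absolutely and its value does not depend on the basis; it is used for such `T` only. -/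
def opTrace (T : H →L[ℂ] H) : ℂ :=
  ∑' k, ⟪stdBasis H k, T (stdBasis H k)⟫_ℂ

/-- A density operator: positive, of trace one. (For a positive operator the
trace series does not depend on the Hilbert basis.) -/
def IsDensityOperator (ρ : H →L[ℂ] H) : Prop :=
  ρ.IsPositive ∧ HasSum (fun k => ⟪stdBasis H k, ρ (stdBasis H k)⟫_ℂ) 1

/-- A strongly continuous one-parameter group of unitary operators. -/
structure IsUnitaryGroup (G : ℝ → H →L[ℂ] H) : Prop where
  unitary : ∀ t, G t ∈ unitary (H →L[ℂ] H)
  zero : G 0 = 1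
  add : ∀ s t, G (s + t) = G s * G t
  cont : ∀ ψ, Continuous fun t => G t ψ

/-- The generator `A` of a one-parameter group `G t = exp (-i t A / ħ)`: its domain consists of
all `ψ` for which `t ↦ G t ψ` is differentiable at `0`, and `A ψ = i ħ (d/dt) G t ψ` at `t = 0`. -/
def generator (ħ : ℝ) (G : ℝ → H →L[ℂ] H) : H →ₗ.[ℂ] H where
  domain :=
    { carrier := {ψ | DifferentiableAt ℝ (fun t => G t ψ) 0}
      zero_mem' := by simp
      add_mem' := by
        intro ψ φ hψ hφ
        have h : DifferentiableAt ℝ (fun t => G t ψ + G t φ) 0 := DifferentiableAt.fun_add hψ hφ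
        simpa using h
      smul_mem' := by
        intro c ψ hψ
        have h : DifferentiableAt ℝ (fun t => c • G t ψ) 0 :=
          DifferentiableAt.fun_const_smul hψ c
        simpa using h }
  toFun :=
    { toFun := fun ψ => (Complex.I * (ħ : ℂ)) • deriv (fun t => G t (ψ : H)) 0
      map_add' := by
        intro ψ φ
        have h : deriv (fun t => G t (ψ : H) + G t (φ : H)) 0
            = deriv (fun t => G t (ψ : H)) 0 + deriv (fun t => G t (φ : H)) 0 :=
          deriv_fun_add ψ.2 φ.2
        simp [h]
      map_smul' := by
        intro c ψ
        have h : deriv (fun t => c • G t (ψ : H)) 0 = c • deriv (fun t => G t (ψ : H)) 0 :=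
          deriv_fun_const_smul c ψ.2
        simp [h, smul_comm c] }

/-- A bounded operator `W` commutes with the (unbounded) operator `A`, i.e. `W A ⊆ A W`:
`W` maps the domain of `A` to itself, and `A W ψ = W A ψ` there. -/
def CommutesWith (A : H →ₗ.[ℂ] H) (W : H →L[ℂ] H) : Prop :=
  ∀ ψ : A.domain, ∃ h : W (ψ : H) ∈ A.domain, A ⟨W (ψ : H), h⟩ = W (A ψ)

/-- The self-adjoint operator `A` commutes with the observable `B` that generates the unitary
group `G s = exp (-i s B / c)`, `c ≠ 0`. This is the usual (strong) meaning of `[A, B] = 0` for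
unbounded self-adjoint operators: all `G s` commute with `A`. -/
def StronglyCommutes (A : H →ₗ.[ℂ] H) (G : ℝ → H →L[ℂ] H) : Prop :=
  ∀ s, CommutesWith A (G s)

/-- `U t = exp (-i t A / ħ)`, where `A` is an operator that is self-adjoint or essentially
self-adjoint: `U` is the unitary group whose generator is the closure of `A`.
By Stone's theorem such a `U` exists exactly when the closure of `A` is self-adjoint. -/
def IsEvolution (ħ : ℝ) (A : H →ₗ.[ℂ] H) (U : ℝ → H →L[ℂ] H) : Prop :=
  IsUnitaryGroup U ∧ generator ħ U = A.closure

/-- The state at time `t`: `ρ(t) = U(t) ρ(0) U(t)†`. -/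
def evolve (U : ℝ → H →L[ℂ] H) (ρ : H →L[ℂ] H) (t : ℝ) : H →L[ℂ] H :=
  U t * ρ * ContinuousLinearMap.adjoint (U t)

/-- The observable `A` with unitary group `G s = exp (-i s A / ħ)` has a finite expected value
in the state `ρ`, and this value is `E`: the distribution `ν` of `A` in the state `ρ` (the
probability measure with `∫ exp (-i s a / ħ) dν(a) = tr (ρ exp (-i s A / ħ))` for all `s`) has a
finite first moment, and its mean is `E`. -/
def HasExpectation (ħ : ℝ) (G : ℝ → H →L[ℂ] H) (ρ : H →L[ℂ] H) (E : ℝ) : Prop :=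
  ∃ ν : Measure ℝ, IsProbabilityMeasure ν ∧
    (∀ s : ℝ, ∫ a : ℝ, Complex.exp (-(Complex.I * s * a / ħ)) ∂ν = opTrace (ρ * G s)) ∧
    Integrable (fun a : ℝ => a) ν ∧ E = ∫ a : ℝ, a ∂ν

end Abstract

/-! ### Finite-dimensional thermodynamics -/

section Matrices

variable {n u b : Type*} [Fintype n] [DecidableEq n] [Fintype u] [DecidableEq u] [Fintype b]
  [DecidableEq b]

/-- Density matrices. -/
def IsDensityMatrix (σ : Matrix n n ℂ) : Prop := σ.PosSemidef ∧ σ.trace = 1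

/-- The von Neumann entropy `S(σ) = - k tr (σ log σ)`, in units in which Boltzmann's constant is
`k` (functional calculus of the Hermitian matrix `σ`, with `0 log 0 = 0`). -/
def entropy (k : ℝ) (σ : Matrix n n ℂ) : ℝ := k * (cfc Real.negMulLog σ).trace.re

/-- The mean energy `tr (h σ)`. -/
def energy (h σ : Matrix n n ℂ) : ℝ := (h * σ).trace.re

/-- The free energy `F(σ) = tr (h σ) - T S(σ)`. -/
def freeEnergy (k T : ℝ) (h σ : Matrix n n ℂ) : ℝ := energy h σ - T * entropy k σ

/-- The thermal state `exp (-h / (k T)) / tr exp (-h / (k T))`. -/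
def thermalState (k T : ℝ) (h : Matrix n n ℂ) : Matrix n n ℂ :=
  ((NormedSpace.exp (-((1 / (k * T) : ℝ) : ℂ) • h)).trace)⁻¹ •
    NormedSpace.exp (-((1 / (k * T) : ℝ) : ℂ) • h)

/-- The partial trace over `b`. -/
def traceB (σ : Matrix (u × b) (u × b) ℂ) : Matrix u u ℂ :=
  Matrix.of fun i j => ∑ k, σ (i, k) (j, k)

/-- The partial trace over `u`. -/
def traceU (σ : Matrix (u × b) (u × b) ℂ) : Matrix b b ℂ :=
  Matrix.of fun i j => ∑ k, σ (k, i) (k, j)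

/-- The Hamiltonian `H_u ⊗ 1 + 1 ⊗ H_b` of the system `s = u ⊗ b`. -/
def systemHamiltonian (Hu : Matrix u u ℂ) (Hb : Matrix b b ℂ) : Matrix (u × b) (u × b) ℂ :=
  Hu ⊗ₖ (1 : Matrix b b ℂ) + (1 : Matrix u u ℂ) ⊗ₖ Hb

end Matrices

/-! ### The space of system, weight and clock

The weight `w` is described in its momentum representation and the clock `c` in its position
representation: `ψ (p, x)` is the amplitude for weight momentum `p` and clock position `x`. -/

/-- `ℂⁿ ⊗ L²(ℝ, dp) ⊗ L²(ℝ, dx)`, realized as the `ℂⁿ`-valued functions in `L²(ℝ², dp dx)`. -/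
abbrev Total (n : Type*) [Fintype n] : Type _ :=
  Lp (EuclideanSpace ℂ n) 2 (volume : Measure (ℝ × ℝ))

/-- The space `L²(ℝ)` of the weight (in the variable `p`) or of the clock (in the variable `x`). -/
abbrev Line : Type := Lp ℂ 2 (volume : Measure ℝ)

/-- The space `L²(ℝ², dp dx)` of weight and clock. -/
abbrev WeightClock : Type := Lp ℂ 2 (volume : Measure (ℝ × ℝ))

section Space

variable {n : Type*} [Fintype n]

/-- The product vector `(p, x) ↦ f(p) g(x) v`. -/
def tensorFun (v : EuclideanSpace ℂ n) (f g : Line) (z : ℝ × ℝ) : EuclideanSpace ℂ n :=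
  (f z.1 * g z.2) • v

lemma memLp_tensorFun (v : EuclideanSpace ℂ n) (f g : Line) :
    MemLp (tensorFun v f g) 2 (volume : Measure (ℝ × ℝ)) := by
  have hf : AEStronglyMeasurable (fun z : ℝ × ℝ => f z.1) volume :=
    (Lp.aestronglyMeasurable f).comp_fst
  have hg : AEStronglyMeasurable (fun z : ℝ × ℝ => g z.2) volume :=
    (Lp.aestronglyMeasurable g).comp_snd
  have hm : AEStronglyMeasurable (tensorFun v f g) (volume : Measure (ℝ × ℝ)) :=
    (hf.mul hg).smul_const v
  rw [memLp_two_iff_integrable_sq_norm hm]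
  have h1 := (memLp_two_iff_integrable_sq_norm (Lp.aestronglyMeasurable f)).1 (Lp.memLp f)
  have h2 := (memLp_two_iff_integrable_sq_norm (Lp.aestronglyMeasurable g)).1 (Lp.memLp g)
  have h3 := (h1.mul_prod h2).mul_const (‖v‖ ^ 2)
  refine h3.congr (Filter.Eventually.of_forall fun z => ?_)
  simp [tensorFun, norm_smul, mul_pow]

/-- The vector `v ⊗ f ⊗ g` of the total space. -/
def tensor (v : EuclideanSpace ℂ n) (f g : Line) : Total n := (memLp_tensorFun v f g).toLp

variable [DecidableEq n]

/-- `ρ = σ ⊗ ρw ⊗ ρc`: the bounded operator that acts factorwise on product vectors (these span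
a dense subspace, so that `ρ` is determined by its factors). -/
def IsProductOperator (ρ : Total n →L[ℂ] Total n) (σ : Matrix n n ℂ)
    (ρw ρc : Line →L[ℂ] Line) : Prop :=
  ∀ (v : EuclideanSpace ℂ n) (f g : Line),
    ρ (tensor v f g) = tensor (Matrix.toEuclideanCLM (n := n) (𝕜 := ℂ) σ v) (ρw f) (ρc g)

/-- The operator `M ⊗ 1 ⊗ 1`, for a matrix `M`. -/
def matOp (M : Matrix n n ℂ) : Total n →L[ℂ] Total n :=
  (Matrix.toEuclideanCLM (n := n) (𝕜 := ℂ) M).compLpL 2 (volume : Measure (ℝ × ℝ))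

/-- Multiplication by a bounded measurable function of `(p, x)`. -/
def mulOp (g : Lp ℂ ∞ (volume : Measure (ℝ × ℝ))) : Total n →L[ℂ] Total n :=
  (ContinuousLinearMap.lsmul ℂ ℂ : ℂ →L[ℂ] EuclideanSpace ℂ n →L[ℂ] EuclideanSpace ℂ n).holderL
    (volume : Measure (ℝ × ℝ)) ∞ 2 2 g

lemma memLp_phase (q : ℝ × ℝ →L[ℝ] ℝ) :
    MemLp (fun z : ℝ × ℝ => Complex.exp (-(Complex.I * (q z : ℂ)))) ∞
      (volume : Measure (ℝ × ℝ)) := by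
  refine memLp_top_of_bound (C := 1) ?_ ?_
  · exact Continuous.aestronglyMeasurable (by fun_prop)
  · refine Filter.Eventually.of_forall fun z => ?_
    simp [Complex.norm_exp]

/-- The group `exp (-i a P_w)`: multiplication by `exp (-i a p)`. -/
def phaseP (a : ℝ) : Total n →L[ℂ] Total n :=
  mulOp (memLp_phase (a • ContinuousLinearMap.fst ℝ ℝ ℝ)).toLp

/-- The group `exp (-i a X_c)`: multiplication by `exp (-i a x)`. -/
def phaseX (a : ℝ) : Total n →L[ℂ] Total n :=
  mulOp (memLp_phase (a • ContinuousLinearMap.snd ℝ ℝ ℝ)).toLp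

/-- The group `exp (-i s H_w / ħ)` with `H_w = X_w = i ħ ∂/∂p`, i.e. `ψ(p, x) ↦ ψ(p + s, x)`. -/
def shiftP (s : ℝ) : Total n →L[ℂ] Total n :=
  (Lp.compMeasurePreservingₗᵢ ℂ (fun z : ℝ × ℝ => z + ((s, 0) : ℝ × ℝ))
    (measurePreserving_add_right volume ((s, 0) : ℝ × ℝ))).toContinuousLinearMap

/-- The group `exp (-i s H_c / ħ)` with `H_c = P_c = -i ħ ∂/∂x`, i.e. `ψ(p, x) ↦ ψ(p, x - s)`. -/
def shiftX (s : ℝ) : Total n →L[ℂ] Total n :=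
  (Lp.compMeasurePreservingₗᵢ ℂ (fun z : ℝ × ℝ => z + ((0, -s) : ℝ × ℝ))
    (measurePreserving_add_right volume ((0, -s) : ℝ × ℝ))).toContinuousLinearMap

/-- The Hamiltonian `H_w = X_w` of the weight, as a self-adjoint operator on the total space. -/
def weightHamiltonian (n : Type*) [Fintype n] [DecidableEq n] (ħ : ℝ) : Total n →ₗ.[ℂ] Total n :=
  generator ħ shiftP

/-- The Hamiltonian `H_c = P_c` of the clock, as a self-adjoint operator on the total space. -/
def clockHamiltonian (n : Type*) [Fintype n] [DecidableEq n] (ħ : ℝ) : Total n →ₗ.[ℂ] Total n :=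
  generator ħ shiftX

/-- The group `exp (-i s H_e / ħ)` of the engine Hamiltonian `H_e = Hs + H_w`, where `Hs` is the
Hamiltonian of the system: the product of the commuting groups of `Hs` and of `H_w`. -/
def engineGroup (ħ : ℝ) (Hs : Matrix n n ℂ) (s : ℝ) : Total n →L[ℂ] Total n :=
  matOp (NormedSpace.exp (-(Complex.I * s / ħ) • Hs)) * shiftP s

/-- The total Hamiltonian `H = Hs + H_w + H_c + H_int`, on the intersection of the domains. -/
def totalHamiltonian (ħ : ℝ) (Hs : Matrix n n ℂ) (Hint : Total n →ₗ.[ℂ] Total n) :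
    Total n →ₗ.[ℂ] Total n :=
  (matOp Hs).toPMap ⊤ + weightHamiltonian n ħ + clockHamiltonian n ħ + Hint

/-- The isometry `f ↦ |j⟩ ⊗ f` from the space of weight and clock to the total space. -/
def ketTensor (j : n) : WeightClock →L[ℂ] Total n :=
  (ContinuousLinearMap.toSpanSingleton ℂ (EuclideanSpace.single j (1 : ℂ))).compLpL 2
    (volume : Measure (ℝ × ℝ))

/-- The reduced state `tr_wc ρ` of the system: `⟨i| tr_wc ρ |j⟩ = tr ((⟨i| ⊗ 1) ρ (|j⟩ ⊗ 1))`. -/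
def traceWC (ρ : Total n →L[ℂ] Total n) : Matrix n n ℂ :=
  Matrix.of fun i j => opTrace ((ContinuousLinearMap.adjoint (ketTensor i)) ∘L ρ ∘L (ketTensor j))

lemma memLp_indicator (B : Set (ℝ × ℝ)) (hB : MeasurableSet B) :
    MemLp (B.indicator fun _ => (1 : ℂ)) ∞ (volume : Measure (ℝ × ℝ)) :=
  (memLp_top_const (1 : ℂ)).indicator hB

/-- `μ (p, x) = ⟨x, p| ρ_cw |x, p⟩`: `μ` is the joint probability density of the weight's momentum
and the clock's position in the state `ρ`, i.e. `∫_B μ dp dx = tr (ρ 1_B(P_w, X_c))`. -/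
structure IsJointDensity (ρ : Total n →L[ℂ] Total n) (μ : ℝ × ℝ → ℝ) : Prop where
  measurable : Measurable μ
  nonneg : ∀ z, 0 ≤ μ z
  integrable : Integrable μ (volume : Measure (ℝ × ℝ))
  setIntegral : ∀ (B : Set (ℝ × ℝ)) (hB : MeasurableSet B),
    ((∫ z in B, μ z : ℝ) : ℂ) = opTrace (ρ * mulOp (memLp_indicator B hB).toLp)

end Space

end

end ClockEngine

set_option linter.unusedSectionVars false

namespace ClockEngine

/-! ### Ensembles of vectors and the trace -/

section Ensemble

variable {H K : Type*} [NormedAddCommGroup H] [InnerProductSpace ℂ H] [CompleteSpace H]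
  [NormedAddCommGroup K] [InnerProductSpace ℂ K] [CompleteSpace K] {ι κ : Type*}

/-! Fibres of the evolution. `X_w` and `P_c` generate translations of the weight momentum `p` and
the clock position `x`, and all other terms of `H` commute with functions of `(p, x)`. Conjugation
by a character `exp (-i q(p, x))` therefore changes `H` by a real constant only. Passing to the
closure (`Intertwines.closure`) and integrating (`Intertwines.group`) gives the Weyl-type relation
`IsEvolution.mul_phase`, whose scalar is inverse to the one for translation by `(-t, t)`. So `shift
(-t, t) * U t` commutes with all characters. An isometry with this property is a measurable field of
unitary matrices (`exists_fibres`), because an integrable function whose Fourier transform vanishes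
is zero. This gives `V` without solving the Schrödinger equation.

Entropy. A density operator is a countable sum of terms `|φₗ⟩⟨φₗ|` (`exists_isEnsemble`), so that
traces become sums of integrals of wave functions. For a product state the matrix density at `(p,
x)` is `μ(p, x) σ` (`IsProductOperator.ae_ensembleMatrix`); weight and clock then act as classical
randomness, and the reduced state becomes the `μ`-mixture of the matrices `V σ V†`. Between the
eigenvalues of the initial and the final reduced state such a mixture is a doubly stochastic matrix,
and concavity of `-x log x` makes the entropy grow. Additivity at time `0` and subadditivity at time
`t` (`entropy_le_add`) give the entropy exchange between `u` and `b`; the Gibbs variational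
principle (`freeEnergy_thermalState_le`) gives the free energy of the bath.

Energy. The group of `H_e` commutes with `U t`, so the whole distribution of `H_e` is conserved.
Resolved along an eigenbasis of the system Hamiltonian, this distribution is a finite sum of shifted
copies of partial distributions of `H_w`. Hence one mean is finite exactly when the other is, and
they differ by the mean energy of the system (`IsEnsemble.hasExpectation_engineGroup_iff`). This is
the first law; the bounds on the work are linear combinations of it with the previous inequalities.
-/

/-- `ρ = ∑ₗ |φₗ⟩⟨φₗ|` (weakly), with `∑ₗ ‖φₗ‖² < ∞`. -/
structure IsEnsemble (φ : ι → H) (ρ : H →L[ℂ] H) : Prop where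
  summable : Summable fun l => ‖φ l‖ ^ 2
  hasSum : ∀ x y, HasSum (fun l => ⟪y, φ l⟫_ℂ * ⟪φ l, x⟫_ℂ) ⟪y, ρ x⟫_ℂ

lemma HilbertBasis.hasSum_norm_inner_sq (e : HilbertBasis κ ℂ H) (x : H) :
    HasSum (fun k => ‖⟪e k, x⟫_ℂ‖ ^ 2) (‖x‖ ^ 2) := by
  have h := Complex.hasSum_re (e.hasSum_inner_mul_inner x x)
  rw [inner_self_eq_norm_sq_to_K] at h
  convert h using 1
  · funext k
    rw [← inner_conj_symm x (e k), Complex.conj_mul']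
    norm_cast
  · norm_cast

/-- The double series behind the trace of `X† |φ⟩⟨φ| Y`. -/
lemma summable_inner_mul_inner (e : HilbertBasis κ ℂ H) {a b : ι → H}
    (ha : Summable fun l => ‖a l‖ ^ 2) (hb : Summable fun l => ‖b l‖ ^ 2) :
    Summable fun q : ι × κ => ⟪b q.1, e q.2⟫_ℂ * ⟪e q.2, a q.1⟫_ℂ := by
  have key : ∀ c : ι → H, (Summable fun l => ‖c l‖ ^ 2) →
      Summable fun q : ι × κ => ‖⟪e q.2, c q.1⟫_ℂ‖ ^ 2 := by
    intro c hc
    rw [summable_prod_of_nonneg (fun q => by positivity)]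
    refine ⟨fun l => (HilbertBasis.hasSum_norm_inner_sq e (c l)).summable, ?_⟩
    simpa only [(HilbertBasis.hasSum_norm_inner_sq e _).tsum_eq] using hc
  refine Summable.of_norm_bounded ((key a ha).add (key b hb)) fun q => ?_
  rw [norm_mul, norm_inner_symm]
  nlinarith [sq_nonneg (‖⟪e q.2, a q.1⟫_ℂ‖ - ‖⟪e q.2, b q.1⟫_ℂ‖),
    sq_nonneg (‖⟪e q.2, a q.1⟫_ℂ‖), sq_nonneg (‖⟪e q.2, b q.1⟫_ℂ‖)]

lemma summable_norm_sq_apply (X : H →L[ℂ] K) {a : ι → H} (ha : Summable fun l => ‖a l‖ ^ 2) :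
    Summable fun l => ‖X (a l)‖ ^ 2 := by
  refine Summable.of_nonneg_of_le (fun _ => by positivity) (fun l => ?_) (ha.mul_left (‖X‖ ^ 2))
  rw [← mul_pow]
  gcongr
  exact X.le_opNorm _

/-- Absolute convergence of the double series allows the sum over the basis to be done first, by
Parseval. The two maps `X` and `Y` from another space cover partial traces as well as expectation
values. -/
lemma IsEnsemble.opTrace_comp {φ : ι → H} {ρ : H →L[ℂ] H} (h : IsEnsemble φ ρ)
    (X Y : K →L[ℂ] H) :
    opTrace ((ContinuousLinearMap.adjoint X) ∘L ρ ∘L Y) =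
      ∑' l, ⟪ContinuousLinearMap.adjoint Y (φ l), ContinuousLinearMap.adjoint X (φ l)⟫_ℂ := by
  have hs := summable_inner_mul_inner (stdBasis K)
    (summable_norm_sq_apply (ContinuousLinearMap.adjoint X) h.summable)
    (summable_norm_sq_apply (ContinuousLinearMap.adjoint Y) h.summable)
  have h1 : ∀ l, ∑' k, ⟪ContinuousLinearMap.adjoint Y (φ l), stdBasis K k⟫_ℂ *
      ⟪stdBasis K k, ContinuousLinearMap.adjoint X (φ l)⟫_ℂ =
      ⟪ContinuousLinearMap.adjoint Y (φ l), ContinuousLinearMap.adjoint X (φ l)⟫_ℂ :=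
    fun l => ((stdBasis K).hasSum_inner_mul_inner _ _).tsum_eq
  simp_rw [← h1]
  rw [← Summable.tsum_comm (f := fun l k => ⟪ContinuousLinearMap.adjoint Y (φ l), stdBasis K k⟫_ℂ *
      ⟪stdBasis K k, ContinuousLinearMap.adjoint X (φ l)⟫_ℂ) hs]
  refine tsum_congr fun k => ?_
  simp only [ContinuousLinearMap.comp_apply, ContinuousLinearMap.adjoint_inner_right,
    ContinuousLinearMap.adjoint_inner_left]
  rw [← (h.hasSum _ _).tsum_eq]
  exact tsum_congr fun l => mul_comm _ _

lemma IsEnsemble.opTrace_mul {φ : ι → H} {ρ : H →L[ℂ] H} (h : IsEnsemble φ ρ) (M : H →L[ℂ] H) :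
    opTrace (ρ * M) = ∑' l, ⟪φ l, M (φ l)⟫_ℂ := by
  have := h.opTrace_comp (ContinuousLinearMap.id ℂ H) M
  rw [ContinuousLinearMap.adjoint_id, ContinuousLinearMap.id_comp] at this
  change opTrace (ρ ∘L M) = _
  simpa only [ContinuousLinearMap.adjoint_inner_left, ContinuousLinearMap.id_apply] using this

lemma IsEnsemble.evolve {φ : ι → H} {ρ : H →L[ℂ] H} (h : IsEnsemble φ ρ) (U : ℝ → H →L[ℂ] H)
    (t : ℝ) : IsEnsemble (fun l => U t (φ l)) (evolve U ρ t) where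
  summable := summable_norm_sq_apply _ h.summable
  hasSum x y := by
    have := h.hasSum (ContinuousLinearMap.adjoint (U t) x) (ContinuousLinearMap.adjoint (U t) y)
    simpa [ClockEngine.evolve, ContinuousLinearMap.adjoint_inner_left,
      ContinuousLinearMap.adjoint_inner_right] using this

/-- With `S` the positive square root of `ρ`, the vectors `S eₖ` form an ensemble: Parseval for `⟪S
y, S x⟫` gives the weak sum. No spectral decomposition of `ρ` is needed. -/
lemma exists_isEnsemble {H : Type*} [NormedAddCommGroup H] [InnerProductSpace ℂ H]
    [CompleteSpace H] {ρ : H →L[ℂ] H} (hρ : IsDensityOperator ρ) :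
    ∃ (ι : Set H) (φ : ι → H), Countable ι ∧ IsEnsemble φ ρ ∧ ∑' l, ‖φ l‖ ^ 2 = 1 := by
  have h0 : 0 ≤ ρ := (ContinuousLinearMap.nonneg_iff_isPositive ρ).2 hρ.1
  set S := CFC.sqrt ρ with hS
  have hSS : S * S = ρ := CFC.sqrt_mul_sqrt_self ρ h0
  have hSa : ContinuousLinearMap.adjoint S = S := by
    rw [← ContinuousLinearMap.star_eq_adjoint]
    exact (IsSelfAdjoint.of_nonneg (CFC.sqrt_nonneg ρ)).star_eq
  have hsw : ∀ x y, ⟪S x, y⟫_ℂ = ⟪x, S y⟫_ℂ := fun x y => by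
    conv_lhs => rw [← hSa]
    rw [ContinuousLinearMap.adjoint_inner_left]
  have hn : HasSum (fun k => ‖S (stdBasis H k)‖ ^ 2) 1 := by
    have h := Complex.hasSum_re hρ.2
    convert h using 1
    · funext k
      rw [← hSS, mul_apply_eq_comp, ← hsw, inner_self_eq_norm_sq_to_K]
      norm_cast
    · simp
  have hens : ∀ x y, HasSum (fun l => ⟪y, S (stdBasis H l)⟫_ℂ * ⟪S (stdBasis H l), x⟫_ℂ)
      ⟪y, ρ x⟫_ℂ := fun x y => by
    have := (stdBasis H).hasSum_inner_mul_inner (S y) (S x)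
    rw [hsw y (S x), ← mul_apply_eq_comp, hSS] at this
    simpa only [hsw] using this
  -- Only the nonzero vectors are kept. Their norms are square summable, so the index set is
  -- countable even if `H` is not separable; countability is what the measure theory below requires.
  set ι : Set (basisIndex H) := Function.support fun k => ‖S (stdBasis H k)‖ ^ 2 with hι
  have hc : ι.Countable := hn.summable.countable_support
  have hz : ∀ k, k ∉ ι → S (stdBasis H k) = 0 := fun k hk => by
    simpa [hι] using hk
  have hinj : Function.Injective (fun k : basisIndex H => (k : H)) := Subtype.val_injective
  let E : ι ≃ (Subtype.val '' ι : Set H) := Equiv.Set.image _ ι hinj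
  refine ⟨Subtype.val '' ι, fun l => S (stdBasis H (E.symm l)), ?_, ⟨?_, ?_⟩, ?_⟩
  · exact (hc.image _).to_subtype
  · have := hn.summable.subtype ι
    exact (E.symm.summable_iff (f := fun k : ι => ‖S (stdBasis H k)‖ ^ 2)).2 this
  · intro x y
    have h2 := (hasSum_subtype_iff_of_support_subset (s := ι) (fun k hk => by
      by_contra hk'
      simp [hz k hk'] at hk)).2 (hens x y)
    exact (E.symm.hasSum_iff (f := fun l : ι => ⟪y, S (stdBasis H l)⟫_ℂ *
      ⟪S (stdBasis H l), x⟫_ℂ)).2 h2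
  · have h2 := (hasSum_subtype_iff_of_support_subset (s := ι) (le_refl _)).2 hn
    exact ((E.symm.hasSum_iff (f := fun k : ι => ‖S (stdBasis H k)‖ ^ 2)).2 h2).tsum_eq

end Ensemble

end ClockEngine

namespace ClockEngine

/-! ### Intertwining relations and one-parameter groups -/

section Groups

variable {H : Type*} [NormedAddCommGroup H] [InnerProductSpace ℂ H] [CompleteSpace H]

/-- `A W = W A + c W` on the domain of `A`, which `W` leaves invariant. -/
def Intertwines (A : H →ₗ.[ℂ] H) (W : H →L[ℂ] H) (c : ℂ) : Prop :=
  ∀ ψ : A.domain, ∃ h : W (ψ : H) ∈ A.domain, A ⟨W (ψ : H), h⟩ = W (A ψ) + c • W (ψ : H)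

lemma CommutesWith.intertwines {A : H →ₗ.[ℂ] H} {W : H →L[ℂ] H} (h : CommutesWith A W) :
    Intertwines A W 0 := by
  intro ψ
  obtain ⟨h1, h2⟩ := h ψ
  exact ⟨h1, by simpa using h2⟩

lemma Intertwines.add {A B : H →ₗ.[ℂ] H} {W : H →L[ℂ] H} {c d : ℂ} (hA : Intertwines A W c)
    (hB : Intertwines B W d) : Intertwines (A + B) W (c + d) := by
  intro ψ
  obtain ⟨h1, h2⟩ := hA ⟨ψ, ψ.2.1⟩
  obtain ⟨h3, h4⟩ := hB ⟨ψ, ψ.2.2⟩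
  refine ⟨⟨h1, h3⟩, ?_⟩
  have e1 : (A + B) ⟨W (ψ : H), ⟨h1, h3⟩⟩ = A ⟨W (ψ : H), h1⟩ + B ⟨W (ψ : H), h3⟩ :=
    LinearPMap.add_apply A B _
  have e2 : (A + B) ψ = A ⟨ψ, ψ.2.1⟩ + B ⟨ψ, ψ.2.2⟩ := LinearPMap.add_apply A B _
  rw [e1, e2, h2, h4, map_add, add_smul]
  abel

lemma intertwines_toPMap {B W : H →L[ℂ] H} (h : B * W = W * B) :
    Intertwines (B.toPMap ⊤) W 0 := by
  intro ψ
  refine ⟨Submodule.mem_top, ?_⟩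
  have := congrArg (fun X : H →L[ℂ] H => X (ψ : H)) h
  change B (W ψ) = W (B ψ) + (0 : ℂ) • W (ψ : H)
  simpa using this

/-- The relation says that the continuous map `(x, y) ↦ (W x, W y + c W x)` preserves the graph of
`A`; it then preserves the closure of the graph. -/
lemma Intertwines.closure {A : H →ₗ.[ℂ] H} {W : H →L[ℂ] H} {c : ℂ} (h : Intertwines A W c) :
    Intertwines A.closure W c := by
  by_cases hA : A.IsClosable
  · intro ψ
    have hmem : ((ψ : H), A.closure ψ) ∈ A.graph.topologicalClosure := by
      rw [hA.graph_closure_eq_closure_graph]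
      exact A.closure.mem_graph ψ
    have hcont : Continuous fun q : H × H => (W q.1, W q.2 + c • W q.1) := by fun_prop
    have h2 : (W (ψ : H), W (A.closure ψ) + c • W (ψ : H)) ∈ A.graph.topologicalClosure := by
      refine map_mem_closure (f := fun q : H × H => (W q.1, W q.2 + c • W q.1)) hcont hmem ?_
      rintro ⟨x, y⟩ hxy
      obtain ⟨z, rfl, rfl⟩ := LinearPMap.mem_graph_iff A |>.1 hxy
      obtain ⟨h3, h4⟩ := h z
      exact (LinearPMap.mem_graph_iff A).2 ⟨⟨W z, h3⟩, rfl, h4⟩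
    rw [hA.graph_closure_eq_closure_graph, LinearPMap.mem_graph_iff] at h2
    obtain ⟨y, hy, hy2⟩ := h2
    simp only at hy hy2
    refine ⟨hy ▸ y.2, ?_⟩
    rw [← hy2]
    congr 1
    exact Subtype.ext hy.symm
  -- For an operator that is not closable, `closure` is by convention the operator itself.
  · rwa [LinearPMap.closure_def' hA]

/-! ### Differentiation along unitary groups -/

lemma IsUnitaryGroup.inner_map {G : ℝ → H →L[ℂ] H} (hG : IsUnitaryGroup G) (t : ℝ) (x y : H) :
    ⟪G t x, G t y⟫_ℂ = ⟪x, y⟫_ℂ := by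
  have h := (Unitary.mem_iff.1 (hG.unitary t)).1
  rw [← ContinuousLinearMap.adjoint_inner_right, ← ContinuousLinearMap.star_eq_adjoint,
    ← mul_apply_eq_comp, h, one_apply_eq_self]

lemma IsUnitaryGroup.apply_neg {G : ℝ → H →L[ℂ] H} (hG : IsUnitaryGroup G) (t : ℝ) (x : H) :
    G t (G (-t) x) = x := by
  rw [← mul_apply_eq_comp, ← hG.add, add_neg_cancel, hG.zero, one_apply_eq_self]

lemma IsUnitaryGroup.inner_apply {G : ℝ → H →L[ℂ] H} (hG : IsUnitaryGroup G) (t : ℝ) (x y : H) :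
    ⟪G t x, y⟫_ℂ = ⟪x, G (-t) y⟫_ℂ := by
  rw [← hG.inner_map t x, hG.apply_neg]

lemma IsUnitaryGroup.hasDerivAt {G : ℝ → H →L[ℂ] H} (hG : IsUnitaryGroup G) {ψ : H}
    (hψ : DifferentiableAt ℝ (fun t => G t ψ) 0) (t : ℝ) :
    HasDerivAt (fun s => G s ψ) (G t (deriv (fun s => G s ψ) 0)) t := by
  have h1 : HasDerivAt (fun s => G s ψ) (deriv (fun s => G s ψ) 0) (t - t) := by
    rw [sub_self]; exact hψ.hasDerivAt
  have h2 := HasDerivAt.comp_sub_const t t h1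
  have h3 : HasDerivAt (fun s => ((G t).restrictScalars ℝ) (G (s - t) ψ))
      ((G t).restrictScalars ℝ (deriv (fun s => G s ψ) 0)) t :=
    ((G t).restrictScalars ℝ).hasFDerivAt.comp_hasDerivAt t h2
  refine h3.congr_of_eventuallyEq (Filter.Eventually.of_forall fun s => ?_)
  simp [← mul_apply_eq_comp, ← hG.add]

lemma IsUnitaryGroup.differentiableAt_apply {G : ℝ → H →L[ℂ] H} (hG : IsUnitaryGroup G) {ψ : H}
    (hψ : DifferentiableAt ℝ (fun t => G t ψ) 0) (s : ℝ) :
    DifferentiableAt ℝ (fun t => G t (G s ψ)) 0 ∧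
      deriv (fun t => G t (G s ψ)) 0 = G s (deriv (fun t => G t ψ) 0) := by
  have h1 : HasDerivAt (fun t => ((G s).restrictScalars ℝ) (G t ψ))
      ((G s).restrictScalars ℝ (deriv (fun s => G s ψ) 0)) 0 :=
    ((G s).restrictScalars ℝ).hasFDerivAt.comp_hasDerivAt 0 hψ.hasDerivAt
  have h2 : HasDerivAt (fun t => G t (G s ψ)) (G s (deriv (fun s => G s ψ) 0)) 0 := by
    refine h1.congr_of_eventuallyEq (Filter.Eventually.of_forall fun t => ?_)
    simp only [ContinuousLinearMap.coe_restrictScalars', ← mul_apply_eq_comp, ← hG.add,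
      add_comm]
  exact ⟨h2.differentiableAt, h2.deriv⟩

/-- Differentiate the constant function `⟪G t x, G t y⟫` at `0`: this is the symmetry of the
generator. -/
lemma IsUnitaryGroup.inner_deriv {G : ℝ → H →L[ℂ] H} (hG : IsUnitaryGroup G) {x y : H}
    (hx : DifferentiableAt ℝ (fun t => G t x) 0) (hy : DifferentiableAt ℝ (fun t => G t y) 0) :
    ⟪deriv (fun t => G t x) 0, y⟫_ℂ = -⟪x, deriv (fun t => G t y) 0⟫_ℂ := by
  have h := (hx.hasDerivAt.inner ℂ hy.hasDerivAt)
  have h2 : HasDerivAt (fun t => ⟪G t x, G t y⟫_ℂ) 0 0 := by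
    simpa only [hG.inner_map] using hasDerivAt_const (0 : ℝ) ⟪x, y⟫_ℂ
  have := h.unique h2
  simp only [hG.zero, one_apply_eq_self] at this
  linear_combination this

/-- Averages along the orbit are smooth vectors: `G t` merely shifts the interval of integration in
`∫ s in 0..h, G s ψ`. Divided by `h`, these integrals tend to `ψ`. -/
lemma IsUnitaryGroup.dense_domain {G : ℝ → H →L[ℂ] H} (hG : IsUnitaryGroup G) (ψ : H) :
    ψ ∈ closure {x | DifferentiableAt ℝ (fun t => G t x) 0} := by
  have hint : ∀ a b, IntervalIntegrable (fun s => G s ψ) volume a b :=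
    fun a b => (hG.cont ψ).intervalIntegrable a b
  have hd : ∀ b, HasDerivAt (fun h => ∫ s in (0 : ℝ)..h, G s ψ) (G b ψ) b := fun b =>
    intervalIntegral.integral_hasDerivAt_right (hint 0 b)
      ((hG.cont ψ).stronglyMeasurableAtFilter _ _) (hG.cont ψ).continuousAt
  have hmem : ∀ h, DifferentiableAt ℝ (fun t => G t (∫ s in (0 : ℝ)..h, G s ψ)) 0 := by
    intro h
    have h1 : ∀ t, G t (∫ s in (0 : ℝ)..h, G s ψ) =
        (∫ s in (0 : ℝ)..(t + h), G s ψ) - ∫ s in (0 : ℝ)..t, G s ψ := by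
      intro t
      rw [← ContinuousLinearMap.intervalIntegral_comp_comm _ (hint 0 h),
        intervalIntegral.integral_interval_sub_left (hint _ _) (hint _ _)]
      simp_rw [← mul_apply_eq_comp, ← hG.add]
      rw [intervalIntegral.integral_comp_add_left (fun s => G s ψ) t]
      simp
    simp_rw [h1]
    have h2 : DifferentiableAt ℝ (fun t : ℝ => ∫ s in (0 : ℝ)..(t + h), G s ψ) 0 :=
      (HasDerivAt.comp_add_const 0 h (hd (0 + h))).differentiableAt
    exact h2.sub (hd 0).differentiableAt
  have ht := (hasDerivAt_iff_tendsto_slope.1 (hd 0))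
  rw [hG.zero, one_apply_eq_self] at ht
  refine mem_closure_of_tendsto ht (Filter.Eventually.of_forall fun h => ?_)
  simp only [slope, sub_zero, intervalIntegral.integral_same, vsub_eq_sub, Set.mem_ofPred_eq]
  simp only [ContinuousLinearMap.map_smul_of_tower]
  exact (hmem h).fun_const_smul (h⁻¹ : ℝ)

/-- A relation between the generator and `W` integrates to the group. -/
lemma Intertwines.group {G : ℝ → H →L[ℂ] H} (hG : IsUnitaryGroup G) {ħ : ℝ} (hħ : ħ ≠ 0)
    {W : H →L[ℂ] H} {c : ℂ} (h : Intertwines (generator ħ G) W c) (t : ℝ) :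
    G t * W = Complex.exp (-(Complex.I * c * t / ħ)) • (W * G t) := by
  have hħ' : (ħ : ℂ) ≠ 0 := by exact_mod_cast hħ
  set D : H → H := fun x => deriv (fun t => G t x) 0 with hD
  have hW : ∀ x, DifferentiableAt ℝ (fun t => G t x) 0 →
      DifferentiableAt ℝ (fun t => G t (W x)) 0 ∧
        D (W x) = W (D x) + (-(Complex.I * c / ħ)) • W x := by
    intro x hx
    obtain ⟨h1, h2⟩ := h ⟨x, hx⟩
    refine ⟨h1, ?_⟩
    have h3 : (Complex.I * (ħ : ℂ)) • D (W x) =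
        W ((Complex.I * (ħ : ℂ)) • D x) + c • W x := h2
    have hne : Complex.I * (ħ : ℂ) ≠ 0 := mul_ne_zero Complex.I_ne_zero hħ'
    have h4 := congrArg (fun z => (Complex.I * (ħ : ℂ))⁻¹ • z) h3
    simp only [map_smul, smul_add, smul_smul, inv_mul_cancel₀ hne, one_smul] at h4
    rw [h4]
    congr 2
    field_simp
    linear_combination c * Complex.I_sq
  -- For vectors in the domain, `exp (-i c s / ħ) ⟪G s x, W (G s y)⟫` has zero derivative: the
  -- skew-symmetry moves the derivative from the left factor across `W`, and the commutation
  -- relation leaves exactly the term that the exponential cancels.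
  have key : ∀ x y, DifferentiableAt ℝ (fun t => G t x) 0 →
      DifferentiableAt ℝ (fun t => G t y) 0 →
      ⟪G t x, W (G t y)⟫_ℂ = Complex.exp (Complex.I * c * t / ħ) * ⟪x, W y⟫_ℂ := by
    intro x y hx hy
    have hder : ∀ s, HasDerivAt
        (fun s : ℝ => Complex.exp (-(Complex.I * c * s / ħ)) * ⟪G s x, W (G s y)⟫_ℂ) 0 s := by
      intro s
      have h1 : HasDerivAt (fun s => ((W.restrictScalars ℝ)) (G s y))
          ((W.restrictScalars ℝ) (G s (D y))) s :=
        (W.restrictScalars ℝ).hasFDerivAt.comp_hasDerivAt s (hG.hasDerivAt hy s)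
      have h2 := (hG.hasDerivAt hx s).inner ℂ h1
      have h3 : HasDerivAt (fun s : ℝ => Complex.exp (-(Complex.I * c * s / ħ)))
          (Complex.exp (-(Complex.I * c * s / ħ)) * (-(Complex.I * c / ħ))) s := by
        have h4 : HasDerivAt (fun s : ℝ => -(Complex.I * c * (s : ℂ) / ħ))
            (-(Complex.I * c / ħ)) s := by
          have := (((Complex.ofRealCLM.hasDerivAt (x := s)).const_mul
            (Complex.I * c)).div_const (ħ : ℂ)).fun_neg
          simpa using this
        exact h4.cexp
      refine (h3.mul h2).congr_deriv ?_
      obtain ⟨h5, h6⟩ := hG.differentiableAt_apply hx s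
      obtain ⟨h7, h8⟩ := hG.differentiableAt_apply hy s
      obtain ⟨h9, h10⟩ := hW _ h7
      have h11 := hG.inner_deriv h5 h9
      rw [h6] at h11
      simp only [hD] at h10 ⊢
      rw [h10, h8, inner_add_right, inner_smul_right] at h11
      simp only [ContinuousLinearMap.coe_restrictScalars']
      rw [h11]
      ring
    have hconst := is_const_of_deriv_eq_zero (𝕜 := ℝ) (fun s => (hder s).differentiableAt)
      (fun s => (hder s).deriv) t 0
    simp only [hG.zero, one_apply_eq_self, Complex.ofReal_zero, mul_zero, zero_div,
      neg_zero, Complex.exp_zero, one_mul] at hconst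
    rw [← hconst, ← mul_assoc, ← Complex.exp_add, add_neg_cancel, Complex.exp_zero, one_mul]
  -- Both sides are jointly continuous, so density of the domain in each variable removes the
  -- restriction to it.
  have key2 : ∀ x y, ⟪G t x, W (G t y)⟫_ℂ = Complex.exp (Complex.I * c * t / ħ) * ⟪x, W y⟫_ℂ := by
    intro x y
    have hcl : IsClosed {q : H × H | ⟪G t q.1, W (G t q.2)⟫_ℂ =
        Complex.exp (Complex.I * c * t / ħ) * ⟪q.1, W q.2⟫_ℂ} :=
      isClosed_eq (by fun_prop) (by fun_prop)
    have hmem : (x, y) ∈ _root_.closure ({x | DifferentiableAt ℝ (fun t => G t x) 0} ×ˢ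
        {x | DifferentiableAt ℝ (fun t => G t x) 0}) := by
      rw [closure_prod_eq]
      exact ⟨hG.dense_domain x, hG.dense_domain y⟩
    exact closure_minimal (fun q hq => key q.1 q.2 hq.1 hq.2) hcl hmem
  ext y
  refine ext_inner_left ℂ fun x => ?_
  have := key2 (G (-t) x) y
  rw [hG.apply_neg, hG.inner_apply, neg_neg] at this
  simp only [mul_apply_eq_comp, smul_apply, inner_smul_right]
  rw [this, ← mul_assoc, ← Complex.exp_add, neg_add_cancel, Complex.exp_zero, one_mul]

/-- A covariance relation between a group and `W` gives one for the generator. -/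
lemma intertwines_generator {G : ℝ → H →L[ℂ] H} {ħ : ℝ} {W : H →L[ℂ] H} {γ : ℝ → ℂ} {γ' : ℂ}
    (hG0 : G 0 = 1) (hγ : HasDerivAt γ γ' 0) (hγ0 : γ 0 = 1)
    (h : ∀ t, G t * W = γ t • (W * G t)) :
    Intertwines (generator ħ G) W (Complex.I * ħ * γ') := by
  rintro ⟨ψ, hψ⟩
  have hψ' : DifferentiableAt ℝ (fun t => G t ψ) 0 := hψ
  have h1 : HasDerivAt (fun s => ((W.restrictScalars ℝ)) (G s ψ))
      ((W.restrictScalars ℝ) (deriv (fun t => G t ψ) 0)) 0 :=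
    (W.restrictScalars ℝ).hasFDerivAt.comp_hasDerivAt 0 hψ'.hasDerivAt
  have h2 := hγ.fun_smul h1
  have h3 : HasDerivAt (fun t => G t (W ψ)) (W (deriv (fun t => G t ψ) 0) + γ' • W ψ) 0 := by
    have h4 : (fun t => G t (W ψ)) = fun t => γ t • (W.restrictScalars ℝ) (G t ψ) := by
      funext t
      simpa using congrArg (fun X : H →L[ℂ] H => X ψ) (h t)
    rw [h4]
    simpa [hG0, hγ0] using h2
  refine ⟨h3.differentiableAt, ?_⟩
  change (Complex.I * (ħ : ℂ)) • deriv (fun t => G t (W ψ)) 0 =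
    W ((Complex.I * (ħ : ℂ)) • deriv (fun t => G t ψ) 0) + (Complex.I * ħ * γ') • W ψ
  rw [h3.deriv, smul_add, smul_smul, map_smul]

end Groups

end ClockEngine

namespace ClockEngine

/-! ### Concrete operators on `ℂⁿ ⊗ L²(ℝ²)` -/

section Concrete

variable {n : Type*} [Fintype n]

lemma coeFn_mulOp (g : Lp ℂ ∞ (volume : Measure (ℝ × ℝ))) (ψ : Total n) :
    mulOp g ψ =ᵐ[volume] fun z => g z • ψ z :=
  ContinuousLinearMap.coeFn_holder
    (ContinuousLinearMap.lsmul ℂ ℂ : ℂ →L[ℂ] EuclideanSpace ℂ n →L[ℂ] EuclideanSpace ℂ n) g ψ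

/-- Multiplication by `exp (-i q)`, for a real linear form `q`. -/
noncomputable def phase (q : ℝ × ℝ →L[ℝ] ℝ) : Total n →L[ℂ] Total n := mulOp (memLp_phase q).toLp

lemma coeFn_phase (q : ℝ × ℝ →L[ℝ] ℝ) (ψ : Total n) :
    phase q ψ =ᵐ[volume] fun z => Complex.exp (-(Complex.I * (q z : ℂ))) • ψ z := by
  filter_upwards [coeFn_mulOp (memLp_phase q).toLp ψ, (memLp_phase q).coeFn_toLp] with z h1 h2
  rw [phase, h1, h2]

/-- The translation `ψ ↦ ψ (· + v)`. -/
noncomputable def shift (v : ℝ × ℝ) : Total n →L[ℂ] Total n :=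
  (Lp.compMeasurePreservingₗᵢ ℂ (fun z : ℝ × ℝ => z + v)
    (measurePreserving_add_right volume v)).toContinuousLinearMap

lemma coeFn_shift (v : ℝ × ℝ) (ψ : Total n) :
    shift v ψ =ᵐ[volume] fun z => ψ (z + v) :=
  Lp.coeFn_compMeasurePreserving ψ (measurePreserving_add_right volume v)

lemma inner_shift (v : ℝ × ℝ) (x y : Total n) : ⟪shift v x, shift v y⟫_ℂ = ⟪x, y⟫_ℂ :=
  LinearIsometry.inner_map_map _ x y

lemma ae_comp_add {P : ℝ × ℝ → Prop} (h : ∀ᵐ z, P z) (v : ℝ × ℝ) : ∀ᵐ z : ℝ × ℝ, P (z + v) :=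
  (measurePreserving_add_right (volume : Measure (ℝ × ℝ)) v).quasiMeasurePreserving.ae h

lemma shift_mul_shift (v w : ℝ × ℝ) : (shift v * shift w : Total n →L[ℂ] Total n) =
    shift (v + w) := by
  ext1 ψ
  refine Lp.ext ?_
  filter_upwards [coeFn_shift v (shift w ψ), ae_comp_add (coeFn_shift w ψ) v,
    coeFn_shift (v + w) ψ] with z h1 h2 h3
  rw [mul_apply_eq_comp, h1, h2, h3, add_assoc]

lemma shift_zero : (shift 0 : Total n →L[ℂ] Total n) = 1 := by
  ext1 ψ
  refine Lp.ext ?_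
  filter_upwards [coeFn_shift 0 ψ] with z h1
  rw [h1, add_zero, one_apply_eq_self]

/-- The Weyl form of the canonical commutation relations. -/
lemma shift_mul_phase (v : ℝ × ℝ) (q : ℝ × ℝ →L[ℝ] ℝ) :
    (shift v * phase q : Total n →L[ℂ] Total n) =
      Complex.exp (-(Complex.I * (q v : ℂ))) • (phase q * shift v) := by
  ext1 ψ
  refine Lp.ext ?_
  filter_upwards [coeFn_shift v (phase q ψ), ae_comp_add (coeFn_phase q ψ) v,
    coeFn_phase q (shift v ψ), coeFn_shift v ψ,
    Lp.coeFn_smul (Complex.exp (-(Complex.I * (q v : ℂ)))) (phase q (shift v ψ))]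
    with z h1 h2 h3 h4 h5
  rw [mul_apply_eq_comp, h1, h2, smul_apply, mul_apply_eq_comp, h5, Pi.smul_apply, h3, h4,
    smul_smul, ← Complex.exp_add]
  congr 2
  rw [map_add]
  push_cast
  ring

lemma phase_mul_phase (q r : ℝ × ℝ →L[ℝ] ℝ) :
    (phase q * phase r : Total n →L[ℂ] Total n) = phase (q + r) := by
  ext1 ψ
  refine Lp.ext ?_
  filter_upwards [coeFn_phase q (phase r ψ), coeFn_phase r ψ, coeFn_phase (q + r) ψ]
    with z h1 h2 h3
  rw [mul_apply_eq_comp, h1, h2, h3, smul_smul, ← Complex.exp_add]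
  congr 2
  rw [add_apply]
  push_cast
  ring

/-- The `i`-th component of a vector-valued wave function. -/
noncomputable def coordOp (i : n) : Total n →L[ℂ] WeightClock :=
  (EuclideanSpace.proj i : EuclideanSpace ℂ n →L[ℂ] ℂ).compLpL 2 (volume : Measure (ℝ × ℝ))

lemma coeFn_coordOp (i : n) (ψ : Total n) : coordOp i ψ =ᵐ[volume] fun z => ψ z i :=
  ContinuousLinearMap.coeFn_compLpL _ ψ

variable [DecidableEq n]

lemma phaseP_eq (a : ℝ) :
    (phaseP a : Total n →L[ℂ] Total n) = phase (a • ContinuousLinearMap.fst ℝ ℝ ℝ) := rfl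

lemma phaseX_eq (a : ℝ) :
    (phaseX a : Total n →L[ℂ] Total n) = phase (a • ContinuousLinearMap.snd ℝ ℝ ℝ) := rfl

lemma shiftP_eq (s : ℝ) : (shiftP s : Total n →L[ℂ] Total n) = shift (s, 0) := rfl

lemma shiftX_eq (s : ℝ) : (shiftX s : Total n →L[ℂ] Total n) = shift (0, -s) := rfl

lemma coeFn_matOp (M : Matrix n n ℂ) (ψ : Total n) :
    matOp M ψ =ᵐ[volume] fun z => Matrix.toEuclideanCLM (n := n) (𝕜 := ℂ) M (ψ z) :=
  ContinuousLinearMap.coeFn_compLpL _ ψ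

lemma matOp_mul_matOp (M N : Matrix n n ℂ) : matOp M * matOp N = matOp (M * N) := by
  ext1 ψ
  refine Lp.ext ?_
  filter_upwards [coeFn_matOp M (matOp N ψ), coeFn_matOp N ψ, coeFn_matOp (M * N) ψ]
    with z h1 h2 h3
  rw [mul_apply_eq_comp, h1, h2, h3, map_mul, mul_apply_eq_comp]

lemma shift_mul_matOp (v : ℝ × ℝ) (M : Matrix n n ℂ) : shift v * matOp M = matOp M * shift v := by
  ext1 ψ
  refine Lp.ext ?_
  filter_upwards [coeFn_shift v (matOp M ψ), ae_comp_add (coeFn_matOp M ψ) v,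
    coeFn_matOp M (shift v ψ), coeFn_shift v ψ] with z h1 h2 h3 h4
  rw [mul_apply_eq_comp, h1, h2, mul_apply_eq_comp, h3, h4]

lemma phase_mul_matOp (q : ℝ × ℝ →L[ℝ] ℝ) (M : Matrix n n ℂ) :
    phase q * matOp M = matOp M * phase q := by
  ext1 ψ
  refine Lp.ext ?_
  filter_upwards [coeFn_phase q (matOp M ψ), coeFn_matOp M ψ,
    coeFn_matOp M (phase q ψ), coeFn_phase q ψ] with z h1 h2 h3 h4
  rw [mul_apply_eq_comp, h1, h2, mul_apply_eq_comp, h3, h4, map_smul]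

lemma coeFn_ketTensor (j : n) (f : WeightClock) :
    ketTensor j f =ᵐ[volume] fun z => f z • EuclideanSpace.single j (1 : ℂ) := by
  filter_upwards [ContinuousLinearMap.coeFn_compLpL (p := 2) (ContinuousLinearMap.toSpanSingleton ℂ
    (EuclideanSpace.single j (1 : ℂ))) f] with z h
  exact h

lemma adjoint_ketTensor (j : n) : ContinuousLinearMap.adjoint (ketTensor j) = coordOp j := by
  symm
  rw [ContinuousLinearMap.eq_adjoint_iff]
  intro ψ f
  rw [L2.inner_def, L2.inner_def]
  refine integral_congr_ae ?_
  filter_upwards [coeFn_coordOp j ψ, coeFn_ketTensor j f] with z h1 h2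
  rw [h1, h2, inner_smul_right, EuclideanSpace.inner_single_right]
  simp

end Concrete

/-! ### Injectivity of the Fourier transform on `L¹(ℝ²)` -/

section Fourier

/-- The positive and negative parts of `h` are densities of finite measures (`ENNReal.ofReal`
truncates at zero). These have equal characteristic functions, hence coincide, so both parts agree
almost everywhere and must vanish. -/
lemma ae_eq_zero_of_integral_exp_real {h : ℝ × ℝ → ℝ} (hi : Integrable h)
    (h0 : ∀ q : ℝ × ℝ →L[ℝ] ℝ, ∫ z, Complex.exp (q z * Complex.I) * (h z : ℂ) = 0) :
    h =ᵐ[volume] 0 := by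
  wlog hm : Measurable h generalizing h
  · obtain ⟨g, hg, hge⟩ := hi.1.aemeasurable
    refine hge.trans (this (hi.congr hge) (fun q => ?_) hg)
    rw [← h0 q]
    refine integral_congr_ae ?_
    filter_upwards [hge] with z hz
    rw [hz]
  have hfin : ∀ g : ℝ × ℝ → ℝ, Integrable g →
      IsFiniteMeasure (volume.withDensity fun z => ENNReal.ofReal (g z)) := fun g hg =>
    isFiniteMeasure_withDensity_ofReal hg.2
  have h1 := hfin h hi
  have h2 := hfin (fun z => -h z) hi.neg
  have hcf : ∀ (g : ℝ × ℝ → ℝ), Measurable g → ∀ q : StrongDual ℝ (ℝ × ℝ),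
      charFunDual (volume.withDensity fun z => ENNReal.ofReal (g z)) q =
        ∫ z, ((max (g z) 0 : ℝ) : ℂ) * Complex.exp (q z * Complex.I) := by
    intro g hg q
    rw [charFunDual_apply, integral_withDensity_eq_integral_toReal_smul hg.ennreal_ofReal
      (Filter.Eventually.of_forall fun _ => ENNReal.ofReal_lt_top)]
    refine integral_congr_ae (Filter.Eventually.of_forall fun z => ?_)
    simp only [ENNReal.toReal_ofReal', Complex.real_smul]
  have hint : ∀ (g : ℝ × ℝ → ℝ), Integrable g → ∀ q : StrongDual ℝ (ℝ × ℝ),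
      Integrable fun z => ((max (g z) 0 : ℝ) : ℂ) * Complex.exp (q z * Complex.I) := by
    intro g hg q
    refine (hg.pos_part.ofReal (𝕜 := ℂ)).mul_bdd (c := 1)
      (Continuous.aestronglyMeasurable (by fun_prop))
      (Filter.Eventually.of_forall fun z => ?_)
    simp [Complex.norm_exp]
  have heq : (volume.withDensity fun z => ENNReal.ofReal (h z)) =
      volume.withDensity fun z => ENNReal.ofReal (-h z) := by
    refine Measure.ext_of_charFunDual (funext fun q => ?_)
    rw [hcf h hm q, hcf (fun z => -h z) hm.neg q, ← sub_eq_zero,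
      ← integral_sub (hint h hi q) (hint (fun z => -h z) hi.neg q), ← h0 q]
    refine integral_congr_ae (Filter.Eventually.of_forall fun z => ?_)
    simp only
    rw [← sub_mul, ← Complex.ofReal_sub, mul_comm]
    congr 2
    rcases le_total 0 (h z) with h' | h'
    · rw [max_eq_left h', max_eq_right (by linarith)]; ring
    · rw [max_eq_right h', max_eq_left (by linarith)]; ring
  have hae := (withDensity_eq_iff hm.ennreal_ofReal.aemeasurable
    hm.neg.ennreal_ofReal.aemeasurable (by
      have := h1.measure_univ_lt_top.ne
      rwa [withDensity_apply _ MeasurableSet.univ, Measure.restrict_univ] at this)).1 heq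
  filter_upwards [hae] with z hz
  have hz' := congrArg ENNReal.toReal hz
  simp only [ENNReal.toReal_ofReal', Pi.neg_apply] at hz'
  rcases le_total 0 (h z) with h' | h'
  · rw [max_eq_left h', max_eq_right (by linarith)] at hz'; simpa using hz'
  · rw [max_eq_right h', max_eq_left (by linarith)] at hz'; simpa using hz'.symm

/-- The transform of the conjugate of `h` at `q` is the conjugate of that of `h` at `-q`, so it
vanishes too, and with it the transforms of the real and imaginary parts. -/
lemma ae_eq_zero_of_integral_exp {h : ℝ × ℝ → ℂ} (hi : Integrable h)
    (h0 : ∀ q : ℝ × ℝ →L[ℝ] ℝ, ∫ z, Complex.exp (-(Complex.I * (q z : ℂ))) * h z = 0) :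
    h =ᵐ[volume] 0 := by
  have hint : ∀ (g : ℝ × ℝ → ℂ), Integrable g → ∀ q : ℝ × ℝ →L[ℝ] ℝ,
      Integrable fun z => Complex.exp (q z * Complex.I) * g z := by
    intro g hg q
    refine hg.bdd_mul (c := 1)
      (Continuous.aestronglyMeasurable (by fun_prop))
      (Filter.Eventually.of_forall fun z => ?_)
    simp [Complex.norm_exp]
  have h1 : ∀ q : ℝ × ℝ →L[ℝ] ℝ, ∫ z, Complex.exp (q z * Complex.I) * h z = 0 := by
    intro q
    rw [← h0 (-q)]
    refine integral_congr_ae (Filter.Eventually.of_forall fun z => ?_)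
    simp [mul_comm]
  have hci : Integrable fun z => (starRingEnd ℂ) (h z) :=
    Complex.conjLIE.toContinuousLinearEquiv.toContinuousLinearMap.integrable_comp hi
  have h2 : ∀ q : ℝ × ℝ →L[ℝ] ℝ, ∫ z, Complex.exp (q z * Complex.I) * (starRingEnd ℂ) (h z) = 0 := by
    intro q
    have := congrArg (starRingEnd ℂ) (h0 q)
    rw [← integral_conj, map_zero] at this
    rw [← this]
    refine integral_congr_ae (Filter.Eventually.of_forall fun z => ?_)
    simp [← Complex.exp_conj, mul_comm]
  have hre := ae_eq_zero_of_integral_exp_real hi.re fun q => by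
    have h3 : ∀ z, Complex.exp (q z * Complex.I) * ((RCLike.re (h z) : ℝ) : ℂ) =
        (1 / 2 : ℂ) * (Complex.exp (q z * Complex.I) * h z +
          Complex.exp (q z * Complex.I) * (starRingEnd ℂ) (h z)) := by
      intro z
      have : ((RCLike.re (h z) : ℝ) : ℂ) = (h z + (starRingEnd ℂ) (h z)) / 2 :=
        Complex.re_eq_add_conj (h z)
      rw [this]
      ring
    simp_rw [h3]
    rw [integral_const_mul, integral_add (hint _ hi q) (hint _ hci q), h1, h2]
    simp
  have him := ae_eq_zero_of_integral_exp_real hi.im fun q => by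
    have h3 : ∀ z, Complex.exp (q z * Complex.I) * ((RCLike.im (h z) : ℝ) : ℂ) =
        (1 / (2 * Complex.I) : ℂ) * (Complex.exp (q z * Complex.I) * h z -
          Complex.exp (q z * Complex.I) * (starRingEnd ℂ) (h z)) := by
      intro z
      have : ((RCLike.im (h z) : ℝ) : ℂ) = (h z - (starRingEnd ℂ) (h z)) / (2 * Complex.I) :=
        Complex.im_eq_sub_conj (h z)
      rw [this]
      ring
    simp_rw [h3]
    rw [integral_const_mul, integral_sub (hint _ hi q) (hint _ hci q), h1, h2]
    simp
  filter_upwards [hre, him] with z hz1 hz2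
  exact Complex.ext hz1 hz2

end Fourier

end ClockEngine

namespace ClockEngine

/-! ### Operators that commute with all multiplications are fibred over `ℝ²` -/

section Fibre

variable {n : Type*} [Fintype n]

/-- The local form of the adjoint relation. -/
lemma ae_inner_adjoint {Y : Total n →L[ℂ] Total n} (hc : ∀ q, Y * phase q = phase q * Y)
    (φ ψ : Total n) :
    ∀ᵐ z, ⟪ContinuousLinearMap.adjoint Y φ z, ψ z⟫_ℂ = ⟪φ z, Y ψ z⟫_ℂ := by
  have hi1 := L2.integrable_inner (𝕜 := ℂ) (ContinuousLinearMap.adjoint Y φ) ψ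
  have hi2 := L2.integrable_inner (𝕜 := ℂ) φ (Y ψ)
  have hph : ∀ (q : ℝ × ℝ →L[ℝ] ℝ) (a b : Total n),
      ∫ z, Complex.exp (-(Complex.I * (q z : ℂ))) * ⟪a z, b z⟫_ℂ = ⟪a, phase q b⟫_ℂ := by
    intro q a b
    rw [L2.inner_def]
    refine integral_congr_ae ?_
    filter_upwards [coeFn_phase q b] with z hz
    rw [hz, inner_smul_right]
  have hint : ∀ (q : ℝ × ℝ →L[ℝ] ℝ) (a b : Total n),
      Integrable fun z => Complex.exp (-(Complex.I * (q z : ℂ))) * ⟪a z, b z⟫_ℂ := by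
    intro q a b
    refine (L2.integrable_inner (𝕜 := ℂ) a b).bdd_mul (c := 1)
      (Continuous.aestronglyMeasurable (by fun_prop))
      (Filter.Eventually.of_forall fun z => ?_)
    simp [Complex.norm_exp]
  -- The Fourier transform of the difference is `⟪Y† φ, phase q ψ⟫ - ⟪φ, phase q (Y ψ)⟫`, which is
  -- zero since `Y` commutes with `phase q`.
  have h := ae_eq_zero_of_integral_exp (hi1.sub hi2) fun q => by
    simp only [Pi.sub_apply, mul_sub]
    rw [integral_sub (hint q _ _) (hint q _ _), hph, hph,
      ContinuousLinearMap.adjoint_inner_left, ← mul_apply_eq_comp, hc, mul_apply_eq_comp, sub_self]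
  filter_upwards [h] with z hz
  exact sub_eq_zero.1 hz

lemma memLp_gaussian (a : ℝ) :
    MemLp (fun x : ℝ => Complex.exp (-(x : ℂ) ^ 2 - Complex.I * (a * x : ℝ))) 2 volume := by
  have hm : AEStronglyMeasurable
      (fun x : ℝ => Complex.exp (-(x : ℂ) ^ 2 - Complex.I * (a * x : ℝ))) volume :=
    Continuous.aestronglyMeasurable (by fun_prop)
  rw [memLp_two_iff_integrable_sq_norm hm]
  refine (integrable_exp_neg_mul_sq (b := 2) (by norm_num)).congr
    (Filter.Eventually.of_forall fun x => ?_)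
  simp only [Complex.norm_exp]
  rw [← Real.exp_nat_mul]
  congr 1
  have : ((x : ℂ) ^ 2).re = x ^ 2 := by norm_cast
  simp [this]

/-- The Gaussian wave packet `exp (-x² - i a x)`. -/
noncomputable def gaussian (a : ℝ) : Line := (memLp_gaussian a).toLp

/-- The positive weight `exp (-p² - x²)`. -/
noncomputable def gaussWeight (z : ℝ × ℝ) : ℂ := Complex.exp (-(z.1 : ℂ) ^ 2 - (z.2 : ℂ) ^ 2)

lemma gaussWeight_ne_zero (z : ℝ × ℝ) : gaussWeight z ≠ 0 := Complex.exp_ne_zero _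

lemma conj_gaussWeight (z : ℝ × ℝ) : (starRingEnd ℂ) (gaussWeight z) = gaussWeight z := by
  simp [gaussWeight, ← Complex.exp_conj]

lemma continuous_gaussWeight : Continuous gaussWeight := by
  unfold gaussWeight
  fun_prop

lemma coeFn_tensor (v : EuclideanSpace ℂ n) (f g : Line) :
    tensor v f g =ᵐ[volume] fun z => (f z.1 * g z.2) • v :=
  (memLp_tensorFun v f g).coeFn_toLp

lemma coeFn_gaussian_mul (a b : ℝ) : ∀ᵐ z : ℝ × ℝ, gaussian a z.1 * gaussian b z.2 =
    Complex.exp (-(Complex.I * (a * z.1 + b * z.2 : ℝ))) * gaussWeight z := by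
  have h1 := Measure.quasiMeasurePreserving_fst (μ := (volume : Measure ℝ))
    (ν := (volume : Measure ℝ)) |>.ae (memLp_gaussian a).coeFn_toLp
  have h2 := Measure.quasiMeasurePreserving_snd (μ := (volume : Measure ℝ))
    (ν := (volume : Measure ℝ)) |>.ae (memLp_gaussian b).coeFn_toLp
  filter_upwards [h1, h2] with z hz1 hz2
  rw [gaussian, gaussian, hz1, hz2, gaussWeight, ← Complex.exp_add, ← Complex.exp_add]
  congr 1
  push_cast
  ring

variable [DecidableEq n]

/-- An isometry that commutes with all multiplications acts as a measurable field of unitary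
matrices. -/
lemma exists_fibres {Y : Total n →L[ℂ] Total n} (hY : ∀ x y, ⟪Y x, Y y⟫_ℂ = ⟪x, y⟫_ℂ)
    (hc : ∀ q, Y * phase q = phase q * Y) :
    ∃ V : ℝ × ℝ → Matrix n n ℂ, (∀ z, V z ∈ Matrix.unitaryGroup n ℂ) ∧
      (∀ i j, Measurable fun z => V z i j) ∧
      ∀ ψ, ∀ᵐ z, Y ψ z = Matrix.toEuclideanCLM (n := n) (𝕜 := ℂ) (V z) (ψ z) := by
  -- The Gaussian is square integrable and vanishes nowhere. It replaces the constant function,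
  -- which is not in `L²`, and can be divided out pointwise.
  set G : n → Total n := fun i => tensor (EuclideanSpace.single i 1) (gaussian 0) (gaussian 0)
    with hG
  have hGz : ∀ i, ∀ᵐ z, G i z = gaussWeight z • EuclideanSpace.single i (1 : ℂ) := by
    intro i
    filter_upwards [coeFn_tensor (EuclideanSpace.single i (1 : ℂ)) (gaussian 0) (gaussian 0),
      coeFn_gaussian_mul 0 0] with z h1 h2
    rw [hG, h1, h2]
    simp
  -- Row `i` is read off from `Y† (G i)` rather than column `j` from `Y (G j)`: the local adjoint
  -- relation then expresses `Y ψ` through `V₀` for every `ψ` directly, without an approximation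
  -- argument.
  set V₀ : ℝ × ℝ → Matrix n n ℂ := fun z => Matrix.of fun i j =>
    (starRingEnd ℂ) (ContinuousLinearMap.adjoint Y (G i) z j) / gaussWeight z with hV₀
  have hm : ∀ i j, Measurable fun z => V₀ z i j := by
    intro i j
    have h1 : Measurable fun z => ContinuousLinearMap.adjoint Y (G i) z j :=
      (EuclideanSpace.proj (𝕜 := ℂ) j).continuous.measurable.comp
        (Lp.stronglyMeasurable _).measurable
    exact (Complex.continuous_conj.measurable.comp h1).div continuous_gaussWeight.measurable
  have hYV : ∀ ψ, ∀ᵐ z, Y ψ z = Matrix.toEuclideanCLM (n := n) (𝕜 := ℂ) (V₀ z) (ψ z) := by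
    intro ψ
    have h1 : ∀ᵐ z, ∀ i, ⟪ContinuousLinearMap.adjoint Y (G i) z, ψ z⟫_ℂ = ⟪G i z, Y ψ z⟫_ℂ :=
      ae_all_iff.2 fun i => ae_inner_adjoint hc (G i) ψ
    filter_upwards [h1, ae_all_iff.2 hGz] with z h1 h2
    ext i
    have h3 := h1 i
    rw [h2 i, inner_smul_left, EuclideanSpace.inner_single_left, conj_gaussWeight, map_one,
      one_mul] at h3
    rw [Matrix.ofLp_toEuclideanCLM, Matrix.mulVec, dotProduct, hV₀]
    simp only [Matrix.of_apply, div_mul_eq_mul_div]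
    rw [← Finset.sum_div, eq_div_iff (gaussWeight_ne_zero z), mul_comm, ← h3, PiLp.inner_apply]
    simp [mul_comm]
  -- Since `Y† Y = 1`, the local relation applied to the vectors `Y (G i)` and `G j` says that the
  -- columns of `V₀ z` are orthonormal. In finite dimension this already means unitary, so
  -- surjectivity of `Y` plays no role.
  have hU : ∀ᵐ z, star (V₀ z) * V₀ z = 1 := by
    have h1 : ∀ᵐ z, ∀ i j, ⟪ContinuousLinearMap.adjoint Y (Y (G i)) z, G j z⟫_ℂ =
        ⟪Y (G i) z, Y (G j) z⟫_ℂ :=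
      ae_all_iff.2 fun i => ae_all_iff.2 fun j => ae_inner_adjoint hc (Y (G i)) (G j)
    have hYY : ∀ x, ContinuousLinearMap.adjoint Y (Y x) = x := fun x =>
      ext_inner_right ℂ fun y => by rw [ContinuousLinearMap.adjoint_inner_left, hY]
    simp only [hYY] at h1
    filter_upwards [h1, ae_all_iff.2 hGz, ae_all_iff.2 fun i => hYV (G i)] with z h1 h2 h3
    ext i j
    have h4 := h1 i j
    simp only [h3, h2, map_smul, inner_smul_left, inner_smul_right, conj_gaussWeight] at h4
    have hne := gaussWeight_ne_zero z
    have h5 := mul_left_cancel₀ hne (mul_left_cancel₀ hne h4)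
    rw [EuclideanSpace.inner_single_left, PiLp.inner_apply] at h5
    simp only [Matrix.ofLp_toEuclideanCLM, PiLp.ofLp_single, Matrix.mulVec_single_one] at h5
    rw [Matrix.mul_apply]
    simp only [Matrix.star_apply]
    rw [Matrix.one_apply]
    simpa [Pi.single_apply, mul_comm, eq_comm, Matrix.col] using h5.symm
  have hS : MeasurableSet {z | star (V₀ z) * V₀ z = 1} := by
    have : {z | star (V₀ z) * V₀ z = 1} =
        ⋂ i, ⋂ j, {z | ∑ k, (starRingEnd ℂ) (V₀ z k i) * V₀ z k j = (1 : Matrix n n ℂ) i j} := by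
      ext z
      simp only [Set.mem_ofPred_eq, Set.mem_iInter, ← Matrix.ext_iff, Matrix.mul_apply,
        Matrix.star_apply]
      rfl
    rw [this]
    refine MeasurableSet.iInter fun i => MeasurableSet.iInter fun j =>
      measurableSet_eq_fun (Finset.measurable_sum _ fun k _ => ?_) measurable_const
    exact (Complex.continuous_conj.measurable.comp (hm k i)).mul (hm k j)
  classical
  -- Replacing `V₀` by the identity on a measurable null set makes it unitary at every point.
  refine ⟨fun z => if star (V₀ z) * V₀ z = 1 then V₀ z else 1, fun z => ?_, fun i j => ?_,
    fun ψ => ?_⟩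
  · dsimp only
    split_ifs with h
    · exact Matrix.mem_unitaryGroup_iff'.2 h
    · exact one_mem _
  · have : (fun z => (if star (V₀ z) * V₀ z = 1 then V₀ z else 1) i j) =
        fun z => if star (V₀ z) * V₀ z = 1 then V₀ z i j else (1 : Matrix n n ℂ) i j := by
      funext z
      split_ifs <;> rfl
    rw [this]
    exact Measurable.ite hS (hm i j) measurable_const
  · filter_upwards [hYV ψ, hU] with z h1 h2
    rw [if_pos h2, h1]

end Fibre

end ClockEngine

namespace ClockEngine

/-! ### The evolution generated by the clock Hamiltonian -/

section Evolution

variable {n : Type*} [Fintype n] [DecidableEq n]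

lemma Intertwines.mul {H : Type*} [NormedAddCommGroup H] [InnerProductSpace ℂ H]
    [CompleteSpace H] {A : H →ₗ.[ℂ] H} {W W' : H →L[ℂ] H} (h : Intertwines A W 0)
    (h' : Intertwines A W' 0) : Intertwines A (W * W') 0 := by
  intro ψ
  obtain ⟨h1, h2⟩ := h' ψ
  obtain ⟨h3, h4⟩ := h ⟨_, h1⟩
  refine ⟨h3, ?_⟩
  rw [zero_smul, add_zero] at h2 h4 ⊢
  rw [h2] at h4
  exact h4

lemma linearForm_apply (q : ℝ × ℝ →L[ℝ] ℝ) (z : ℝ × ℝ) : q z = q (1, 0) * z.1 + q (0, 1) * z.2 := by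
  have : z = z.1 • ((1, 0) : ℝ × ℝ) + z.2 • ((0, 1) : ℝ × ℝ) := by
    ext <;> simp
  conv_lhs => rw [this]
  simp only [map_add, map_smul, smul_eq_mul]
  ring

lemma hasDerivAt_cexp_linear (c : ℝ) :
    HasDerivAt (fun t : ℝ => Complex.exp (-(Complex.I * ((c * t : ℝ) : ℂ)))) (-(Complex.I * c)) 0 := by
  have h1 : HasDerivAt (fun t : ℝ => -(Complex.I * ((c * t : ℝ) : ℂ))) (-(Complex.I * c)) 0 := by
    have := ((Complex.ofRealCLM.hasDerivAt (x := (0 : ℝ))).const_mul (Complex.I * c)).fun_neg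
    simpa [mul_assoc] using this
  simpa using h1.cexp

/-- The derivative of the Weyl relation along the `p`-translations; the constant is `ħ ∂q/∂p`. -/
lemma intertwines_weight_phase (ħ : ℝ) (q : ℝ × ℝ →L[ℝ] ℝ) :
    Intertwines (weightHamiltonian n ħ) (phase q) (ħ * q (1, 0)) := by
  have h := intertwines_generator (ħ := ħ) (G := (shiftP : ℝ → Total n →L[ℂ] Total n))
    (W := phase q) (by rw [shiftP_eq]; exact shift_zero)
    (hasDerivAt_cexp_linear (q (1, 0))) (by simp) fun t => by
      rw [shiftP_eq, shift_mul_phase, linearForm_apply q (t, 0)]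
      simp
  have e : Complex.I * ħ * -(Complex.I * (q (1, 0) : ℂ)) = ħ * q (1, 0) := by
    linear_combination (-(ħ : ℂ) * q (1, 0)) * Complex.I_sq
  rwa [e] at h

lemma intertwines_clock_phase (ħ : ℝ) (q : ℝ × ℝ →L[ℝ] ℝ) :
    Intertwines (clockHamiltonian n ħ) (phase q) (-(ħ * q (0, 1))) := by
  have h := intertwines_generator (ħ := ħ) (G := (shiftX : ℝ → Total n →L[ℂ] Total n))
    (W := phase q) (by rw [shiftX_eq, neg_zero]; exact shift_zero)
    (hasDerivAt_cexp_linear (-q (0, 1))) (by simp) fun t => by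
      rw [shiftX_eq, shift_mul_phase, linearForm_apply q (0, -t)]
      simp
  have e : Complex.I * ħ * -(Complex.I * ((-q (0, 1) : ℝ) : ℂ)) = -(ħ * q (0, 1)) := by
    push_cast
    linear_combination ((ħ : ℂ) * q (0, 1)) * Complex.I_sq
  rwa [e] at h

variable {ħ : ℝ} {Hs : Matrix n n ℂ} {Hint : Total n →ₗ.[ℂ] Total n}
  {U : ℝ → Total n →L[ℂ] Total n}

/-- The system and interaction terms contribute no constant, the weight `ħ ∂q/∂p` and the clock `-ħ
∂q/∂x`. These add up on the intersection of the domains, survive the closure, and integrate to a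
scalar for the group. -/
lemma IsEvolution.mul_phase (hħ : 0 < ħ) (hXc : StronglyCommutes Hint phaseX)
    (hPw : StronglyCommutes Hint phaseP) (hU : IsEvolution ħ (totalHamiltonian ħ Hs Hint) U)
    (t : ℝ) (q : ℝ × ℝ →L[ℝ] ℝ) :
    U t * phase q =
      Complex.exp (-(Complex.I * ((q (1, 0) - q (0, 1)) * t : ℝ))) • (phase q * U t) := by
  have hq : (phase q : Total n →L[ℂ] Total n) = phaseP (q (1, 0)) * phaseX (q (0, 1)) := by
    rw [phaseP_eq, phaseX_eq, phase_mul_phase]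
    congr 1
    refine ContinuousLinearMap.ext fun z => ?_
    rw [linearForm_apply q z]
    simp
  have h1 : Intertwines Hint (phase q) 0 := by
    rw [hq]
    exact (hPw _).intertwines.mul (hXc _).intertwines
  have h2 : Intertwines (totalHamiltonian ħ Hs Hint) (phase q) _ :=
    (((intertwines_toPMap (phase_mul_matOp q Hs).symm).add (intertwines_weight_phase ħ q)).add
      (intertwines_clock_phase ħ q)).add h1
  have h3 := h2.closure
  rw [← hU.2] at h3
  rw [h3.group hU.1 hħ.ne' t]
  congr 2
  have : (ħ : ℂ) ≠ 0 := by exact_mod_cast hħ.ne'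
  push_cast
  field_simp
  ring

lemma commute_exp_matOp (ħ : ℝ) (Hs : Matrix n n ℂ) (s : ℝ) :
    Commute Hs (NormedSpace.exp (-(Complex.I * s / ħ) • Hs)) := by
  let : SeminormedRing (Matrix n n ℂ) := Matrix.linftyOpSemiNormedRing
  let : NormedRing (Matrix n n ℂ) := Matrix.linftyOpNormedRing
  let : NormedAlgebra ℂ (Matrix n n ℂ) := Matrix.linftyOpNormedAlgebra
  exact ((Commute.refl Hs).smul_right _).exp_right

/-- Each term of the Hamiltonian commutes with the group of `H_e`: translations commute with each
other and with matrices, `Hs` commutes with its exponential, and `Hint` does by hypothesis. This is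
conservation of the engine energy. -/
lemma IsEvolution.mul_engineGroup (hħ : 0 < ħ) (he : StronglyCommutes Hint (engineGroup ħ Hs))
    (hU : IsEvolution ħ (totalHamiltonian ħ Hs Hint) U) (t s : ℝ) :
    U t * engineGroup ħ Hs s = engineGroup ħ Hs s * U t := by
  have hcomm : ∀ v, shift v * engineGroup ħ Hs s = engineGroup ħ Hs s * shift v := by
    intro v
    rw [engineGroup, shiftP_eq, ← mul_assoc, shift_mul_matOp, mul_assoc, mul_assoc,
      shift_mul_shift, shift_mul_shift, add_comm]
  have hgen : ∀ G : ℝ → ℝ × ℝ, G 0 = 0 →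
      Intertwines (generator ħ fun t => (shift (G t) : Total n →L[ℂ] Total n))
        (engineGroup ħ Hs s) 0 := by
    intro G hG
    have := intertwines_generator (ħ := ħ) (G := fun t => (shift (G t) : Total n →L[ℂ] Total n))
      (W := engineGroup ħ Hs s) (γ := fun _ => 1) (γ' := 0) (by simp only [hG]; exact shift_zero)
      (hasDerivAt_const _ _) rfl fun t => by rw [one_smul, hcomm]
    simpa using this
  have h0 : matOp Hs * engineGroup ħ Hs s = engineGroup ħ Hs s * matOp Hs := by
    rw [engineGroup, shiftP_eq, mul_assoc (matOp _) (shift _), shift_mul_matOp, ← mul_assoc,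
      ← mul_assoc, matOp_mul_matOp, matOp_mul_matOp, (commute_exp_matOp ħ Hs s).eq]
  have h2 : Intertwines (totalHamiltonian ħ Hs Hint) (engineGroup ħ Hs s) _ :=
    (((intertwines_toPMap h0).add (hgen (fun t => (t, 0)) rfl)).add
      (hgen (fun t => (0, -t)) (by simp))).add (he s).intertwines
  have h3 := h2.closure
  rw [← hU.2] at h3
  rw [h3.group hU.1 hħ.ne' t]
  simp

/-- The evolution is fibred, up to a displacement of weight and clock. -/
lemma IsEvolution.exists_fibres (hħ : 0 < ħ) (hXc : StronglyCommutes Hint phaseX)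
    (hPw : StronglyCommutes Hint phaseP) (hU : IsEvolution ħ (totalHamiltonian ħ Hs Hint) U)
    (t : ℝ) :
    ∃ V : ℝ × ℝ → Matrix n n ℂ, (∀ z, V z ∈ Matrix.unitaryGroup n ℂ) ∧
      (∀ i j, Measurable fun z => V z i j) ∧
      ∀ ψ, ∀ᵐ z : ℝ × ℝ, U t ψ (z + (-t, t)) =
        Matrix.toEuclideanCLM (n := n) (𝕜 := ℂ) (V z) (ψ z) := by
  -- The translation by `(-t, t)` undoes the free motion of weight and clock: its Weyl scalar is the
  -- inverse of that of `U t`, so the product commutes with all phases.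
  obtain ⟨V, h1, h2, h3⟩ := ClockEngine.exists_fibres (Y := shift (-t, t) * U t)
    (fun x y => by
      rw [mul_apply_eq_comp, mul_apply_eq_comp, inner_shift, hU.1.inner_map])
    (fun q => by
      rw [mul_assoc, hU.mul_phase hħ hXc hPw, mul_smul_comm, ← mul_assoc, shift_mul_phase,
        smul_mul_assoc, smul_smul, ← Complex.exp_add, mul_assoc, linearForm_apply q (-t, t)]
      convert one_smul ℂ _
      rw [← Complex.exp_zero]
      congr 1
      push_cast
      ring)
  refine ⟨V, h1, h2, fun ψ => ?_⟩
  filter_upwards [h3 ψ, coeFn_shift (-t, t) (U t ψ)] with z hz1 hz2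
  rw [← hz1, mul_apply_eq_comp, hz2]

end Evolution

end ClockEngine

namespace ClockEngine

/-! ### Densities of ensembles -/

section Density

variable {n : Type*} [Fintype n] {ι : Type*} {φ : ι → Total n}

/-- The density `∑ₗ ‖φₗ(z)‖²`. -/
noncomputable def ensembleDensity (φ : ι → Total n) (z : ℝ × ℝ) : ℝ :=
  (∑' l, ‖φ l z‖ₑ ^ 2).toReal

/-- The matrix elements `∑ₗ φₗ(z)ᵢ conj φₗ(z)ⱼ`. -/
noncomputable def ensembleMatrix (φ : ι → Total n) (z : ℝ × ℝ) (i j : n) : ℂ :=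
  ∑' l, φ l z i * (starRingEnd ℂ) (φ l z j)

variable [Countable ι]

lemma integral_norm_sq (ψ : Total n) : ∫ z, ‖ψ z‖ ^ 2 = ‖ψ‖ ^ 2 := by
  have h : (‖ψ‖ ^ 2 : ℝ) = RCLike.re ⟪ψ, ψ⟫_ℂ := (inner_self_eq_norm_sq ψ).symm
  rw [h, L2.inner_def, ← integral_re (L2.integrable_inner (𝕜 := ℂ) ψ ψ)]
  exact integral_congr_ae (Filter.Eventually.of_forall fun z => (inner_self_eq_norm_sq _).symm)

lemma integrable_norm_sq (ψ : Total n) : Integrable fun z => ‖ψ z‖ ^ 2 :=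
  (memLp_two_iff_integrable_sq_norm (Lp.aestronglyMeasurable ψ)).1 (Lp.memLp ψ)

lemma lintegral_enorm_sq (ψ : Total n) : ∫⁻ z, ‖ψ z‖ₑ ^ 2 = ENNReal.ofReal (‖ψ‖ ^ 2) := by
  rw [← integral_norm_sq, ofReal_integral_eq_lintegral_ofReal (integrable_norm_sq ψ)
    (Filter.Eventually.of_forall fun _ => by positivity)]
  refine lintegral_congr fun z => ?_
  rw [ENNReal.ofReal_pow (norm_nonneg _), ofReal_norm]

lemma measurable_tsum_enorm_sq : Measurable fun z => ∑' l, ‖φ l z‖ₑ ^ 2 :=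
  Measurable.tsum fun l => (Lp.stronglyMeasurable (φ l)).enorm.pow_const 2

lemma lintegral_tsum_enorm_sq (hs : Summable fun l => ‖φ l‖ ^ 2) :
    ∫⁻ z, ∑' l, ‖φ l z‖ₑ ^ 2 = ENNReal.ofReal (∑' l, ‖φ l‖ ^ 2) := by
  rw [lintegral_tsum fun l => ((Lp.stronglyMeasurable (φ l)).enorm.pow_const 2).aemeasurable,
    ENNReal.ofReal_tsum_of_nonneg (fun _ => by positivity) hs]
  simp_rw [lintegral_enorm_sq]

lemma measurable_ensembleDensity : Measurable (ensembleDensity φ) :=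
  measurable_tsum_enorm_sq.ennreal_toReal

lemma ensembleDensity_nonneg (z : ℝ × ℝ) : 0 ≤ ensembleDensity φ z := ENNReal.toReal_nonneg

lemma integrable_ensembleDensity (hs : Summable fun l => ‖φ l‖ ^ 2) :
    Integrable (ensembleDensity φ) :=
  integrable_toReal_of_lintegral_ne_top measurable_tsum_enorm_sq.aemeasurable (by
    rw [lintegral_tsum_enorm_sq hs]; exact ENNReal.ofReal_ne_top)

/-- The total integral is finite by Tonelli, so the series diverges only on a null set, where
`toReal` gives the default `0`. -/
lemma ae_hasSum_ensembleDensity (hs : Summable fun l => ‖φ l‖ ^ 2) :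
    ∀ᵐ z, HasSum (fun l => ‖φ l z‖ ^ 2) (ensembleDensity φ z) := by
  have h := ae_lt_top (measurable_tsum_enorm_sq (φ := φ)) (by
    rw [lintegral_tsum_enorm_sq hs]; exact ENNReal.ofReal_ne_top)
  filter_upwards [h] with z hz
  have := ENNReal.hasSum_toReal hz.ne
  simpa [ensembleDensity, ENNReal.tsum_toReal_eq fun l => ENNReal.ne_top_of_tsum_ne_top hz.ne l]
    using this

lemma norm_mul_conj_le (v : EuclideanSpace ℂ n) (i j : n) :
    ‖v i * (starRingEnd ℂ) (v j)‖ ≤ ‖v‖ ^ 2 := by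
  rw [norm_mul, RCLike.norm_conj, sq]
  exact mul_le_mul (PiLp.norm_apply_le v i) (PiLp.norm_apply_le v j) (norm_nonneg _) (norm_nonneg _)

lemma aestronglyMeasurable_mul_conj (ψ : Total n) (i j : n) :
    AEStronglyMeasurable (fun z => ψ z i * (starRingEnd ℂ) (ψ z j)) volume := by
  have h1 : ∀ j, Measurable fun z => ψ z j := fun j =>
    (EuclideanSpace.proj (𝕜 := ℂ) j).continuous.measurable.comp (Lp.stronglyMeasurable _).measurable
  exact ((h1 i).mul (Complex.continuous_conj.measurable.comp (h1 j))).aestronglyMeasurable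

lemma integrable_mul_conj (ψ : Total n) (i j : n) :
    Integrable fun z => ψ z i * (starRingEnd ℂ) (ψ z j) :=
  (integrable_norm_sq ψ).mono' (aestronglyMeasurable_mul_conj ψ i j)
    (Filter.Eventually.of_forall fun z => norm_mul_conj_le (ψ z) i j)

lemma ae_hasSum_ensembleMatrix (hs : Summable fun l => ‖φ l‖ ^ 2) (i j : n) :
    ∀ᵐ z, HasSum (fun l => φ l z i * (starRingEnd ℂ) (φ l z j)) (ensembleMatrix φ z i j) := by
  filter_upwards [ae_hasSum_ensembleDensity hs] with z hz
  exact (Summable.of_norm_bounded hz.summable fun l => norm_mul_conj_le (φ l z) i j).hasSum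

lemma integrable_ensembleMatrix (hs : Summable fun l => ‖φ l‖ ^ 2) (i j : n) :
    Integrable fun z => ensembleMatrix φ z i j := by
  refine (integrable_ensembleDensity hs).mono' ?_ ?_
  · refine aestronglyMeasurable_of_tendsto_ae (u := Filter.atTop)
      (f := fun (s : Finset ι) z => ∑ l ∈ s, φ l z i * (starRingEnd ℂ) (φ l z j)) (fun s => ?_)
      (by
        filter_upwards [ae_hasSum_ensembleMatrix hs i j] with z hz
        simpa [HasSum] using hz)
    exact Finset.aestronglyMeasurable_fun_sum _ fun l _ => aestronglyMeasurable_mul_conj (φ l) i j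
  · filter_upwards [ae_hasSum_ensembleDensity hs] with z hz
    rw [← hz.tsum_eq]
    exact tsum_of_norm_bounded hz.summable.hasSum fun l => norm_mul_conj_le (φ l z) i j

/-- Termwise integration, with `∑ₗ ‖φₗ‖²` controlling the sum of the `L¹` norms. The bounded weight
`c` will be an indicator or the constant `1`. -/
lemma hasSum_integral_mul_conj (hs : Summable fun l => ‖φ l‖ ^ 2) (i j : n) {c : ℝ × ℝ → ℂ}
    (hc : AEStronglyMeasurable c volume) {C : ℝ} (hC : ∀ z, ‖c z‖ ≤ C) :
    HasSum (fun l => ∫ z, c z * (φ l z i * (starRingEnd ℂ) (φ l z j)))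
      (∫ z, c z * ensembleMatrix φ z i j) := by
  have hC0 : 0 ≤ C := (norm_nonneg _).trans (hC 0)
  have hint : ∀ l, Integrable fun z => c z * (φ l z i * (starRingEnd ℂ) (φ l z j)) := fun l =>
    (integrable_mul_conj (φ l) i j).bdd_mul hc (Filter.Eventually.of_forall hC)
  have h := hasSum_integral_of_summable_integral_norm hint (by
    refine Summable.of_nonneg_of_le (fun l => integral_nonneg fun _ => norm_nonneg _) (fun l => ?_)
      (hs.mul_left C)
    rw [← integral_norm_sq, ← integral_const_mul]
    refine integral_mono (hint l).norm ((integrable_norm_sq _).const_mul C) fun z => ?_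
    simp only [norm_mul]
    rw [← norm_mul (φ l z i)]
    exact mul_le_mul (hC z) (norm_mul_conj_le _ i j) (norm_nonneg _) hC0)
  simp only [tsum_mul_left] at h
  exact h

lemma ae_ensembleDensity_eq_sum (hs : Summable fun l => ‖φ l‖ ^ 2) :
    ∀ᵐ z, (ensembleDensity φ z : ℂ) = ∑ i, ensembleMatrix φ z i i := by
  filter_upwards [ae_hasSum_ensembleDensity hs,
    ae_all_iff.2 fun i => ae_hasSum_ensembleMatrix hs i i] with z h1 h2
  have h3 := hasSum_sum (s := Finset.univ) fun i _ => h2 i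
  have h4 := Complex.hasSum_ofReal.2 h1
  refine h4.unique (h3.congr_fun ?_)
  intro l
  rw [EuclideanSpace.norm_sq_eq]
  push_cast
  exact Finset.sum_congr rfl fun i _ => (Complex.mul_conj' _).symm

lemma integral_ensembleDensity (hs : Summable fun l => ‖φ l‖ ^ 2) :
    ∫ z, ensembleDensity φ z = ∑' l, ‖φ l‖ ^ 2 := by
  unfold ensembleDensity
  rw [integral_toReal measurable_tsum_enorm_sq.aemeasurable
    (ae_lt_top measurable_tsum_enorm_sq (by
      rw [lintegral_tsum_enorm_sq hs]; exact ENNReal.ofReal_ne_top)), lintegral_tsum_enorm_sq hs,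
    ENNReal.toReal_ofReal (tsum_nonneg fun _ => by positivity)]

lemma inner_coordOp (i j : n) (ψ : Total n) :
    ⟪coordOp j ψ, coordOp i ψ⟫_ℂ = ∫ z, ψ z i * (starRingEnd ℂ) (ψ z j) := by
  rw [L2.inner_def]
  refine integral_congr_ae ?_
  filter_upwards [coeFn_coordOp i ψ, coeFn_coordOp j ψ] with z h1 h2
  rw [h1, h2]
  simp

lemma IsEnsemble.isJointDensity {ρ : Total n →L[ℂ] Total n} (h : IsEnsemble φ ρ) :
    IsJointDensity ρ (ensembleDensity φ) where
  measurable := measurable_ensembleDensity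
  nonneg := ensembleDensity_nonneg
  integrable := integrable_ensembleDensity h.summable
  setIntegral B hB := by
    rw [h.opTrace_mul]
    have h1 : ∀ l, ⟪φ l, mulOp (memLp_indicator B hB).toLp (φ l)⟫_ℂ =
        ∑ i, ∫ z, B.indicator (fun _ => (1 : ℂ)) z * (φ l z i * (starRingEnd ℂ) (φ l z i)) := by
      intro l
      rw [L2.inner_def, ← integral_finsetSum]
      · refine integral_congr_ae ?_
        filter_upwards [coeFn_mulOp (memLp_indicator B hB).toLp (φ l),
          (memLp_indicator B hB).coeFn_toLp] with z h1 h2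
        rw [h1, h2, inner_smul_right, PiLp.inner_apply, Finset.mul_sum]
        rfl
      · intro i _
        refine (integrable_mul_conj (φ l) i i).bdd_mul (c := 1)
          (aestronglyMeasurable_const.indicator hB) (Filter.Eventually.of_forall fun z => ?_)
        by_cases hz : z ∈ B <;> simp [hz]
    simp_rw [h1]
    have h2 := hasSum_sum (s := Finset.univ) fun i _ => hasSum_integral_mul_conj h.summable i i
      (c := B.indicator fun _ => (1 : ℂ)) (aestronglyMeasurable_const.indicator hB) (C := 1)
      fun z => by by_cases hz : z ∈ B <;> simp [hz]
    rw [h2.tsum_eq, ← integral_finsetSum]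
    · rw [← integral_complex_ofReal, ← integral_indicator hB]
      refine integral_congr_ae ?_
      filter_upwards [ae_ensembleDensity_eq_sum h.summable] with z hz
      by_cases hzB : z ∈ B <;> simp [hzB, hz]
    · intro i _
      refine (integrable_ensembleMatrix h.summable i i).bdd_mul (c := 1)
        (aestronglyMeasurable_const.indicator hB) (Filter.Eventually.of_forall fun z => ?_)
      by_cases hz : z ∈ B <;> simp [hz]

variable [DecidableEq n]

lemma IsEnsemble.traceWC_apply {ρ : Total n →L[ℂ] Total n} (h : IsEnsemble φ ρ) (i j : n) :
    traceWC ρ i j = ∫ z, ensembleMatrix φ z i j := by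
  have h1 := h.opTrace_comp (ketTensor i) (ketTensor j)
  simp only [adjoint_ketTensor, inner_coordOp] at h1
  have h2 := hasSum_integral_mul_conj h.summable i j (c := fun _ => 1) aestronglyMeasurable_const
    (C := 1) (by simp)
  simp only [one_mul] at h2
  rw [traceWC, Matrix.of_apply, adjoint_ketTensor, h1, h2.tsum_eq]

/-- The matrix density of an ensemble after an operator that is fibred up to a displacement. -/
lemma ae_ensembleMatrix_fibres {T : Total n →L[ℂ] Total n} {V : ℝ × ℝ → Matrix n n ℂ} {v : ℝ × ℝ}
    (hT : ∀ ψ, ∀ᵐ z, T ψ (z + v) = Matrix.toEuclideanCLM (n := n) (𝕜 := ℂ) (V z) (ψ z))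
    (hs : Summable fun l => ‖φ l‖ ^ 2) (i j : n) :
    ∀ᵐ z, ensembleMatrix (fun l => T (φ l)) (z + v) i j =
      (V z * (Matrix.of fun a b => ensembleMatrix φ z a b) * star (V z)) i j := by
  filter_upwards [ae_all_iff.2 fun l => hT (φ l),
    ae_all_iff.2 fun a => ae_all_iff.2 fun b => ae_hasSum_ensembleMatrix hs a b] with z h1 h2
  have h3 : HasSum (fun l => ∑ b, ∑ a, V z i a * (φ l z a * (starRingEnd ℂ) (φ l z b)) *
      (starRingEnd ℂ) (V z j b)) (∑ b, ∑ a, V z i a * ensembleMatrix φ z a b *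
      (starRingEnd ℂ) (V z j b)) :=
    hasSum_sum fun b _ => hasSum_sum fun a _ => ((h2 a b).mul_left _).mul_right _
  rw [ensembleMatrix, Matrix.mul_apply]
  simp only [Matrix.mul_apply, Matrix.of_apply, Matrix.star_apply, Finset.sum_mul]
  refine Eq.trans (tsum_congr fun l => ?_) h3.tsum_eq
  rw [h1 l, Matrix.ofLp_toEuclideanCLM, Matrix.mulVec, Matrix.mulVec, dotProduct, dotProduct,
    map_sum, Finset.sum_mul_sum, Finset.sum_comm]
  refine Finset.sum_congr rfl fun b _ => Finset.sum_congr rfl fun a _ => ?_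
  rw [map_mul]
  ring

end Density

/-! ### Product states -/

section Product

/-- The product wave function `f(p) g(x)` of weight and clock. -/
noncomputable def wcTensor (f g : Line) : WeightClock :=
  coordOp () (tensor (EuclideanSpace.single () (1 : ℂ)) f g)

lemma coeFn_wcTensor (f g : Line) : wcTensor f g =ᵐ[volume] fun z => f z.1 * g z.2 := by
  filter_upwards [coeFn_coordOp () (tensor (EuclideanSpace.single () (1 : ℂ)) f g),
    coeFn_tensor (EuclideanSpace.single () (1 : ℂ)) f g] with z h1 h2
  rw [wcTensor, h1, h2]
  simp

/-- These inner products are the Fourier transform of `gaussWeight` times the conjugate of `x`, and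
the Gaussian factor vanishes nowhere. Product vectors are therefore total. -/
lemma eq_zero_of_inner_gaussian {x : WeightClock}
    (h : ∀ a b, ⟪x, wcTensor (gaussian a) (gaussian b)⟫_ℂ = 0) : x = 0 := by
  have hz : ∀ a b, ∀ᵐ z : ℝ × ℝ, ⟪x z, wcTensor (gaussian a) (gaussian b) z⟫_ℂ =
      Complex.exp (-(Complex.I * (a * z.1 + b * z.2 : ℝ))) *
        (gaussWeight z * (starRingEnd ℂ) (x z)) := by
    intro a b
    filter_upwards [coeFn_wcTensor (gaussian a) (gaussian b), coeFn_gaussian_mul a b] with z h1 h2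
    rw [h1, h2, RCLike.inner_apply]
    ring
  have hi : Integrable fun z : ℝ × ℝ => gaussWeight z * (starRingEnd ℂ) (x z) := by
    refine (L2.integrable_inner (𝕜 := ℂ) x (wcTensor (gaussian 0) (gaussian 0))).congr ?_
    filter_upwards [hz 0 0] with z h1
    rw [h1]
    simp
  have h0 := ae_eq_zero_of_integral_exp hi fun q => by
    rw [← h (q (1, 0)) (q (0, 1)), L2.inner_def]
    refine integral_congr_ae ?_
    filter_upwards [hz (q (1, 0)) (q (0, 1))] with z h1
    rw [h1, linearForm_apply q z]
  refine Lp.ext ?_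
  filter_upwards [h0, Lp.coeFn_zero ℂ 2 (volume : Measure (ℝ × ℝ))] with z h1 h2
  rw [h2]
  simpa [gaussWeight_ne_zero] using h1

lemma ext_of_wcTensor {A B : WeightClock →L[ℂ] WeightClock}
    (h : ∀ f g, A (wcTensor f g) = B (wcTensor f g)) : A = B := by
  refine ContinuousLinearMap.ext fun x => ?_
  refine ext_inner_left ℂ fun y => ?_
  have : ContinuousLinearMap.adjoint (A - B) y = 0 := eq_zero_of_inner_gaussian fun a b => by
    rw [ContinuousLinearMap.adjoint_inner_left, sub_apply, h, sub_self,
      inner_zero_right]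
  have h2 := ContinuousLinearMap.adjoint_inner_left (A - B) x y
  rw [this, inner_zero_left, sub_apply, inner_sub_right] at h2
  exact sub_eq_zero.1 h2.symm

/-- Multiplication by a bounded function on the space of weight and clock. -/
noncomputable def wcMul (g : Lp ℂ ∞ (volume : Measure (ℝ × ℝ))) : WeightClock →L[ℂ] WeightClock :=
  (ContinuousLinearMap.lsmul ℂ ℂ : ℂ →L[ℂ] ℂ →L[ℂ] ℂ).holderL (volume : Measure (ℝ × ℝ)) ∞ 2 2 g

lemma coeFn_wcMul (g : Lp ℂ ∞ (volume : Measure (ℝ × ℝ))) (f : WeightClock) :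
    wcMul g f =ᵐ[volume] fun z => g z * f z :=
  ContinuousLinearMap.coeFn_holder (ContinuousLinearMap.lsmul ℂ ℂ : ℂ →L[ℂ] ℂ →L[ℂ] ℂ) g f

variable {n : Type*} [Fintype n] [DecidableEq n]

lemma ketTensor_wcTensor (j : n) (f g : Line) :
    ketTensor j (wcTensor f g) = tensor (EuclideanSpace.single j (1 : ℂ)) f g := by
  refine Lp.ext ?_
  filter_upwards [coeFn_ketTensor j (wcTensor f g), coeFn_wcTensor f g,
    coeFn_tensor (EuclideanSpace.single j (1 : ℂ)) f g] with z h1 h2 h3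
  rw [h1, h2, h3]

lemma coordOp_tensor (i : n) (v : EuclideanSpace ℂ n) (f g : Line) :
    coordOp i (tensor v f g) = v i • wcTensor f g := by
  refine Lp.ext ?_
  filter_upwards [coeFn_coordOp i (tensor v f g), coeFn_wcTensor f g, coeFn_tensor v f g,
    Lp.coeFn_smul (v i) (wcTensor f g)] with z h1 h2 h3 h4
  rw [h1, h3, h4, Pi.smul_apply, h2]
  simp [mul_comm]

variable {ρ : Total n →L[ℂ] Total n} {σ : Matrix n n ℂ} {ρw ρc : Line →L[ℂ] Line}

/-- On product vectors the block `⟨i| ρ |j⟩` acts as `σ i j` times `ρw ⊗ ρc`. The sum of the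
diagonal blocks serves as the operator `ρw ⊗ ρc`, which thus need not be constructed; `tr σ = 1`
normalizes it. -/
lemma IsProductOperator.coordOp_comp_ketTensor (h : IsProductOperator ρ σ ρw ρc)
    (hσ : σ.trace = 1) (i j : n) :
    coordOp i ∘L ρ ∘L ketTensor j = σ i j • ∑ a, coordOp a ∘L ρ ∘L ketTensor a := by
  have h1 : ∀ (i j : n) (f g : Line), (coordOp i ∘L ρ ∘L ketTensor j) (wcTensor f g) =
      σ i j • wcTensor (ρw f) (ρc g) := by
    intro i j f g
    rw [ContinuousLinearMap.comp_apply, ContinuousLinearMap.comp_apply, ketTensor_wcTensor, h,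
      coordOp_tensor, Matrix.ofLp_toEuclideanCLM]
    simp [Matrix.col]
  refine ext_of_wcTensor fun f g => ?_
  rw [h1, smul_apply, sum_apply]
  simp only [h1]
  rw [← Finset.sum_smul]
  have : ∑ i, σ i i = 1 := hσ
  rw [this, one_smul]

variable {ι : Type*} [Countable ι] {φ : ι → Total n}

/-- The integral over `B` of the `(i, j)` density is the trace of the block `⟨i| ρ |j⟩` times the
indicator of `B`. The blocks being proportional to `σ i j`, so are all these integrals, and hence
the densities. -/
lemma IsProductOperator.ae_ensembleMatrix (h : IsProductOperator ρ σ ρw ρc)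
    (hσ : σ.trace = 1) (hφ : IsEnsemble φ ρ) (i j : n) :
    ∀ᵐ z, ensembleMatrix φ z i j = σ i j * ensembleDensity φ z := by
  have hB : ∀ (B : Set (ℝ × ℝ)) (hB : MeasurableSet B) (i j : n),
      ∫ z in B, ensembleMatrix φ z i j =
        opTrace ((coordOp i ∘L ρ ∘L ketTensor j) ∘L wcMul (memLp_indicator B hB).toLp) := by
    intro B hB i j
    have h1 := hφ.opTrace_comp (ketTensor i) (ketTensor j ∘L wcMul (memLp_indicator B hB).toLp)
    rw [ContinuousLinearMap.adjoint_comp, adjoint_ketTensor, adjoint_ketTensor] at h1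
    have h2 := hasSum_integral_mul_conj hφ.summable i j (c := B.indicator fun _ => (1 : ℂ))
      (aestronglyMeasurable_const.indicator hB) (C := 1)
      fun z => by by_cases hz : z ∈ B <;> simp [hz]
    have h3 : opTrace ((coordOp i ∘L ρ ∘L ketTensor j) ∘L wcMul (memLp_indicator B hB).toLp) =
        opTrace (coordOp i ∘L ρ ∘L ketTensor j ∘L wcMul (memLp_indicator B hB).toLp) := rfl
    rw [h3, h1, ← integral_indicator hB]
    have h4 : ∀ z, B.indicator (fun z => ensembleMatrix φ z i j) z =
        B.indicator (fun _ => (1 : ℂ)) z * ensembleMatrix φ z i j := by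
      intro z
      by_cases hz : z ∈ B <;> simp [hz]
    simp_rw [h4]
    rw [← h2.tsum_eq]
    refine tsum_congr fun l => ?_
    rw [ContinuousLinearMap.comp_apply, ContinuousLinearMap.adjoint_inner_left, L2.inner_def]
    refine integral_congr_ae ?_
    filter_upwards [coeFn_wcMul (memLp_indicator B hB).toLp (coordOp i (φ l)),
      (memLp_indicator B hB).coeFn_toLp, coeFn_coordOp i (φ l), coeFn_coordOp j (φ l)]
      with z h1 h2 h3 h4
    rw [h1, h2, h3, h4, RCLike.inner_apply]
    ring
  have hkey : (fun z => ensembleMatrix φ z i j) =ᵐ[volume]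
      fun z => σ i j * ∑ a, ensembleMatrix φ z a a := by
    refine Integrable.ae_eq_of_forall_setIntegral_eq _ _
      (integrable_ensembleMatrix hφ.summable i j)
      ((integrable_finsetSum _ fun a _ =>
        integrable_ensembleMatrix hφ.summable a a).const_mul _) fun B hBm _ => ?_
    rw [integral_const_mul, integral_finsetSum _ fun a _ =>
      (integrable_ensembleMatrix hφ.summable a a).integrableOn, hB B hBm]
    simp only [hB B hBm]
    obtain ⟨τ, hτ⟩ : ∃ τ, ∀ i j, coordOp i ∘L ρ ∘L ketTensor j = σ i j • τ :=
      ⟨_, h.coordOp_comp_ketTensor hσ⟩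
    have hlin : ∀ c : ℂ, opTrace ((c • τ) ∘L wcMul (memLp_indicator B hBm).toLp) =
        c * opTrace (τ ∘L wcMul (memLp_indicator B hBm).toLp) := fun c => by
      simp [opTrace, tsum_mul_left]
    have : ∑ i, σ i i = 1 := hσ
    simp only [hτ, hlin]
    rw [← Finset.sum_mul, this, one_mul]
  filter_upwards [hkey, ae_ensembleDensity_eq_sum hφ.summable] with z h1 h2
  rw [h1, h2]

end Product

end ClockEngine

namespace ClockEngine

/-! ### Entropy of finite-dimensional states -/

section Entropy

variable {n u b : Type*} [Fintype n] [DecidableEq n] [Fintype u] [DecidableEq u] [Fintype b]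
  [DecidableEq b]

/-- `σ = Q diag(d) Q†` with `Q` unitary. -/
structure Diagonalizes (Q : Matrix n n ℂ) (d : n → ℝ) (σ : Matrix n n ℂ) : Prop where
  unitary : Q ∈ Matrix.unitaryGroup n ℂ
  eq : σ = Q * Matrix.diagonal (fun i => (d i : ℂ)) * star Q

lemma exists_diagonalizes {σ : Matrix n n ℂ} (h : σ.IsHermitian) :
    ∃ Q, Diagonalizes Q h.eigenvalues σ :=
  ⟨h.eigenvectorUnitary, h.eigenvectorUnitary.2, h.spectral_theorem⟩

namespace Diagonalizes

variable {Q σ : Matrix n n ℂ} {d : n → ℝ}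

lemma star_mul_self (h : Diagonalizes Q d σ) : star Q * Q = 1 :=
  Matrix.mem_unitaryGroup_iff'.1 h.unitary

lemma mul_star_self (h : Diagonalizes Q d σ) : Q * star Q = 1 :=
  Matrix.mem_unitaryGroup_iff.1 h.unitary

lemma star_mul_mul (h : Diagonalizes Q d σ) :
    star Q * σ * Q = Matrix.diagonal fun i => (d i : ℂ) := by
  rw [h.eq]
  simp only [← mul_assoc]
  rw [h.star_mul_self, one_mul, mul_assoc, h.star_mul_self, mul_one]

lemma isHermitian (h : Diagonalizes Q d σ) : σ.IsHermitian := by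
  rw [h.eq, Matrix.star_eq_conjTranspose]
  refine Matrix.isHermitian_mul_mul_conjTranspose _ ?_
  rw [Matrix.isHermitian_diagonal_iff]
  intro i
  simp [IsSelfAdjoint]

lemma trace (h : Diagonalizes Q d σ) : σ.trace = ∑ i, (d i : ℂ) := by
  rw [h.eq, Matrix.trace_mul_comm, ← mul_assoc, h.star_mul_self, one_mul, Matrix.trace_diagonal]

lemma posSemidef (h : Diagonalizes Q d σ) (hd : ∀ i, 0 ≤ d i) : σ.PosSemidef := by
  rw [h.eq, Matrix.star_eq_conjTranspose]
  refine Matrix.PosSemidef.mul_mul_conjTranspose_same (Matrix.PosSemidef.diagonal fun i => ?_) _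
  simpa using hd i

lemma nonneg (h : Diagonalizes Q d σ) (hσ : σ.PosSemidef) (i : n) : 0 ≤ d i := by
  have h1 := (hσ.conjTranspose_mul_mul_same Q).diag_nonneg (i := i)
  rw [← Matrix.star_eq_conjTranspose, h.star_mul_mul, Matrix.diagonal_apply_eq] at h1
  exact_mod_cast h1

lemma charpoly (h : Diagonalizes Q d σ) :
    σ.charpoly.roots = Multiset.map (fun i => (d i : ℂ)) Finset.univ.val := by
  rw [h.eq, Matrix.charpoly_mul_comm, ← mul_assoc, h.star_mul_self, one_mul,
    Matrix.charpoly_diagonal, Polynomial.roots_prod]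
  · simp
  · simp [Finset.prod_ne_zero_iff, Polynomial.X_sub_C_ne_zero]

/-- The functional calculus is evaluated on Mathlib's eigenvalues. Those and `d` are the same
multiset, namely the roots of the characteristic polynomial, and the sum depends on the multiset
only. -/
lemma entropy_eq (h : Diagonalizes Q d σ) (k : ℝ) :
    entropy k σ = k * ∑ i, Real.negMulLog (d i) := by
  have hσ := h.isHermitian
  have h1 : (cfc Real.negMulLog σ).trace = ∑ i, (Real.negMulLog (hσ.eigenvalues i) : ℂ) := by
    rw [hσ.cfc_eq, Matrix.IsHermitian.cfc, Unitary.conjStarAlgAut_apply, Matrix.trace_mul_comm,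
      ← mul_assoc, Unitary.coe_star_mul_self, one_mul, Matrix.trace_diagonal]
    rfl
  have h2 := hσ.roots_charpoly_eq_eigenvalues
  rw [h.charpoly] at h2
  have h3 := congrArg (fun s : Multiset ℂ => (s.map fun c => Real.negMulLog c.re).sum) h2
  simp only [Multiset.map_map, Function.comp_def] at h3
  rw [entropy, h1]
  congr 1
  have h4 : ∑ i, Real.negMulLog (d i) = ∑ i, Real.negMulLog (hσ.eigenvalues i) := h3
  rw [h4]
  simp

lemma kronecker {P τ : Matrix b b ℂ} {e : b → ℝ} {Q σ : Matrix u u ℂ} {d : u → ℝ}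
    (h : Diagonalizes Q d σ) (h' : Diagonalizes P e τ) :
    Diagonalizes (Q ⊗ₖ P) (fun i => d i.1 * e i.2) (σ ⊗ₖ τ) where
  unitary := Matrix.kronecker_mem_unitary h.unitary h'.unitary
  eq := by
    rw [h.eq, h'.eq, Matrix.mul_kronecker_mul, Matrix.mul_kronecker_mul,
      Matrix.diagonal_kronecker_diagonal, Matrix.star_eq_conjTranspose,
      Matrix.star_eq_conjTranspose, Matrix.star_eq_conjTranspose, Matrix.conjTranspose_kronecker]
    push_cast
    rfl

end Diagonalizes

/-! ### Doubly stochastic matrices and Shannon entropy -/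

lemma sum_normSq_row {M : Matrix n n ℂ} (hM : M ∈ Matrix.unitaryGroup n ℂ) (i : n) :
    ∑ j, Complex.normSq (M i j) = 1 := by
  have h := congrArg (fun A : Matrix n n ℂ => A i i) (Matrix.mem_unitaryGroup_iff.1 hM)
  simp only [Matrix.mul_apply, Matrix.star_apply, Matrix.one_apply_eq, RCLike.star_def,
    Complex.mul_conj] at h
  exact_mod_cast h

lemma sum_normSq_col {M : Matrix n n ℂ} (hM : M ∈ Matrix.unitaryGroup n ℂ) (j : n) :
    ∑ i, Complex.normSq (M i j) = 1 := by
  have h := congrArg (fun A : Matrix n n ℂ => A j j) (Matrix.mem_unitaryGroup_iff'.1 hM)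
  simp only [Matrix.mul_apply, Matrix.star_apply, Matrix.one_apply_eq, RCLike.star_def,
    mul_comm _ (M _ j), Complex.mul_conj] at h
  exact_mod_cast h

/-- The entropy of a probability vector does not decrease under a doubly stochastic matrix. -/
lemma sum_negMulLog_le_of_doublyStochastic {D : n → n → ℝ} (hD : ∀ i j, 0 ≤ D i j)
    (hrow : ∀ i, ∑ j, D i j = 1) (hcol : ∀ j, ∑ i, D i j = 1) {d : n → ℝ} (hd : ∀ j, 0 ≤ d j) :
    ∑ j, Real.negMulLog (d j) ≤ ∑ i, Real.negMulLog (∑ j, D i j * d j) := by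
  have h1 : ∀ i, ∑ j, D i j * Real.negMulLog (d j) ≤ Real.negMulLog (∑ j, D i j * d j) := by
    intro i
    -- Jensen along each row; the column sums then collapse the total of the left-hand sides.
    have := Real.concaveOn_negMulLog.le_map_sum (t := Finset.univ) (w := D i) (p := d)
      (fun j _ => hD i j) (hrow i) (fun j _ => hd j)
    simpa only [smul_eq_mul] using this
  refine le_trans (le_of_eq ?_) (Finset.sum_le_sum fun i _ => h1 i)
  rw [Finset.sum_comm]
  refine Finset.sum_congr rfl fun j _ => ?_
  rw [← Finset.sum_mul, hcol, one_mul]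

lemma mul_diagonal_mul_star_apply (M : Matrix n n ℂ) (d : n → ℝ) (i : n) :
    (M * Matrix.diagonal (fun i => (d i : ℂ)) * star M) i i =
      ((∑ j, Complex.normSq (M i j) * d j : ℝ) : ℂ) := by
  rw [Matrix.mul_apply]
  push_cast
  refine Finset.sum_congr rfl fun j _ => ?_
  rw [Matrix.mul_diagonal, Matrix.star_apply, RCLike.star_def, mul_right_comm, Complex.mul_conj]

/-- The entropy is at most the entropy of the diagonal in any orthonormal basis. -/
lemma entropy_le_diag {σ W : Matrix n n ℂ} (hσ : σ.PosSemidef)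
    (hW : W ∈ Matrix.unitaryGroup n ℂ) {k : ℝ} (hk : 0 ≤ k) :
    entropy k σ ≤ k * ∑ i, Real.negMulLog ((star W * σ * W) i i).re := by
  obtain ⟨Q, hQ⟩ := exists_diagonalizes hσ.isHermitian
  rw [hQ.entropy_eq k]
  -- The diagonal of `σ` in the basis `W` is the image of its eigenvalues under the squared moduli
  -- of the entries of `star W * Q`, a doubly stochastic matrix.
  have hM : star W * Q ∈ Matrix.unitaryGroup n ℂ := mul_mem (Unitary.star_mem hW) hQ.unitary
  have h1 : ∀ i, ((star W * σ * W) i i).re =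
      ∑ j, Complex.normSq ((star W * Q) i j) * hσ.isHermitian.eigenvalues j := by
    intro i
    have : star W * σ * W = (star W * Q) * Matrix.diagonal
        (fun i => (hσ.isHermitian.eigenvalues i : ℂ)) * star (star W * Q) := by
      conv_lhs => rw [hQ.eq]
      rw [star_mul, star_star]
      simp only [mul_assoc]
    rw [this, mul_diagonal_mul_star_apply, Complex.ofReal_re]
  simp only [h1]
  exact mul_le_mul_of_nonneg_left (sum_negMulLog_le_of_doublyStochastic
    (fun _ _ => Complex.normSq_nonneg _) (sum_normSq_row hM) (sum_normSq_col hM)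
    (hQ.nonneg hσ)) hk

/-- This is `log x ≤ x - 1` at `x = s / r`, the pointwise form of nonnegativity of relative entropy.
The support condition excludes `s = 0 < r`, where the convention `log 0 = 0` would spoil it. -/
lemma negMulLog_le_of_pos_imp {r s : ℝ} (hr : 0 ≤ r) (hs : 0 ≤ s) (h : 0 < r → 0 < s) :
    Real.negMulLog r ≤ -r * Real.log s + s - r := by
  rcases hr.eq_or_lt with rfl | hr
  · simpa using hs
  · have hs' := h hr
    have h1 := Real.log_le_sub_one_of_pos (div_pos hs' hr)
    rw [Real.log_div hs'.ne' hr.ne'] at h1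
    have h2 := mul_le_mul_of_nonneg_left h1 hr.le
    rw [mul_sub, mul_sub, mul_div_cancel₀ _ hr.ne'] at h2
    rw [Real.negMulLog]
    linarith

/-- Subadditivity of the Shannon entropy. -/
lemma sum_negMulLog_le_marginals {r : u × b → ℝ} (hr : ∀ i, 0 ≤ r i) (h1 : ∑ i, r i = 1) :
    ∑ i, Real.negMulLog (r i) ≤ (∑ i, Real.negMulLog (∑ j, r (i, j))) +
      ∑ j, Real.negMulLog (∑ i, r (i, j)) := by
  set p : u → ℝ := fun i => ∑ j, r (i, j) with hp
  set q : b → ℝ := fun j => ∑ i, r (i, j) with hq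
  have hp0 : ∀ i, 0 ≤ p i := fun i => Finset.sum_nonneg fun j _ => hr _
  have hq0 : ∀ i, 0 ≤ q i := fun i => Finset.sum_nonneg fun j _ => hr _
  have hp1 : ∑ i, p i = 1 := by rw [← h1, Fintype.sum_prod_type]
  have hq1 : ∑ i, q i = 1 := by rw [← h1, Fintype.sum_prod_type_right]
  have hle : ∀ i, Real.negMulLog (r i) ≤
      -r i * Real.log (p i.1) + -r i * Real.log (q i.2) + (p i.1 * q i.2 - r i) := by
    rintro ⟨i, j⟩
    -- A joint distribution is supported inside the product of its marginals, so `log (p q)` may be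
    -- split wherever `r` is positive; elsewhere the logarithms have coefficient zero.
    have hpos : 0 < r (i, j) → 0 < p i ∧ 0 < q j := fun h =>
      ⟨h.trans_le (Finset.single_le_sum (f := fun j => r (i, j)) (fun j _ => hr _)
        (Finset.mem_univ j)), h.trans_le (Finset.single_le_sum (f := fun i => r (i, j))
        (fun j _ => hr _) (Finset.mem_univ i))⟩
    have h := negMulLog_le_of_pos_imp (hr (i, j)) (mul_nonneg (hp0 i) (hq0 j))
      fun h => mul_pos (hpos h).1 (hpos h).2
    rcases (hr (i, j)).eq_or_lt with h0 | h0
    · simp only [← h0] at h ⊢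
      simpa using h
    · rw [Real.log_mul (hpos h0).1.ne' (hpos h0).2.ne'] at h
      simp only
      linarith
  refine (Finset.sum_le_sum fun i _ => hle i).trans (le_of_eq ?_)
  have e1 : ∑ i, -r i * Real.log (p i.1) = ∑ i, Real.negMulLog (p i) := by
    rw [Fintype.sum_prod_type]
    refine Finset.sum_congr rfl fun i _ => ?_
    dsimp only
    rw [← Finset.sum_mul, Finset.sum_neg_distrib, Real.negMulLog]
  have e2 : ∑ i, -r i * Real.log (q i.2) = ∑ i, Real.negMulLog (q i) := by
    rw [Fintype.sum_prod_type_right]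
    refine Finset.sum_congr rfl fun i _ => ?_
    dsimp only
    rw [← Finset.sum_mul, Finset.sum_neg_distrib, Real.negMulLog]
  have e3 : ∑ i : u × b, p i.1 * q i.2 = 1 := by
    rw [Fintype.sum_prod_type, ← Finset.sum_mul_sum, hp1, hq1, one_mul]
  rw [Finset.sum_add_distrib, Finset.sum_add_distrib, Finset.sum_sub_distrib, e1, e2, e3, h1,
    sub_self, add_zero]

/-! ### Partial traces in product bases -/

lemma star_kronecker_mul_mul_apply (σ : Matrix (u × b) (u × b) ℂ) (Q : Matrix u u ℂ)
    (P : Matrix b b ℂ) (i : u × b) :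
    (star (Q ⊗ₖ P) * σ * (Q ⊗ₖ P)) i i = ∑ a, ∑ c, ∑ a', ∑ c',
      (starRingEnd ℂ) (Q a' i.1) * (starRingEnd ℂ) (P c' i.2) * σ (a', c') (a, c) *
        (Q a i.1 * P c i.2) := by
  rw [Matrix.mul_apply, Fintype.sum_prod_type]
  refine Finset.sum_congr rfl fun a _ => Finset.sum_congr rfl fun c _ => ?_
  rw [Matrix.mul_apply, Fintype.sum_prod_type, Finset.sum_mul]
  refine Finset.sum_congr rfl fun a' _ => ?_
  rw [Finset.sum_mul]
  refine Finset.sum_congr rfl fun c' _ => ?_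
  simp [Matrix.star_apply]

/-- Completeness of the basis `P` removes it from the sum. Thus marginals of the diagonal in a
product basis are diagonals of the partial traces. -/
lemma sum_star_kronecker_right (σ : Matrix (u × b) (u × b) ℂ) (Q : Matrix u u ℂ)
    {P : Matrix b b ℂ} (hP : P ∈ Matrix.unitaryGroup b ℂ) (i : u) :
    ∑ j, (star (Q ⊗ₖ P) * σ * (Q ⊗ₖ P)) (i, j) (i, j) = (star Q * traceB σ * Q) i i := by
  have hPP : ∀ c c', ∑ j, P c j * (starRingEnd ℂ) (P c' j) = if c = c' then 1 else 0 := by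
    intro c c'
    have := congrArg (fun A : Matrix b b ℂ => A c c') (Matrix.mem_unitaryGroup_iff.1 hP)
    simpa [Matrix.mul_apply, Matrix.one_apply] using this
  simp only [star_kronecker_mul_mul_apply]
  rw [Finset.sum_comm, Matrix.mul_apply]
  refine Finset.sum_congr rfl fun a _ => ?_
  rw [Matrix.mul_apply, Finset.sum_mul]
  calc _ = ∑ c, ∑ a', ∑ c', (starRingEnd ℂ) (Q a' i) * σ (a', c') (a, c) * Q a i *
        ∑ j, P c j * (starRingEnd ℂ) (P c' j) := by
        rw [Finset.sum_comm]
        refine Finset.sum_congr rfl fun c _ => ?_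
        rw [Finset.sum_comm]
        refine Finset.sum_congr rfl fun a' _ => ?_
        rw [Finset.sum_comm]
        refine Finset.sum_congr rfl fun c' _ => ?_
        rw [Finset.mul_sum]
        exact Finset.sum_congr rfl fun j _ => by ring
    _ = _ := by
        simp only [hPP, mul_ite, mul_one, mul_zero, Finset.sum_ite_eq, Finset.mem_univ, if_true]
        rw [Finset.sum_comm]
        refine Finset.sum_congr rfl fun a' _ => ?_
        rw [traceB, Matrix.of_apply, Matrix.star_apply, Finset.mul_sum, Finset.sum_mul]
        rfl

lemma sum_star_kronecker_left (σ : Matrix (u × b) (u × b) ℂ) {Q : Matrix u u ℂ}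
    (hQ : Q ∈ Matrix.unitaryGroup u ℂ) (P : Matrix b b ℂ) (j : b) :
    ∑ i, (star (Q ⊗ₖ P) * σ * (Q ⊗ₖ P)) (i, j) (i, j) = (star P * traceU σ * P) j j := by
  have hQQ : ∀ c c', ∑ j, Q c j * (starRingEnd ℂ) (Q c' j) = if c = c' then 1 else 0 := by
    intro c c'
    have := congrArg (fun A : Matrix u u ℂ => A c c') (Matrix.mem_unitaryGroup_iff.1 hQ)
    simpa [Matrix.mul_apply, Matrix.one_apply] using this
  simp only [star_kronecker_mul_mul_apply]
  rw [Matrix.mul_apply]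
  calc _ = ∑ c, ∑ c', ∑ a, ∑ a', (starRingEnd ℂ) (P c' j) * σ (a', c') (a, c) * P c j *
        ∑ i, Q a i * (starRingEnd ℂ) (Q a' i) := by
        rw [Finset.sum_comm, Finset.sum_congr rfl fun a _ => Finset.sum_comm, Finset.sum_comm]
        refine Finset.sum_congr rfl fun c _ => ?_
        rw [Finset.sum_comm (s := Finset.univ (α := b))]
        refine Finset.sum_congr rfl fun a _ => ?_
        rw [Finset.sum_comm (s := Finset.univ (α := b)), Finset.sum_comm]
        refine Finset.sum_congr rfl fun a' _ => ?_
        rw [Finset.sum_comm]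
        refine Finset.sum_congr rfl fun c' _ => ?_
        rw [Finset.mul_sum]
        exact Finset.sum_congr rfl fun j _ => by ring
    _ = _ := by
        refine Finset.sum_congr rfl fun c _ => ?_
        simp only [hQQ, mul_ite, mul_one, mul_zero, Finset.sum_ite_eq, Finset.mem_univ, if_true]
        rw [Matrix.mul_apply, Finset.sum_mul]
        refine Finset.sum_congr rfl fun c' _ => ?_
        rw [traceU, Matrix.of_apply, Matrix.star_apply, Finset.mul_sum, Finset.sum_mul]
        rfl

lemma traceB_isHermitian {σ : Matrix (u × b) (u × b) ℂ} (h : σ.IsHermitian) :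
    (traceB σ).IsHermitian := by
  ext i j
  simp only [traceB, Matrix.conjTranspose_apply, Matrix.of_apply, star_sum]
  exact Finset.sum_congr rfl fun k _ => h.apply _ _

lemma traceU_isHermitian {σ : Matrix (u × b) (u × b) ℂ} (h : σ.IsHermitian) :
    (traceU σ).IsHermitian := by
  ext i j
  simp only [traceU, Matrix.conjTranspose_apply, Matrix.of_apply, star_sum]
  exact Finset.sum_congr rfl fun k _ => h.apply _ _

lemma trace_star_mul_mul {W : Matrix n n ℂ} (hW : W ∈ Matrix.unitaryGroup n ℂ)
    (σ : Matrix n n ℂ) : (star W * σ * W).trace = σ.trace := by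
  rw [Matrix.trace_mul_comm, ← mul_assoc, Matrix.mem_unitaryGroup_iff.1 hW, one_mul]

/-- Subadditivity of the von Neumann entropy. -/
lemma entropy_le_add {σ : Matrix (u × b) (u × b) ℂ} (hσ : IsDensityMatrix σ) {k : ℝ}
    (hk : 0 ≤ k) : entropy k σ ≤ entropy k (traceB σ) + entropy k (traceU σ) := by
  obtain ⟨Q, hQ⟩ := exists_diagonalizes (traceB_isHermitian hσ.1.isHermitian)
  obtain ⟨P, hP⟩ := exists_diagonalizes (traceU_isHermitian hσ.1.isHermitian)
  have hW := Matrix.kronecker_mem_unitary hQ.unitary hP.unitary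
  -- In the product of the eigenbases of the two reduced states, the diagonal of `σ` has the
  -- eigenvalues of these states as marginals. Its Shannon entropy bounds that of `σ` from above,
  -- and classical subadditivity finishes.
  set r : u × b → ℝ := fun i => ((star (Q ⊗ₖ P) * σ * (Q ⊗ₖ P)) i i).re with hr
  have hr0 : ∀ i, 0 ≤ r i := fun i =>
    (Complex.nonneg_iff.1 ((hσ.1.conjTranspose_mul_mul_same (Q ⊗ₖ P)).diag_nonneg (i := i))).1
  have hr1 : ∑ i, r i = 1 := by
    have := congrArg Complex.re ((trace_star_mul_mul hW σ).trans hσ.2)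
    simpa [Matrix.trace] using this
  have hB : ∀ i, ∑ j, r (i, j) = (traceB_isHermitian hσ.1.isHermitian).eigenvalues i := by
    intro i
    simp only [hr]
    rw [← Complex.re_sum, sum_star_kronecker_right σ Q hP.unitary, hQ.star_mul_mul,
      Matrix.diagonal_apply_eq, Complex.ofReal_re]
  have hU : ∀ j, ∑ i, r (i, j) = (traceU_isHermitian hσ.1.isHermitian).eigenvalues j := by
    intro j
    simp only [hr]
    rw [← Complex.re_sum, sum_star_kronecker_left σ hQ.unitary P, hP.star_mul_mul,
      Matrix.diagonal_apply_eq, Complex.ofReal_re]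
  rw [hQ.entropy_eq, hP.entropy_eq, ← mul_add]
  refine (entropy_le_diag hσ.1 hW hk).trans (mul_le_mul_of_nonneg_left ?_ hk)
  have := sum_negMulLog_le_marginals hr0 hr1
  simpa only [hB, hU] using this

/-- Additivity of the von Neumann entropy. -/
lemma entropy_kronecker {σ : Matrix u u ℂ} {τ : Matrix b b ℂ} (hσ : IsDensityMatrix σ)
    (hτ : IsDensityMatrix τ) (k : ℝ) :
    entropy k (σ ⊗ₖ τ) = entropy k σ + entropy k τ := by
  obtain ⟨Q, hQ⟩ := exists_diagonalizes hσ.1.isHermitian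
  obtain ⟨P, hP⟩ := exists_diagonalizes hτ.1.isHermitian
  have h1 : ∑ i, hσ.1.isHermitian.eigenvalues i = 1 := by
    exact_mod_cast hQ.trace.symm.trans hσ.2
  have h2 : ∑ i, hτ.1.isHermitian.eigenvalues i = 1 := by
    exact_mod_cast hP.trace.symm.trans hτ.2
  rw [(hQ.kronecker hP).entropy_eq, hQ.entropy_eq, hP.entropy_eq, ← mul_add]
  congr 1
  simp only [Real.negMulLog_mul]
  rw [Finset.sum_add_distrib, Fintype.sum_prod_type, Fintype.sum_prod_type]
  simp only [← Finset.mul_sum, ← Finset.sum_mul, h1, h2, one_mul]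

lemma traceB_kronecker (σ : Matrix u u ℂ) {τ : Matrix b b ℂ} (hτ : τ.trace = 1) :
    traceB (σ ⊗ₖ τ) = σ := by
  ext i j
  have : ∑ k, τ k k = 1 := hτ
  simp [traceB, ← Finset.mul_sum, this]

lemma traceU_kronecker {σ : Matrix u u ℂ} (τ : Matrix b b ℂ) (hσ : σ.trace = 1) :
    traceU (σ ⊗ₖ τ) = τ := by
  ext i j
  have : ∑ k, σ k k = 1 := hσ
  simp [traceU, ← Finset.sum_mul, this]

lemma energy_systemHamiltonian (Hu : Matrix u u ℂ) (Hb : Matrix b b ℂ)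
    (σ : Matrix (u × b) (u × b) ℂ) :
    energy (systemHamiltonian Hu Hb) σ = energy Hu (traceB σ) + energy Hb (traceU σ) := by
  have h1 : ((Hu ⊗ₖ (1 : Matrix b b ℂ)) * σ).trace = (Hu * traceB σ).trace := by
    simp only [Matrix.trace, Matrix.diag, Matrix.mul_apply, Fintype.sum_prod_type,
      Matrix.kroneckerMap_apply, traceB, Matrix.of_apply, Matrix.one_apply, mul_ite, mul_one,
      mul_zero, ite_mul, zero_mul, Finset.sum_ite_eq, Finset.mem_univ, if_true, Finset.mul_sum]
    exact Finset.sum_congr rfl fun i _ => Finset.sum_comm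
  have h2 : (((1 : Matrix u u ℂ) ⊗ₖ Hb) * σ).trace = (Hb * traceU σ).trace := by
    simp only [Matrix.trace, Matrix.diag, Matrix.mul_apply, Fintype.sum_prod_type,
      Matrix.kroneckerMap_apply, traceU, Matrix.of_apply, Matrix.one_apply, ite_mul, one_mul,
      zero_mul, Finset.mul_sum]
    have e : ∀ (i : u) (x : b), ∑ x_1 : u, ∑ x_2 : b,
        (if i = x_1 then Hb x x_2 * σ (x_1, x_2) (i, x) else 0) =
        ∑ x_2 : b, Hb x x_2 * σ (i, x_2) (i, x) := by
      intro i x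
      rw [Finset.sum_comm]
      simp
    simp only [e]
    rw [Finset.sum_comm]
    exact Finset.sum_congr rfl fun i _ => Finset.sum_comm
  rw [energy, energy, energy, systemHamiltonian, add_mul, Matrix.trace_add, Complex.add_re, h1, h2]

end Entropy

end ClockEngine

namespace ClockEngine

/-! ### Mixtures of unitaries and the thermal state -/

section Mixture

variable {n b : Type*} [Fintype n] [DecidableEq n] [Fintype b] [DecidableEq b]
  {α : Type*} [MeasurableSpace α] {m : Measure α}

lemma measurable_mul_mul_entry {V : α → Matrix n n ℂ} (hV : ∀ i j, Measurable fun z => V z i j)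
    (A B : Matrix n n ℂ) (i j : n) : Measurable fun z => (A * V z * B) i j := by
  simp only [Matrix.mul_apply]
  exact Finset.measurable_sum _ fun a _ => (Finset.measurable_sum _ fun c _ =>
    (hV c a).const_mul _).mul_const _

lemma integrable_mul_conj_entry {μ : α → ℝ} (hμ : Integrable μ m) {V : α → Matrix n n ℂ}
    (hV : ∀ i j, Measurable fun z => V z i j) (hVu : ∀ z, V z ∈ Matrix.unitaryGroup n ℂ)
    (σ : Matrix n n ℂ) (i j : n) :
    Integrable (fun z => (μ z : ℂ) * (V z * σ * star (V z)) i j) m := by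
  have h1 : ∀ z, (μ z : ℂ) * (V z * σ * star (V z)) i j =
      ∑ c, ∑ a, (μ z : ℂ) * (V z i a * σ a c * (starRingEnd ℂ) (V z j c)) := by
    intro z
    rw [Matrix.mul_apply, Finset.mul_sum]
    refine Finset.sum_congr rfl fun c _ => ?_
    rw [Matrix.mul_apply, Finset.sum_mul, Finset.mul_sum]
    rfl
  simp only [h1]
  refine integrable_finsetSum _ fun c _ => integrable_finsetSum _ fun a _ => ?_
  refine (hμ.ofReal (𝕜 := ℂ)).mul_bdd (c := ‖σ a c‖) ?_ (Filter.Eventually.of_forall fun z => ?_)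
  · exact (((hV i a).mul_const _).mul
      (Complex.continuous_conj.measurable.comp (hV j c))).aestronglyMeasurable
  · rw [norm_mul, norm_mul, RCLike.norm_conj]
    have h2 := entry_norm_bound_of_unitary (hVu z) i a
    have h3 := entry_norm_bound_of_unitary (hVu z) j c
    calc ‖V z i a‖ * ‖σ a c‖ * ‖V z j c‖ ≤ 1 * ‖σ a c‖ * 1 := by gcongr
      _ = ‖σ a c‖ := by ring

/-- A mixture of unitary images of a state is a state, and has at least its entropy. -/
lemma isDensityMatrix_and_entropy_le_of_mixture {μ : α → ℝ} (hμ0 : ∀ z, 0 ≤ μ z)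
    (hμ : Integrable μ m) (hμ1 : ∫ z, μ z ∂m = 1) {V : α → Matrix n n ℂ}
    (hV : ∀ i j, Measurable fun z => V z i j) (hVu : ∀ z, V z ∈ Matrix.unitaryGroup n ℂ)
    {σ σ' : Matrix n n ℂ} (hσ : IsDensityMatrix σ)
    (h : ∀ i j, σ' i j = ∫ z, (μ z : ℂ) * (V z * σ * star (V z)) i j ∂m) {k : ℝ} (hk : 0 ≤ k) :
    IsDensityMatrix σ' ∧ entropy k σ ≤ entropy k σ' := by
  have hint := integrable_mul_conj_entry hμ hV hVu σ
  have hH : σ'.IsHermitian := by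
    ext i j
    rw [Matrix.conjTranspose_apply, h, h, RCLike.star_def, ← integral_conj]
    refine integral_congr_ae (Filter.Eventually.of_forall fun z => ?_)
    have h1 : (V z * σ * star (V z)).IsHermitian :=
      Matrix.isHermitian_mul_mul_conjTranspose _ hσ.1.isHermitian
    simp only [map_mul, Complex.conj_ofReal]
    rw [← h1.apply i j]
    rfl
  obtain ⟨W, hW⟩ := exists_diagonalizes hH
  obtain ⟨Q, hQ⟩ := exists_diagonalizes hσ.1.isHermitian
  set d := hσ.1.isHermitian.eigenvalues
  set M : α → Matrix n n ℂ := fun z => star W * V z * Q with hM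
  have hMu : ∀ z, M z ∈ Matrix.unitaryGroup n ℂ := fun z =>
    mul_mem (mul_mem (Unitary.star_mem hW.unitary) (hVu z)) hQ.unitary
  have hMm : ∀ i j, Measurable fun z => M z i j := measurable_mul_mul_entry hV _ _
  -- An average of doubly stochastic matrices, hence doubly stochastic, between the eigenbasis `Q`
  -- of `σ` and the eigenbasis `W` of `σ'`. Working in these fixed bases reduces everything to
  -- scalar integrals.
  set D : n → n → ℝ := fun i j => ∫ z, μ z * Complex.normSq (M z i j) ∂m with hD
  have hDi : ∀ i j, Integrable (fun z => μ z * Complex.normSq (M z i j)) m := by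
    intro i j
    refine hμ.mul_bdd (c := 1) (Complex.continuous_normSq.measurable.comp
      (hMm i j)).aestronglyMeasurable (Filter.Eventually.of_forall fun z => ?_)
    rw [Complex.normSq_eq_norm_sq, norm_pow, norm_norm]
    exact pow_le_one₀ (norm_nonneg _) (entry_norm_bound_of_unitary (hMu z) i j)
  have hD0 : ∀ i j, 0 ≤ D i j := fun i j =>
    integral_nonneg fun z => mul_nonneg (hμ0 z) (Complex.normSq_nonneg _)
  have hrow : ∀ i, ∑ j, D i j = 1 := by
    intro i
    rw [← integral_finsetSum _ fun j _ => hDi i j, ← hμ1]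
    simp only [← Finset.mul_sum, sum_normSq_row (hMu _), mul_one]
  have hcol : ∀ j, ∑ i, D i j = 1 := by
    intro j
    rw [← integral_finsetSum _ fun i _ => hDi i j, ← hμ1]
    simp only [← Finset.mul_sum, sum_normSq_col (hMu _), mul_one]
  have hd' : ∀ i, hH.eigenvalues i = ∑ j, D i j * d j := by
    intro i
    have h1 : ((hH.eigenvalues i : ℝ) : ℂ) = ∫ z, (μ z : ℂ) *
        (M z * Matrix.diagonal (fun i => (d i : ℂ)) * star (M z)) i i ∂m := by
      have h2 := congrArg (fun A : Matrix n n ℂ => A i i) hW.star_mul_mul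
      simp only [Matrix.diagonal_apply_eq] at h2
      rw [← h2]
      have h3 : ∀ z, (μ z : ℂ) * (M z * Matrix.diagonal (fun i => (d i : ℂ)) * star (M z)) i i =
          ∑ c, ∑ a, (star W) i a * ((μ z : ℂ) * (V z * σ * star (V z)) a c) * W c i := by
        intro z
        have h4 : M z * Matrix.diagonal (fun i => (d i : ℂ)) * star (M z) =
            star W * (V z * σ * star (V z)) * W := by
          rw [hQ.eq, hM]
          simp only [star_mul, star_star, mul_assoc]
        rw [h4, Matrix.mul_apply, Finset.mul_sum]
        refine Finset.sum_congr rfl fun c _ => ?_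
        rw [Matrix.mul_apply, Finset.sum_mul, Finset.mul_sum]
        exact Finset.sum_congr rfl fun a _ => by ring
      simp only [h3]
      rw [integral_finsetSum _ fun c _ => integrable_finsetSum _ fun a _ =>
        ((hint a c).const_mul _).mul_const _, Matrix.mul_apply]
      refine Finset.sum_congr rfl fun c _ => ?_
      rw [integral_finsetSum _ fun a _ => ((hint a c).const_mul _).mul_const _, Matrix.mul_apply,
        Finset.sum_mul]
      refine Finset.sum_congr rfl fun a _ => ?_
      rw [integral_mul_const, integral_const_mul, ← h]
    simp only [mul_diagonal_mul_star_apply, ← Complex.ofReal_mul] at h1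
    rw [integral_complex_ofReal] at h1
    rw [Complex.ofReal_inj.1 h1]
    simp only [Finset.mul_sum, ← mul_assoc]
    rw [integral_finsetSum _ fun j _ => (hDi i j).mul_const _]
    exact Finset.sum_congr rfl fun j _ => integral_mul_const _ _
  have hd := hQ.nonneg hσ.1
  refine ⟨⟨hW.posSemidef fun i => ?_, ?_⟩, ?_⟩
  · rw [hd']
    exact Finset.sum_nonneg fun j _ => mul_nonneg (hD0 i j) (hd j)
  · rw [hW.trace, ← hσ.2, hQ.trace, ← Complex.ofReal_sum, ← Complex.ofReal_sum]
    congr 1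
    simp only [hd']
    rw [Finset.sum_comm]
    simp only [← Finset.sum_mul, hcol, one_mul]
  · rw [hW.entropy_eq, hQ.entropy_eq]
    refine mul_le_mul_of_nonneg_left ?_ hk
    simp only [hd']
    exact sum_negMulLog_le_of_doublyStochastic hD0 hrow hcol hd

/-! ### Gibbs states -/

lemma Diagonalizes.exp_smul {Q A : Matrix n n ℂ} {d : n → ℝ} (h : Diagonalizes Q d A) (c : ℂ) :
    NormedSpace.exp (c • A) = Q * Matrix.diagonal (fun i => Complex.exp (c * d i)) * star Q := by
  have hinv : Q⁻¹ = star Q := Matrix.inv_eq_right_inv h.mul_star_self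
  have hu : IsUnit Q := IsUnit.of_mul_eq_one _ h.mul_star_self
  have h1 : c • A = Q * Matrix.diagonal (fun i => c * d i) * Q⁻¹ := by
    rw [h.eq, hinv, ← Matrix.smul_mul, ← Matrix.mul_smul, ← Matrix.diagonal_smul]
    rfl
  rw [h1, Matrix.exp_conj _ _ hu, hinv, Matrix.exp_diagonal]
  congr 3
  funext i
  rw [Pi.coe_exp, ← Complex.exp_eq_exp_ℂ]

variable [Nonempty b] {k T : ℝ} {Hb : Matrix b b ℂ}

/-- The Boltzmann weights. -/
lemma Diagonalizes.thermalState {Q : Matrix b b ℂ} {d : b → ℝ} (h : Diagonalizes Q d Hb) :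
    Diagonalizes Q (fun i => Real.exp (-(1 / (k * T)) * d i) /
      ∑ j, Real.exp (-(1 / (k * T)) * d j)) (thermalState k T Hb) where
  unitary := h.unitary
  eq := by
    rw [ClockEngine.thermalState, h.exp_smul, Matrix.trace_mul_comm, ← mul_assoc, h.star_mul_self,
      one_mul, Matrix.trace_diagonal, ← Matrix.smul_mul, ← Matrix.mul_smul,
      ← Matrix.diagonal_smul]
    congr 3
    funext i
    rw [Pi.smul_apply, smul_eq_mul]
    push_cast
    exact (div_eq_inv_mul _ _).symm

lemma isDensityMatrix_thermalState (hHb : Hb.IsHermitian) :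
    IsDensityMatrix (thermalState k T Hb) := by
  obtain ⟨Q, hQ⟩ := exists_diagonalizes hHb
  have h := hQ.thermalState (k := k) (T := T)
  have hZ : 0 < ∑ j, Real.exp (-(1 / (k * T)) * hHb.eigenvalues j) :=
    Finset.sum_pos (fun j _ => Real.exp_pos _) Finset.univ_nonempty
  refine ⟨h.posSemidef fun i => by positivity, ?_⟩
  rw [h.trace, ← Complex.ofReal_sum, ← Finset.sum_div, div_self hZ.ne', Complex.ofReal_one]

lemma Diagonalizes.energy_eq {Q A : Matrix n n ℂ} {d : n → ℝ} (h : Diagonalizes Q d A)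
    (σ : Matrix n n ℂ) : energy A σ = ∑ i, d i * ((star Q * σ * Q) i i).re := by
  have h1 : (A * σ).trace = (Matrix.diagonal (fun i => (d i : ℂ)) * (star Q * σ * Q)).trace := by
    rw [h.eq, ← mul_assoc, ← mul_assoc, Matrix.trace_mul_comm _ Q]
    simp only [mul_assoc]
  rw [energy, h1, Matrix.trace, Complex.re_sum]
  refine Finset.sum_congr rfl fun i _ => ?_
  rw [Matrix.diag_apply, Matrix.diagonal_mul, Complex.re_ofReal_mul]

/-- The Gibbs variational principle: the thermal state minimizes the free energy. -/
lemma freeEnergy_thermalState_le (hk : 0 < k) (hT : 0 < T) (hHb : Hb.IsHermitian)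
    {σ : Matrix b b ℂ} (hσ : IsDensityMatrix σ) :
    freeEnergy k T Hb (thermalState k T Hb) ≤ freeEnergy k T Hb σ := by
  obtain ⟨Q, hQ⟩ := exists_diagonalizes hHb
  set d := hHb.eigenvalues
  have hth := hQ.thermalState (k := k) (T := T)
  have hkT : k * T ≠ 0 := (mul_pos hk hT).ne'
  set Z := ∑ j, Real.exp (-(1 / (k * T)) * d j) with hZdef
  have hZ : 0 < Z := Finset.sum_pos (fun j _ => Real.exp_pos _) Finset.univ_nonempty
  set τ : b → ℝ := fun i => Real.exp (-(1 / (k * T)) * d i) / Z with hτ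
  have hτ0 : ∀ i, 0 < τ i := fun i => by positivity
  have hτ1 : ∑ i, τ i = 1 := by rw [hτ, ← Finset.sum_div, div_self hZ.ne']
  have hlog : ∀ i, Real.log (τ i) = -(1 / (k * T)) * d i - Real.log Z := fun i => by
    rw [hτ, Real.log_div (Real.exp_pos _).ne' hZ.ne', Real.log_exp]
  -- The cross entropy relative to the Boltzmann weights is affine in the energy. At `p = τ` it
  -- yields the value `-k T log Z` of the minimum.
  have hgen : ∀ p : b → ℝ, ∑ i, p i = 1 →
      ∑ i, -p i * Real.log (τ i) = (1 / (k * T)) * (∑ i, d i * p i) + Real.log Z := by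
    intro p hp
    have : ∀ i, -p i * Real.log (τ i) = (1 / (k * T)) * (d i * p i) + p i * Real.log Z := by
      intro i
      rw [hlog]
      ring
    simp only [this]
    rw [Finset.sum_add_distrib, ← Finset.mul_sum, ← Finset.sum_mul, hp, one_mul]
  have hF : freeEnergy k T Hb (ClockEngine.thermalState k T Hb) = -(k * T * Real.log Z) := by
    rw [freeEnergy, hth.entropy_eq, hQ.energy_eq, hth.star_mul_mul]
    simp only [Matrix.diagonal_apply_eq, Complex.ofReal_re]
    have h1 : ∑ i, Real.negMulLog (τ i) = (1 / (k * T)) * (∑ i, d i * τ i) + Real.log Z :=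
      hgen τ hτ1
    rw [h1]
    field_simp
    ring
  set p : b → ℝ := fun i => ((star Q * σ * Q) i i).re with hp
  have hp0 : ∀ i, 0 ≤ p i := fun i =>
    (Complex.nonneg_iff.1 ((hσ.1.conjTranspose_mul_mul_same Q).diag_nonneg (i := i))).1
  have hp1 : ∑ i, p i = 1 := by
    have := congrArg Complex.re ((trace_star_mul_mul hQ.unitary σ).trans hσ.2)
    simpa [Matrix.trace] using this
  have hS := entropy_le_diag hσ.1 hQ.unitary hk.le
  -- Nonnegativity of the relative entropy of `p`, the populations of `σ` in the energy eigenbasis,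
  -- with respect to `τ`.
  have h2 : ∑ i, Real.negMulLog (p i) ≤ (1 / (k * T)) * (∑ i, d i * p i) + Real.log Z := by
    rw [← hgen p hp1]
    have h3 := Finset.sum_le_sum fun i (_ : i ∈ Finset.univ) =>
      negMulLog_le_of_pos_imp (hp0 i) (hτ0 i).le fun _ => hτ0 i
    rw [Finset.sum_sub_distrib, Finset.sum_add_distrib, hτ1, hp1] at h3
    linarith
  have h4 : T * entropy k σ ≤ (∑ i, d i * p i) + k * T * Real.log Z := by
    calc T * entropy k σ ≤ T * (k * ∑ i, Real.negMulLog (p i)) :=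
          mul_le_mul_of_nonneg_left hS hT.le
      _ ≤ T * (k * ((1 / (k * T)) * (∑ i, d i * p i) + Real.log Z)) := by gcongr
      _ = _ := by field_simp
  rw [hF, freeEnergy, hQ.energy_eq]
  linarith

/-- In an eigenbasis of the partial trace its eigenvalues are sums of diagonal entries of a
conjugate of `σ`, hence nonnegative. -/
lemma isDensityMatrix_traceU {u : Type*} [Fintype u] [DecidableEq u]
    {σ : Matrix (u × b) (u × b) ℂ} (hσ : IsDensityMatrix σ) : IsDensityMatrix (traceU σ) := by
  obtain ⟨P, hP⟩ := exists_diagonalizes (traceU_isHermitian hσ.1.isHermitian)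
  refine ⟨hP.posSemidef fun j => ?_, ?_⟩
  · have h1 := sum_star_kronecker_left σ (one_mem (Matrix.unitaryGroup u ℂ)) P j
    rw [hP.star_mul_mul, Matrix.diagonal_apply_eq] at h1
    have h2 : 0 ≤ (((traceU_isHermitian hσ.1.isHermitian).eigenvalues j : ℝ) : ℂ) := by
      rw [← h1]
      exact Finset.sum_nonneg fun i _ => (hσ.1.conjTranspose_mul_mul_same _).diag_nonneg
    exact_mod_cast h2
  · rw [← hσ.2, Matrix.trace, Matrix.trace, Fintype.sum_prod_type, Finset.sum_comm]
    rfl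

end Mixture

end ClockEngine

namespace ClockEngine

/-! ### Spectral measures of translations -/

section Plancherel

open FourierTransform

variable {E : Type*} [NormedAddCommGroup E] [InnerProductSpace ℝ E] [FiniteDimensional ℝ E]
  [MeasurableSpace E] [BorelSpace E]

/-- The translation `f ↦ f (· + v)` on `L²(E)`. -/
noncomputable def translate (v : E) : Lp ℂ 2 (volume : Measure E) →ₗᵢ[ℂ] Lp ℂ 2 (volume : Measure E) :=
  Lp.compMeasurePreservingₗᵢ ℂ (fun z : E => z + v) (measurePreserving_add_right volume v)

lemma coeFn_translate (v : E) (f : Lp ℂ 2 (volume : Measure E)) :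
    translate v f =ᵐ[volume] fun z => f (z + v) :=
  Lp.coeFn_compMeasurePreserving f (measurePreserving_add_right volume v)

lemma memLp_fourierPhase (v : E) :
    MemLp (fun ξ : E => Complex.exp (2 * Real.pi * Complex.I * (⟪v, ξ⟫_ℝ : ℂ))) ∞ volume := by
  refine memLp_top_of_bound (C := 1) ?_ ?_
  · exact Continuous.aestronglyMeasurable (by fun_prop)
  · refine Filter.Eventually.of_forall fun z => ?_
    simp [Complex.norm_exp]

/-- Multiplication by `exp (2 π i ⟨v, ξ⟩)`. -/
noncomputable def fourierPhase (v : E) :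
    Lp ℂ 2 (volume : Measure E) →L[ℂ] Lp ℂ 2 (volume : Measure E) :=
  (ContinuousLinearMap.lsmul ℂ ℂ : ℂ →L[ℂ] ℂ →L[ℂ] ℂ).holderL volume ∞ 2 2
    (memLp_fourierPhase v).toLp

lemma coeFn_fourierPhase (v : E) (f : Lp ℂ 2 (volume : Measure E)) :
    fourierPhase v f =ᵐ[volume]
      fun ξ => Complex.exp (2 * Real.pi * Complex.I * (⟪v, ξ⟫_ℝ : ℂ)) * f ξ := by
  filter_upwards [(memLp_fourierPhase v).coeFn_toLp, ContinuousLinearMap.coeFn_holder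
    (r := 2) (ContinuousLinearMap.lsmul ℂ ℂ : ℂ →L[ℂ] ℂ →L[ℂ] ℂ) (memLp_fourierPhase v).toLp f]
    with z h1 h2
  rw [h1] at h2
  exact h2

/-- The Fourier transform turns translations into multiplications. -/
lemma fourier_translate (v : E) (f : Lp ℂ 2 (volume : Measure E)) :
    Lp.fourierTransformₗᵢ E ℂ (translate v f) = fourierPhase v (Lp.fourierTransformₗᵢ E ℂ f) := by
  -- Both sides are continuous in `f`, so Schwartz functions suffice; there the transform is the
  -- usual integral.
  refine DenseRange.induction_on
    (p := fun f => Lp.fourierTransformₗᵢ E ℂ (translate v f) =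
      fourierPhase v (Lp.fourierTransformₗᵢ E ℂ f))
    (SchwartzMap.denseRange_toLpCLM (p := 2) ENNReal.ofNat_ne_top) f ?_ ?_
  · exact isClosed_eq ((Lp.fourierTransformₗᵢ E ℂ).continuous.comp (translate v).continuous)
      ((fourierPhase v).continuous.comp (Lp.fourierTransformₗᵢ E ℂ).continuous)
  intro g
  have h1 : translate v (SchwartzMap.toLpCLM ℝ ℂ 2 volume g) =
      (g.compSubConstCLM ℂ (-v)).toLp 2 := by
    refine Lp.ext ?_
    filter_upwards [coeFn_translate v (SchwartzMap.toLpCLM ℝ ℂ 2 volume g),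
      (measurePreserving_add_right (volume : Measure E) v).quasiMeasurePreserving.ae
        (p := fun z => g.toLp 2 volume z = g z) (g.coeFn_toLp 2 volume), (g.compSubConstCLM ℂ (-v)).coeFn_toLp 2] with z h1 h2 h3
    rw [h1, h3, SchwartzMap.toLpCLM_apply, h2]
    simp
  have h2 : ∀ h : SchwartzMap E ℂ, Lp.fourierTransformₗᵢ E ℂ (h.toLp 2) = (𝓕 h).toLp 2 :=
    fun h => SchwartzMap.toLp_fourier_eq h
  rw [h1, SchwartzMap.toLpCLM_apply, h2, h2]
  refine Lp.ext ?_
  filter_upwards [coeFn_fourierPhase v ((𝓕 g).toLp 2), (𝓕 g).coeFn_toLp 2,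
    (𝓕 (g.compSubConstCLM ℂ (-v))).coeFn_toLp 2] with ξ h3 h4 h5
  rw [h3, h4, h5, SchwartzMap.fourier_coe, SchwartzMap.fourier_coe]
  have h6 : (g.compSubConstCLM ℂ (-v) : E → ℂ) = (g : E → ℂ) ∘ fun z => z + v := by
    funext z
    simp
  rw [h6]
  have h7 := congrFun (VectorFourier.fourierIntegral_comp_add_right Real.fourierChar
    (volume : Measure E) (innerₗ E) (g : E → ℂ) v) ξ
  refine h7.trans ?_
  rw [Circle.smul_def, Real.fourierChar_apply, smul_eq_mul]
  congr 2
  simp only [innerₗ_apply_apply]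
  push_cast
  ring

lemma inner_translate (v : E) (f : Lp ℂ 2 (volume : Measure E)) :
    ⟪f, translate v f⟫_ℂ = ∫ ξ, Complex.exp (2 * Real.pi * Complex.I * (⟪v, ξ⟫_ℝ : ℂ)) *
      ((‖Lp.fourierTransformₗᵢ E ℂ f ξ‖ ^ 2 : ℝ) : ℂ) := by
  rw [← (Lp.fourierTransformₗᵢ E ℂ).inner_map_map, fourier_translate, L2.inner_def]
  refine integral_congr_ae ?_
  filter_upwards [coeFn_fourierPhase v (Lp.fourierTransformₗᵢ E ℂ f)] with ξ h1
  rw [h1, RCLike.inner_apply, mul_assoc, Complex.mul_conj']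
  push_cast
  rfl

end Plancherel

section SpectralMeasure

/-- The translation `ψ ↦ ψ (· + v)` on the space of weight and clock. -/
noncomputable def wcShift (v : ℝ × ℝ) : WeightClock →ₗᵢ[ℂ] WeightClock :=
  Lp.compMeasurePreservingₗᵢ ℂ (fun z : ℝ × ℝ => z + v) (measurePreserving_add_right volume v)

lemma coeFn_wcShift (v : ℝ × ℝ) (f : WeightClock) :
    wcShift v f =ᵐ[volume] fun z => f (z + v) :=
  Lp.coeFn_compMeasurePreserving f (measurePreserving_add_right volume v)

/-- The distribution of the weight's position in a wave function. -/
lemma exists_spectralMeasure {ħ : ℝ} (hħ : ħ ≠ 0) (χ : WeightClock) :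
    ∃ m : Measure ℝ, IsFiniteMeasure m ∧ ∀ s : ℝ,
      ∫ a : ℝ, Complex.exp (-(Complex.I * s * a / ħ)) ∂m = ⟪χ, wcShift (s, 0) χ⟫_ℂ := by
  have hħ' : (ħ : ℂ) ≠ 0 := by exact_mod_cast hħ
  -- The `L²` Fourier transform requires an inner product space, whereas `ℝ × ℝ` carries the sup
  -- norm; `J` moves to the Euclidean product.
  let J : WeightClock →ₗᵢ[ℂ] Lp ℂ 2 (volume : Measure (WithLp 2 (ℝ × ℝ))) :=
    Lp.compMeasurePreservingₗᵢ ℂ _ (WithLp.volume_preserving_ofLp ℝ ℝ)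
  have hJ : ∀ f : WeightClock, J f =ᵐ[volume] fun z => f (WithLp.ofLp z) := fun f =>
    Lp.coeFn_compMeasurePreserving f (WithLp.volume_preserving_ofLp ℝ ℝ)
  have hJs : ∀ s : ℝ, J (wcShift (s, 0) χ) = translate (WithLp.toLp 2 (s, 0)) (J χ) := by
    intro s
    refine Lp.ext ?_
    filter_upwards [hJ (wcShift (s, 0) χ),
      (WithLp.volume_preserving_ofLp ℝ ℝ).quasiMeasurePreserving.ae (coeFn_wcShift (s, 0) χ),
      coeFn_translate (WithLp.toLp 2 (s, 0)) (J χ),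
      (measurePreserving_add_right (volume : Measure (WithLp 2 (ℝ × ℝ)))
        (WithLp.toLp 2 (s, 0))).quasiMeasurePreserving.ae (hJ χ)] with z h1 h2 h3 h4
    rw [h1, h2, h3, h4]
    rfl
  set F := Lp.fourierTransformₗᵢ (WithLp 2 (ℝ × ℝ)) ℂ (J χ) with hF
  have hFi : Integrable fun ξ => ‖F ξ‖ ^ 2 :=
    (memLp_two_iff_integrable_sq_norm (Lp.aestronglyMeasurable F)).1 (Lp.memLp F)
  have hFm : Measurable fun ξ => ENNReal.ofReal (‖F ξ‖ ^ 2) :=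
    ((Lp.stronglyMeasurable F).norm.measurable.pow_const 2).ennreal_ofReal
  -- The frequency `ξ` dual to `p` corresponds to the position `a = -2πħ ξ`, so that `exp (2πi s ξ)
  -- = exp (-i s a / ħ)`.
  let κ : WithLp 2 (ℝ × ℝ) → ℝ := fun ξ => -(2 * Real.pi * ħ * ξ.fst)
  have hκ : Measurable κ := by
    have : Continuous fun ξ : WithLp 2 (ℝ × ℝ) => ξ.fst := by fun_prop
    exact (this.measurable.const_mul _).neg
  have := isFiniteMeasure_withDensity_ofReal hFi.2
  refine ⟨(volume.withDensity fun ξ => ENNReal.ofReal (‖F ξ‖ ^ 2)).map κ, inferInstance,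
    fun s => ?_⟩
  rw [integral_map hκ.aemeasurable (Continuous.aestronglyMeasurable (by fun_prop)),
    integral_withDensity_eq_integral_toReal_smul hFm
    (Filter.Eventually.of_forall fun _ => ENNReal.ofReal_lt_top),
    ← J.inner_map_map, hJs, inner_translate]
  refine integral_congr_ae (Filter.Eventually.of_forall fun ξ => ?_)
  simp only
  rw [ENNReal.toReal_ofReal (by positivity), Complex.real_smul, mul_comm]
  congr 2
  simp only [κ, WithLp.prod_inner_apply]
  simp
  field_simp

end SpectralMeasure

end ClockEngine

namespace ClockEngine

/-! ### Mean energies -/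

section MeanEnergy

lemma integrable_cexp_measure {ν : Measure ℝ} [IsFiniteMeasure ν] (ħ s : ℝ) :
    Integrable (fun a : ℝ => Complex.exp (-(Complex.I * s * a / ħ))) ν := by
  refine Integrable.of_bound (Continuous.aestronglyMeasurable (by fun_prop)) 1
    (Filter.Eventually.of_forall fun a => ?_)
  have : -(Complex.I * s * a / ħ) = ((-(s * a / ħ) : ℝ) : ℂ) * Complex.I := by push_cast; ring
  rw [this, Complex.norm_exp_ofReal_mul_I]

/-- The characteristic function at `t` is the integral at `s = -t ħ`. This makes the distribution in
`HasExpectation` unique. -/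
lemma measure_eq_of_integral_cexp {ħ : ℝ} (hħ : ħ ≠ 0) {μ ν : Measure ℝ} [IsFiniteMeasure μ]
    [IsFiniteMeasure ν] (h : ∀ s : ℝ, ∫ a : ℝ, Complex.exp (-(Complex.I * s * a / ħ)) ∂μ =
      ∫ a : ℝ, Complex.exp (-(Complex.I * s * a / ħ)) ∂ν) : μ = ν := by
  have hħ' : (ħ : ℂ) ≠ 0 := by exact_mod_cast hħ
  refine Measure.ext_of_charFun (funext fun t => ?_)
  have h1 := h (-(t * ħ))
  rw [charFun_apply_real, charFun_apply_real]
  have h2 : ∀ a : ℝ, -(Complex.I * ((-(t * ħ) : ℝ) : ℂ) * a / ħ) = t * a * Complex.I := by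
    intro a
    push_cast
    field_simp
  simpa only [h2] using h1

variable {n : Type*} [Fintype n] {ħ : ℝ}

lemma integral_cexp_sum {M : n → Measure ℝ} [∀ j, IsFiniteMeasure (M j)] (s : ℝ) :
    ∫ a : ℝ, Complex.exp (-(Complex.I * s * a / ħ)) ∂(∑ j, M j) =
      ∑ j, ∫ a : ℝ, Complex.exp (-(Complex.I * s * a / ħ)) ∂(M j) :=
  integral_finsetSum_measure fun _ _ => integrable_cexp_measure ħ s

lemma integral_cexp_map_add (M : Measure ℝ) (e s : ℝ) :
    ∫ a : ℝ, Complex.exp (-(Complex.I * s * a / ħ)) ∂(M.map fun a => a + e) =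
      Complex.exp (-(Complex.I * s * e / ħ)) * ∫ a : ℝ, Complex.exp (-(Complex.I * s * a / ħ)) ∂M := by
  rw [integral_map (by fun_prop) (Continuous.aestronglyMeasurable (by fun_prop)),
    ← integral_const_mul]
  refine integral_congr_ae (Filter.Eventually.of_forall fun a => ?_)
  simp only
  rw [← Complex.exp_add]
  congr 1
  push_cast
  ring

lemma integrable_id_map_add {M : Measure ℝ} [IsFiniteMeasure M] (e : ℝ) :
    Integrable (fun a : ℝ => a) (M.map fun a => a + e) ↔ Integrable (fun a : ℝ => a) M := by
  rw [integrable_map_measure (Continuous.aestronglyMeasurable (by fun_prop)) (by fun_prop)]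
  constructor
  · intro h
    have := h.sub (integrable_const e)
    simpa [Function.comp_def, Pi.sub_def] using this
  · intro h
    exact h.add (integrable_const e)

lemma integral_id_map_add {M : Measure ℝ} [IsFiniteMeasure M] (e : ℝ)
    (h : Integrable (fun a : ℝ => a) M) :
    ∫ a : ℝ, a ∂(M.map fun a => a + e) = (∫ a : ℝ, a ∂M) + e * M.real Set.univ := by
  rw [integral_map (by fun_prop) (Continuous.aestronglyMeasurable (by fun_prop)), integral_add h (integrable_const e),
    integral_const, smul_eq_mul, mul_comm]

variable [DecidableEq n]

/-- The component of a wave function along the `j`-th column of `Q`. -/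
noncomputable def comp (Q : Matrix n n ℂ) (j : n) : Total n →L[ℂ] WeightClock :=
  coordOp j ∘L matOp (star Q)

lemma coeFn_comp (Q : Matrix n n ℂ) (j : n) (ψ : Total n) :
    comp Q j ψ =ᵐ[volume] fun z =>
      (Matrix.toEuclideanCLM (n := n) (𝕜 := ℂ) (star Q) (ψ z)) j := by
  filter_upwards [coeFn_coordOp j (matOp (star Q) ψ), coeFn_matOp (star Q) ψ] with z h1 h2
  rw [comp, ContinuousLinearMap.comp_apply, h1, h2]

lemma comp_shift (Q : Matrix n n ℂ) (j : n) (v : ℝ × ℝ) (ψ : Total n) :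
    comp Q j (shift v ψ) = wcShift v (comp Q j ψ) := by
  refine Lp.ext ?_
  filter_upwards [coeFn_comp Q j (shift v ψ), coeFn_shift v ψ, coeFn_wcShift v (comp Q j ψ),
    ae_comp_add (coeFn_comp Q j ψ) v] with z h1 h2 h3 h4
  rw [h1, h2, h3, h4]

lemma comp_eq_sum (Q : Matrix n n ℂ) (j : n) (ψ : Total n) :
    comp Q j ψ = ∑ a, (starRingEnd ℂ) (Q a j) • coordOp a ψ := by
  refine Lp.ext ?_
  have h0 : ∀ᵐ z, ∀ a, ((starRingEnd ℂ) (Q a j) • coordOp a ψ : WeightClock) z =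
      (starRingEnd ℂ) (Q a j) * ψ z a := by
    refine ae_all_iff.2 fun a => ?_
    filter_upwards [Lp.coeFn_smul ((starRingEnd ℂ) (Q a j)) (coordOp a ψ), coeFn_coordOp a ψ]
      with z h1 h2
    rw [h1, Pi.smul_apply, h2, smul_eq_mul]
  filter_upwards [coeFn_comp Q j ψ, h0, Lp.coeFn_finsetSum Finset.univ
    fun a => (starRingEnd ℂ) (Q a j) • coordOp a ψ] with z h1 h2 h3
  rw [h1, h3, Finset.sum_apply, Matrix.ofLp_toEuclideanCLM, Matrix.mulVec, dotProduct]
  exact Finset.sum_congr rfl fun a _ => (h2 a).symm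

variable {Q Hs : Matrix n n ℂ} {ε : n → ℝ}

lemma Diagonalizes.comp_matOp_exp (hQ : Diagonalizes Q ε Hs) (c : ℂ) (j : n) (ψ : Total n) :
    comp Q j (matOp (NormedSpace.exp (c • Hs)) ψ) = Complex.exp (c * ε j) • comp Q j ψ := by
  have h : star Q * NormedSpace.exp (c • Hs) =
      Matrix.diagonal (fun i => Complex.exp (c * ε i)) * star Q := by
    rw [hQ.exp_smul, ← mul_assoc, ← mul_assoc, hQ.star_mul_self, one_mul]
  refine Lp.ext ?_
  filter_upwards [coeFn_comp Q j (matOp (NormedSpace.exp (c • Hs)) ψ),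
    coeFn_matOp (NormedSpace.exp (c • Hs)) ψ, coeFn_comp Q j ψ,
    Lp.coeFn_smul (Complex.exp (c * ε j)) (comp Q j ψ)] with z h1 h2 h3 h4
  rw [h1, h2, h4, Pi.smul_apply, h3, ← mul_apply_eq_comp, ← map_mul, h, map_mul, mul_apply_eq_comp,
    Matrix.ofLp_toEuclideanCLM, Matrix.mulVec_diagonal, smul_eq_mul]

lemma inner_eq_sum_comp (hQ : Q ∈ Matrix.unitaryGroup n ℂ) (ψ θ : Total n) :
    ⟪ψ, θ⟫_ℂ = ∑ j, ⟪comp Q j ψ, comp Q j θ⟫_ℂ := by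
  have h : ∀ x y : EuclideanSpace ℂ n, ⟪x, y⟫_ℂ =
      ⟪Matrix.toEuclideanCLM (n := n) (𝕜 := ℂ) (star Q) x,
        Matrix.toEuclideanCLM (n := n) (𝕜 := ℂ) (star Q) y⟫_ℂ := by
    intro x y
    rw [← ContinuousLinearMap.adjoint_inner_right, ← ContinuousLinearMap.star_eq_adjoint,
      ← map_star, star_star, ← mul_apply_eq_comp, ← map_mul, Matrix.mem_unitaryGroup_iff.1 hQ,
      map_one, one_apply_eq_self]
  simp only [L2.inner_def]
  rw [← integral_finsetSum _ fun j _ => L2.integrable_inner (𝕜 := ℂ) (comp Q j ψ) (comp Q j θ)]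
  refine integral_congr_ae ?_
  filter_upwards [ae_all_iff.2 fun j => coeFn_comp Q j ψ, ae_all_iff.2 fun j => coeFn_comp Q j θ]
    with z h1 h2
  rw [h, PiLp.inner_apply]
  exact Finset.sum_congr rfl fun j _ => by rw [h1 j, h2 j]

variable {ι : Type*} [Countable ι] {φ : ι → Total n} {ρ : Total n →L[ℂ] Total n}

/-- The distribution of the weight's position, conditioned on an eigenbasis of `Hs`. -/
lemma IsEnsemble.exists_measures (hħ : ħ ≠ 0) (hQ : Diagonalizes Q ε Hs) (h : IsEnsemble φ ρ) :
    ∃ M : n → Measure ℝ, (∀ j, IsFiniteMeasure (M j)) ∧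
      (∀ j, (M j).real Set.univ = ((star Q * traceWC ρ * Q) j j).re) ∧
      (∀ s : ℝ, opTrace (ρ * shiftP s) =
        ∑ j, ∫ a : ℝ, Complex.exp (-(Complex.I * s * a / ħ)) ∂(M j)) ∧
      ∀ s : ℝ, opTrace (ρ * engineGroup ħ Hs s) = ∑ j, Complex.exp (-(Complex.I * s * ε j / ħ)) *
        ∫ a : ℝ, Complex.exp (-(Complex.I * s * a / ħ)) ∂(M j) := by
  choose m hmf hm using fun χ => exists_spectralMeasure hħ χ
  have hm1 : ∀ χ, m χ Set.univ = ENNReal.ofReal (‖χ‖ ^ 2) := by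
    intro χ
    have h1 := hm χ 0
    have h2 : wcShift ((0 : ℝ), (0 : ℝ)) χ = χ := by
      refine Lp.ext ?_
      filter_upwards [coeFn_wcShift (0, 0) χ] with z hz
      rw [hz, Prod.mk_zero_zero, add_zero]
    rw [h2] at h1
    simp only [Complex.ofReal_zero, mul_zero, zero_mul, zero_div, neg_zero, Complex.exp_zero,
      integral_const, Complex.real_smul, mul_one] at h1
    have h3 : (m χ).real Set.univ = ‖χ‖ ^ 2 :=
      (congrArg Complex.re h1).trans (inner_self_eq_norm_sq (𝕜 := ℂ) χ)
    rw [← h3, ofReal_measureReal]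
  -- Spectral measures of the components along the `j`-th eigenvector, added over the ensemble. The
  -- total mass of `M j` is the `j`-th population of the reduced state.
  set M : n → Measure ℝ := fun j => Measure.sum fun l => m (comp Q j (φ l)) with hM
  have hsum : ∀ j, Summable fun l => ‖comp Q j (φ l)‖ ^ 2 := fun j =>
    summable_norm_sq_apply _ h.summable
  have hMu : ∀ j, M j Set.univ = ENNReal.ofReal (∑' l, ‖comp Q j (φ l)‖ ^ 2) := by
    intro j
    rw [hM, Measure.sum_apply _ MeasurableSet.univ,
      ENNReal.ofReal_tsum_of_nonneg (fun _ => by positivity) (hsum j)]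
    simp only [hm1]
  have hMf : ∀ j, IsFiniteMeasure (M j) := fun j => ⟨by
    rw [hMu]; exact ENNReal.ofReal_lt_top⟩
  have hint : ∀ (j : n) (s : ℝ), HasSum
      (fun l => ⟪comp Q j (φ l), wcShift (s, 0) (comp Q j (φ l))⟫_ℂ)
      (∫ a : ℝ, Complex.exp (-(Complex.I * s * a / ħ)) ∂(M j)) := by
    intro j s
    have := hasSum_integral_measure (μ := fun l => m (comp Q j (φ l)))
      (f := fun a : ℝ => Complex.exp (-(Complex.I * s * a / ħ)))
      (by
        have := hMf j
        exact integrable_cexp_measure (ν := M j) ħ s)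
    simpa only [hm] using this
  refine ⟨M, hMf, fun j => ?_, fun s => ?_, fun s => ?_⟩
  · rw [measureReal_def, hMu, ENNReal.toReal_ofReal (tsum_nonneg fun _ => by positivity)]
    have h1 : ∀ a c, HasSum (fun l => ⟪coordOp c (φ l), coordOp a (φ l)⟫_ℂ) (traceWC ρ a c) := by
      intro a c
      have := hasSum_integral_mul_conj h.summable a c (c := fun _ => 1) aestronglyMeasurable_const
        (C := 1) (by simp)
      simp only [one_mul] at this
      rw [h.traceWC_apply]
      simpa only [inner_coordOp] using this
    have h2 : HasSum (fun l => ∑ c, ∑ a, (starRingEnd ℂ) (Q a j) *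
        ⟪coordOp c (φ l), coordOp a (φ l)⟫_ℂ * Q c j) ((star Q * traceWC ρ * Q) j j) := by
      rw [Matrix.mul_apply]
      simp only [Matrix.mul_apply, Finset.sum_mul]
      exact hasSum_sum fun c _ => hasSum_sum fun a _ => ((h1 a c).mul_left _).mul_right _
    rw [← (Complex.hasSum_re h2).tsum_eq]
    refine tsum_congr fun l => ?_
    rw [← inner_self_eq_norm_sq (𝕜 := ℂ), comp_eq_sum, sum_inner]
    change Complex.re _ = _
    congr 1
    refine Finset.sum_congr rfl fun c _ => ?_
    rw [inner_sum]
    refine Finset.sum_congr rfl fun a _ => ?_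
    rw [inner_smul_left, inner_smul_right, Complex.conj_conj]
    ring
  · rw [h.opTrace_mul, ← (hasSum_sum fun j _ => hint j s).tsum_eq]
    refine tsum_congr fun l => ?_
    rw [inner_eq_sum_comp hQ.unitary]
    simp only [shiftP_eq, comp_shift]
  · rw [h.opTrace_mul, ← (hasSum_sum fun j _ => (hint j s).mul_left
      (Complex.exp (-(Complex.I * s * ε j / ħ)))).tsum_eq]
    refine tsum_congr fun l => ?_
    rw [inner_eq_sum_comp hQ.unitary]
    refine Finset.sum_congr rfl fun j _ => ?_
    rw [engineGroup, mul_apply_eq_comp, hQ.comp_matOp_exp, shiftP_eq, comp_shift, inner_smul_right]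
    congr 2
    ring

/-- The mean energy of the engine is that of the system plus that of the weight. -/
lemma IsEnsemble.hasExpectation_engineGroup_iff (hħ : ħ ≠ 0) (hHs : Hs.IsHermitian)
    (h : IsEnsemble φ ρ) (w : ℝ) :
    HasExpectation ħ (engineGroup ħ Hs) ρ (w + energy Hs (traceWC ρ)) ↔
      HasExpectation ħ shiftP ρ w := by
  obtain ⟨Q, hQ⟩ := exists_diagonalizes hHs
  obtain ⟨M, hMf, hM1, hMs, hMe⟩ := h.exists_measures hħ hQ
  -- `A` is the distribution of `H_w`. In `B`, the distribution of `H_e`, each part is displaced by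
  -- the corresponding eigenvalue of `Hs`.
  set A : Measure ℝ := ∑ j, M j with hA
  set B : Measure ℝ := ∑ j, (M j).map fun a => a + hHs.eigenvalues j with hB
  have hAB : A Set.univ = B Set.univ := by
    rw [hA, hB, Measure.finsetSum_apply, Measure.finsetSum_apply]
    refine Finset.sum_congr rfl fun j _ => ?_
    rw [Measure.map_apply (by fun_prop) MeasurableSet.univ, Set.preimage_univ]
  have hAc : ∀ s : ℝ, ∫ a : ℝ, Complex.exp (-(Complex.I * s * a / ħ)) ∂A =
      opTrace (ρ * shiftP s) := fun s => by
    rw [hMs]; exact integral_cexp_sum s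
  have hBc : ∀ s : ℝ, ∫ a : ℝ, Complex.exp (-(Complex.I * s * a / ħ)) ∂B =
      opTrace (ρ * engineGroup ħ Hs s) := fun s => by
    rw [hMe, hB, integral_cexp_sum s]
    exact Finset.sum_congr rfl fun j _ => integral_cexp_map_add _ _ _
  have hAi : Integrable (fun a : ℝ => a) A ↔ ∀ j, Integrable (fun a : ℝ => a) (M j) := by
    simp [hA, integrable_finsetSum_measure]
  have hBi : Integrable (fun a : ℝ => a) B ↔ ∀ j, Integrable (fun a : ℝ => a) (M j) := by
    simp [hB, integrable_finsetSum_measure, integrable_id_map_add]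
  -- The displacements change the mean by the sum of eigenvalues times populations, which is the
  -- system energy.
  have hmean : (∀ j, Integrable (fun a : ℝ => a) (M j)) →
      ∫ a : ℝ, a ∂B = (∫ a : ℝ, a ∂A) + energy Hs (traceWC ρ) := by
    intro hi
    rw [hA, hB, integral_finsetSum_measure fun j _ => (integrable_id_map_add _).2 (hi j),
      integral_finsetSum_measure fun j _ => hi j, hQ.energy_eq, ← Finset.sum_add_distrib]
    refine Finset.sum_congr rfl fun j _ => ?_
    rw [integral_id_map_add _ (hi j), hM1]
  have hAf : IsFiniteMeasure A := by rw [hA]; infer_instance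
  have hBf : IsFiniteMeasure B := ⟨by rw [← hAB]; exact measure_lt_top A _⟩
  constructor
  · rintro ⟨ν, hν, hc, hi, hw⟩
    obtain rfl : ν = B := measure_eq_of_integral_cexp hħ fun s => by rw [hc, hBc]
    have hi' := hBi.1 hi
    refine ⟨A, ⟨hAB.trans hν.measure_univ⟩, hAc, hAi.2 hi', ?_⟩
    rw [hmean hi'] at hw
    linarith
  · rintro ⟨ν, hν, hc, hi, hw⟩
    obtain rfl : ν = A := measure_eq_of_integral_cexp hħ fun s => by rw [hc, hAc]
    have hi' := hAi.1 hi
    refine ⟨B, ⟨hAB.symm.trans hν.measure_univ⟩, hBc, hBi.2 hi', ?_⟩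
    rw [hmean hi', hw]

end MeanEnergy

end ClockEngine

namespace ClockEngine

/-! ### The reduced state of the system -/

section Reduced

variable {n : Type*} [Fintype n] [DecidableEq n] {ι : Type*} [Countable ι] {φ : ι → Total n}
  {ρ : Total n →L[ℂ] Total n} {σ : Matrix n n ℂ} {ρw ρc : Line →L[ℂ] Line}
  {U : ℝ → Total n →L[ℂ] Total n}

lemma IsEnsemble.traceWC_eq (hφ : IsEnsemble φ ρ) (hφ1 : ∑' l, ‖φ l‖ ^ 2 = 1)
    (h : IsProductOperator ρ σ ρw ρc) (hσ : σ.trace = 1) : traceWC ρ = σ := by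
  ext i j
  rw [hφ.traceWC_apply, integral_congr_ae (h.ae_ensembleMatrix hσ hφ i j), integral_const_mul,
    integral_complex_ofReal, integral_ensembleDensity hφ.summable, hφ1, Complex.ofReal_one, mul_one]

/-- Translation invariance of Lebesgue measure absorbs the displacement of weight and clock, which
leaves only the conjugation by the fibres. -/
lemma IsEnsemble.traceWC_evolve (hφ : IsEnsemble φ ρ) (h : IsProductOperator ρ σ ρw ρc)
    (hσ : σ.trace = 1) {V : ℝ × ℝ → Matrix n n ℂ} {v : ℝ × ℝ} {t : ℝ}
    (hV : ∀ ψ, ∀ᵐ z, U t ψ (z + v) = Matrix.toEuclideanCLM (n := n) (𝕜 := ℂ) (V z) (ψ z))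
    (i j : n) : ClockEngine.traceWC (ClockEngine.evolve U ρ t) i j =
      ∫ z, (ensembleDensity φ z : ℂ) * (V z * σ * star (V z)) i j := by
  rw [(hφ.evolve U t).traceWC_apply,
    ← integral_add_right_eq_self (fun z => ensembleMatrix (fun l => U t (φ l)) z i j) v]
  refine integral_congr_ae ?_
  filter_upwards [ae_ensembleMatrix_fibres hV hφ.summable i j,
    ae_all_iff.2 fun a => ae_all_iff.2 fun c => h.ae_ensembleMatrix hσ hφ a c] with z h1 h2
  rw [h1]
  have h3 : (Matrix.of fun a c => ensembleMatrix φ z a c) = (ensembleDensity φ z : ℂ) • σ := by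
    ext a c
    rw [Matrix.of_apply, h2, Matrix.smul_apply, smul_eq_mul, mul_comm]
  rw [h3, Matrix.mul_smul, Matrix.smul_mul, Matrix.smul_apply, smul_eq_mul]

/-- A group commuting with `U t` has the same characteristic function in the evolved state, so the
same measure `ν` serves at both times. -/
lemma IsEnsemble.hasExpectation_evolve (hφ : IsEnsemble φ ρ) (hU : IsUnitaryGroup U)
    {G : ℝ → Total n →L[ℂ] Total n} {t : ℝ} (hG : ∀ s, U t * G s = G s * U t) {ħ w : ℝ}
    (h : HasExpectation ħ G ρ w) : HasExpectation ħ G (ClockEngine.evolve U ρ t) w := by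
  obtain ⟨ν, hν, hc, hi, hw⟩ := h
  refine ⟨ν, hν, fun s => ?_, hi, hw⟩
  rw [hc, hφ.opTrace_mul, (hφ.evolve U t).opTrace_mul]
  refine tsum_congr fun l => ?_
  rw [← mul_apply_eq_comp (G s), ← hG, mul_apply_eq_comp, hU.inner_map]

lemma isHermitian_systemHamiltonian {u b : Type*} [Fintype u] [DecidableEq u] [Fintype b]
    [DecidableEq b] {Hu : Matrix u u ℂ} {Hb : Matrix b b ℂ} (hHu : Hu.IsHermitian)
    (hHb : Hb.IsHermitian) : (systemHamiltonian Hu Hb).IsHermitian := by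
  rw [Matrix.IsHermitian, systemHamiltonian, Matrix.conjTranspose_add,
    Matrix.conjTranspose_kronecker, Matrix.conjTranspose_kronecker, hHu.eq, hHb.eq,
    Matrix.conjTranspose_one, Matrix.conjTranspose_one]

lemma IsDensityMatrix.kronecker {u b : Type*} [Fintype u] [DecidableEq u] [Fintype b]
    [DecidableEq b] {σ : Matrix u u ℂ} {τ : Matrix b b ℂ} (hσ : IsDensityMatrix σ)
    (hτ : IsDensityMatrix τ) : IsDensityMatrix (σ ⊗ₖ τ) :=
  ⟨hσ.1.kronecker hτ.1, by rw [Matrix.trace_kronecker, hσ.2, hτ.2, one_mul]⟩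

end Reduced

end ClockEngine

open ClockEngine in
theorem mainTheorem4 {u b : Type*} [Fintype u] [DecidableEq u] [Fintype b] [DecidableEq b]
    [Nonempty b] (ħ k T : ℝ) (hħ : 0 < ħ) (hk : 0 < k) (hT : 0 < T)
    (Hu : Matrix u u ℂ) (hHu : Hu.IsHermitian) (Hb : Matrix b b ℂ) (hHb : Hb.IsHermitian)
    (Hint : Total (u × b) →ₗ.[ℂ] Total (u × b)) (hHint : IsSelfAdjoint Hint)
    (he : StronglyCommutes Hint (engineGroup ħ (systemHamiltonian Hu Hb)))
    (hXc : StronglyCommutes Hint phaseX) (hPw : StronglyCommutes Hint phaseP)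
    (U : ℝ → Total (u × b) →L[ℂ] Total (u × b))
    (hU : IsEvolution ħ (totalHamiltonian ħ (systemHamiltonian Hu Hb) Hint) U) :
    ∃ V : ℝ → ℝ → ℝ → Matrix (u × b) (u × b) ℂ,
      -- the `V x p t` are unitary, and depend on the Hamiltonian only
      (∀ x p t, V x p t ∈ Matrix.unitaryGroup (u × b) ℂ) ∧
      (∀ t i j, Measurable fun z : ℝ × ℝ => V z.2 z.1 t i j) ∧
      -- they are the fibres of the evolution, up to the displacement of weight and clock
      (∀ (t : ℝ) (ψ : Total (u × b)), ∀ᵐ z : ℝ × ℝ,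
        U t ψ (z + (-t, t)) =
          Matrix.toEuclideanCLM (n := u × b) (𝕜 := ℂ) (V z.2 z.1 t) (ψ z)) ∧
      ∀ (ρu : Matrix u u ℂ) (ρw ρc : Line →L[ℂ] Line)
        (ρ₀ : Total (u × b) →L[ℂ] Total (u × b)),
        IsDensityMatrix ρu → IsDensityOperator ρw → IsDensityOperator ρc →
        IsDensityOperator ρ₀ →
        IsProductOperator ρ₀ (ρu ⊗ₖ thermalState k T Hb) ρw ρc →
        -- the reduced state is a mixture of unitaries applied to the initial state
        (∃ μ : ℝ × ℝ → ℝ, IsJointDensity ρ₀ μ ∧ ∀ t i j,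
          Integrable (fun z : ℝ × ℝ => (μ z : ℂ) *
            (V z.2 z.1 t * (ρu ⊗ₖ thermalState k T Hb) * star (V z.2 z.1 t)) i j) ∧
          traceWC (evolve U ρ₀ t) i j = ∫ z : ℝ × ℝ, (μ z : ℂ) *
            (V z.2 z.1 t * (ρu ⊗ₖ thermalState k T Hb) * star (V z.2 z.1 t)) i j) ∧
        -- entropies and free energy of the bath
        (∀ t : ℝ,
          let ρb := thermalState k T Hb
          let ρub' := traceWC (evolve U ρ₀ t)
          let ρu' := traceB ρub'
          let ρb' := traceU ρub'
          0 ≤ entropy k ρub' - entropy k (ρu ⊗ₖ ρb) ∧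
          -(entropy k ρb' - entropy k ρb) ≤ entropy k ρu' - entropy k ρu ∧
          0 ≤ freeEnergy k T Hb ρb' - freeEnergy k T Hb ρb ∧
          T * (entropy k ρb' - entropy k ρb) ≤ energy Hb ρb' - energy Hb ρb) ∧
        -- if the initial mean energy of the weight is finite: first law and bounds on the work
        (∀ Ew₀ : ℝ, HasExpectation ħ shiftP ρ₀ Ew₀ →
          ∀ t : ℝ, ∃ Ew : ℝ, HasExpectation ħ shiftP (evolve U ρ₀ t) Ew ∧
            (∃ Ee : ℝ,
              HasExpectation ħ (engineGroup ħ (systemHamiltonian Hu Hb)) ρ₀ Ee ∧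
              HasExpectation ħ (engineGroup ħ (systemHamiltonian Hu Hb)) (evolve U ρ₀ t) Ee) ∧
            (let ρb := thermalState k T Hb
             let ρub' := traceWC (evolve U ρ₀ t)
             let ρu' := traceB ρub'
             let ρb' := traceU ρub'
             let ΔU := energy Hu ρu' - energy Hu ρu
             let W := Ew - Ew₀
             let Q := energy Hb ρb' - energy Hb ρb
             let ΔFu := freeEnergy k T Hu ρu' - freeEnergy k T Hu ρu
             ΔU + W + Q = 0 ∧
             W ≤ -(T * (entropy k ρb' - entropy k ρb)) - ΔU ∧
             W ≤ -ΔFu ∧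
             (ΔFu = 0 → W ≤ 0))) := by
  choose V hVu hVm hVU using fun t => hU.exists_fibres hħ hXc hPw t
  -- The fibres were chosen before any state is introduced, so they depend on the Hamiltonian only.
  refine ⟨fun x p t => V t (p, x), fun x p t => hVu t (p, x), fun t i j => hVm t i j, hVU, ?_⟩
  intro ρu ρw ρc ρ₀ hρu hρw hρc hρ₀ hprod
  obtain ⟨ι, φ, hι, hφ, hφ1⟩ := exists_isEnsemble hρ₀
  have hρb : IsDensityMatrix (thermalState k T Hb) := isDensityMatrix_thermalState hHb
  have hσ := hρu.kronecker hρb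
  have hred : ∀ t i j, traceWC (evolve U ρ₀ t) i j =
      ∫ z, (ensembleDensity φ z : ℂ) * (V t z * (ρu ⊗ₖ thermalState k T Hb) * star (V t z)) i j :=
    fun t i j => hφ.traceWC_evolve hprod hσ.2 (hVU t) i j
  have hμ := integrable_ensembleDensity hφ.summable
  have hmix := fun t => isDensityMatrix_and_entropy_le_of_mixture ensembleDensity_nonneg hμ
    ((integral_ensembleDensity hφ.summable).trans hφ1) (hVm t) (hVu t) hσ (hred t) hk.le
  have hS : ∀ t, -(entropy k (traceU (traceWC (evolve U ρ₀ t))) - entropy k (thermalState k T Hb)) ≤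
      entropy k (traceB (traceWC (evolve U ρ₀ t))) - entropy k ρu := by
    intro t
    have h1 := (hmix t).2
    have h2 := entropy_le_add (hmix t).1 hk.le
    rw [entropy_kronecker hρu hρb] at h1
    linarith
  have hF : ∀ t, freeEnergy k T Hb (thermalState k T Hb) ≤
      freeEnergy k T Hb (traceU (traceWC (evolve U ρ₀ t))) := fun t =>
    freeEnergy_thermalState_le hk hT hHb (isDensityMatrix_traceU (hmix t).1)
  have hQ : ∀ t, T * (entropy k (traceU (traceWC (evolve U ρ₀ t))) -
      entropy k (thermalState k T Hb)) ≤
      energy Hb (traceU (traceWC (evolve U ρ₀ t))) - energy Hb (thermalState k T Hb) := by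
    intro t
    have h1 := hF t
    simp only [freeEnergy] at h1
    linarith
  refine ⟨⟨ensembleDensity φ, hφ.isJointDensity, fun t i j =>
    ⟨integrable_mul_conj_entry hμ (hVm t) (hVu t) _ i j, hred t i j⟩⟩, fun t => ?_, ?_⟩
  · exact ⟨sub_nonneg.2 (hmix t).2, hS t, sub_nonneg.2 (hF t), hQ t⟩
  intro Ew₀ hEw₀ t
  have hHs := isHermitian_systemHamiltonian hHu hHb
  have he₀ := (hφ.hasExpectation_engineGroup_iff hħ.ne' hHs Ew₀).2 hEw₀
  have het := hφ.hasExpectation_evolve hU.1 (fun s => hU.mul_engineGroup hħ he t s) he₀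
  -- The mean weight energy at time `t` is the conserved mean of `H_e` minus the system energy at
  -- time `t`; finiteness comes from the same equivalence, read backwards.
  have hwt := ((hφ.evolve U t).hasExpectation_engineGroup_iff hħ.ne' hHs
    (Ew₀ + energy (systemHamiltonian Hu Hb) (traceWC ρ₀) -
      energy (systemHamiltonian Hu Hb) (traceWC (evolve U ρ₀ t)))).1 (by rwa [sub_add_cancel])
  refine ⟨_, hwt, ⟨_, he₀, het⟩, ?_⟩
  rw [hφ.traceWC_eq hφ1 hprod hσ.2, energy_systemHamiltonian, energy_systemHamiltonian,
    traceB_kronecker ρu hρb.2, traceU_kronecker (thermalState k T Hb) hρu.2]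
  have h1 := hQ t
  -- With `W = -ΔU - Q`, the inequality `Q ≥ T ΔS(ρ_b)` gives the first bound on the work, and `T
  -- ΔS(ρ_u) ≥ -T ΔS(ρ_b)` turns it into the bound by the free energy of `u`.
  have h2 := mul_le_mul_of_nonneg_left (hS t) hT.le
  dsimp only [freeEnergy]
  refine ⟨by ring, by linarith, by linarith, fun h => by linarith⟩
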